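/- Let $\Bbbk$ be an algebraically closed field of characteristic $0$. Let $\Gamma=(V,H,s,\iota,\rho)$ be a connected ribbon graph: $V$ and $H$ are finite sets (vertices and half-edges), $s:H\to V$ is a map, $\iota$ is a fixed-point-free involution of $H$, and $\rho$ is a permutation of $H$ whose cycles are exactly the non-empty sets $H_v=s^{-1}(v)$, $v\in V$. Let $\mathbb m:V\to\mathbb Z_{>0}$ be a multiplicity function. Write $h^{+}=\rho(h)$, $h^-=\rho^{-1}(h)$, $\bar h=\{h,\iota(h)\}$ for the edge of $h$, $E$ for the set of edges, and $\mathrm{val}(v)=|H_v|$; a vertex $v$ is truncated if $\mathbb m(v)=\mathrm{val}(v)=1$. Assume that $\Gamma$ is bipartite with $V=V_1\sqcup V_2$, i.e. every edge connects $V_1$ with $V_2$. The quiver $Q_\Gamma$ has vertex set $E$ and one arrow $\alpha_h:\bar h\to\overline{h^+}$ for each $h\in H$ (an arrow around $s(h)$). Paths are written from right to left, and $e_{\bar h}$ is the trivial path at $\bar h$. Put $\sigma(\alpha_h)=\alpha_{h^-}$, and for an arrow $\alpha$ around $v$ put $C_\alpha=\alpha\sigma(\alpha)\cdots\sigma^{\mathrm{val}(v)-1}(\alpha)$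 and $\mathbb m(C_\alpha)=\mathbb m(v)$; this is a cycle at the target of $\alpha$, so the cycle around $s(h)$ starting from $\bar h$ is $C_{\sigma(\alpha_h)}$. The Brauer graph algebra is $B_\Gamma=\Bbbk Q_\Gamma/I_\Gamma$, where $I_\Gamma$ is generated by all $\alpha\beta$ with $\alpha,\beta$ composable arrows, $\beta\ne\sigma(\alpha)$, and by $C_\alpha^{\mathbb m(C_\alpha)}-C_\beta^{\mathbb m(C_\beta)}$ for each edge $\bar h$, where $C_\alpha=C_{\sigma(\alpha_h)}$ and $C_\beta=C_{\sigma(\alpha_{\iota(h)})}$ are the two cycles starting from $\bar h$. Let $Q'$ be obtained from $Q_\Gamma$ by removing the loops at the truncated vertices in $V_1$; then $B_\Gamma$ is also a quotient of $\Bbbk Q'$. The reduction system $R_\Gamma$ consists of the pairs $(s,\varphi_s)$: (a) $(C_\alpha^{\mathbb m(v)},C_\beta^{\mathbb m(w)})$ for each edge $\bar h$ connecting a non-truncated $v\in V_1$ with $w\in V_2$, where $C_\alpha$, $C_\beta$ are the cycles starting from $\bar h$ around $v$ and $w$; (b) $(C_{\alpha_h}^{\mathbb m(s(h))}\alpha_h,0)$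 for each $h\in H$ with $s(h)\in V_2$; (c) $(\alpha\beta,0)$ for composable arrows $\alpha,\beta$ of $Q'$ with $\sigma(\alpha)\neq\beta$. Let $S$ be the set of the paths $s$. The cochain complex $$\mathrm{Hom}_{\Bbbk Q_0^e}(\Bbbk Q'_1,B_\Gamma)\xrightarrow{\partial^1}\mathrm{Hom}_{\Bbbk Q_0^e}(\Bbbk S,B_\Gamma)\xrightarrow{\partial^2}\cdots$$ is obtained from the Chouhy–Solotar projective bimodule resolution of $B_\Gamma$ attached to $R_\Gamma$. If $s-\varphi_s=\sum_p c(p)\,p$, then $(\partial^1\psi)(s)=\sum_p c(p)\sum_i \alpha_m\cdots\alpha_{i+1}\psi(\alpha_i)\alpha_{i-1}\cdots\alpha_1$, where $p=\alpha_m\cdots\alpha_1$; and $\ker\partial^2$ consists of the $\tilde\varphi$ whose associated bimodule map $B_\Gamma\otimes\Bbbk S\otimes B_\Gamma\to B_\Gamma$ (tensor products over $\Bbbk Q_0$) vanishes on the kernel of the differential $B_\Gamma\otimes\Bbbk S\otimes B_\Gamma\to B_\Gamma\otimes\Bbbk Q'_1\otimes B_\Gamma$, $1\otimes s\otimes1\mapsto\sum_p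 c(p)\sum_i\alpha_m\cdots\alpha_{i+1}\otimes\alpha_i\otimes\alpha_{i-1}\cdots\alpha_1$. Assume that $B_\Gamma$ is not a local Brauer tree algebra, i.e. $\Gamma$ is not the graph with two vertices, a single edge, and multiplicity $1$ at one of the vertices. Fix a spanning tree $T$ of $\Gamma$. Then the comparison map from the Hochschild complex, $f\mapsto\big(s\mapsto\sum_p c(p)\sum_i e_{t(s)}f(\alpha_m\cdots\alpha_{i+1},\alpha_i)\,\alpha_{i-1}\cdots\alpha_1\big)$ (where $t(s)$ is the target of $s$, and the empty path in the first argument of $f$ is $e_{t(s)}$, the empty path after $\alpha_1$ being the trivial path at the source of $s$), induces an isomorphism $\mathrm{HH}^2(B_\Gamma)\cong\ker\partial^2/\mathrm{im}\,\partial^1$, and $\mathrm{HH}^2(B_\Gamma)$ has a $\Bbbk$-basis represented by the following standard cocycles $\tilde\varphi\in\ker\partial^2$. Each is multiplied by an arbitrary fixed non-zero scalar, which may be chosen differently for different cocycles and is denoted $\lambda,\mu,\varepsilon,\kappa$; values on elements of $S$ that are not mentioned are $0$, and prescribed values on paths that are not in $S$ are omitted. (A) One cocycle: $\tilde\varphi(C_\alpha^{\mathbb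 m(v)})=\lambda e_{\bar h}$ and $\tilde\varphi(C_\beta^{\mathbb m(w)}\beta)=-\lambda\beta$ for all edges $\bar h$ connecting $v\in V_1$ to $w\in V_2$, where $C_\alpha$, $C_\beta$ are the cycles starting from $\bar h$ around $v$ and $w$. (B) For each vertex $v$ and each $1\le i\le\mathbb m(v)-1$ one cocycle: if $v\in V_1$, then $\tilde\varphi(C_\alpha^{\mathbb m(v)})=\mu C_\alpha^i$ for all arrows $\alpha$ around $v$; if $v\in V_2$, then $\tilde\varphi\big(C_{\sigma(\alpha_{\iota(h)})}^{\mathbb m(s(\iota(h)))}\big)=\varepsilon C_{\sigma(\alpha_h)}^i$ and $\tilde\varphi(C_{\alpha_h}^{\mathbb m(v)}\alpha_h)=-\varepsilon C_{\alpha_h}^i\alpha_h$ for all $h\in H_v$. (C) For each edge $\bar h$ not in $T$, connecting $v\in V_1$ to $w\in V_2$, one cocycle: $\tilde\varphi(C_\alpha^{\mathbb m(v)})=\kappa C_\beta^{\mathbb m(w)}$, where $C_\alpha$, $C_\beta$ are the cycles starting from $\bar h$ around $v$ and $w$. The number of these edges is $|E|-|V|+1$. (D) For each pair $h_1,h_2$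 of half-edges at a vertex $w\in V_2$ with $h_1^+=h_2$ and $\iota(h_1)^-=\iota(h_2)$, two cocycles. Put $\beta=\alpha_{h_1}:\bar h_1\to\bar h_2$ and $\alpha=\alpha_{\iota(h_2)}:\bar h_2\to\bar h_1$, so that $\alpha\beta=\beta\alpha=0$ in $B_\Gamma$, and let $\alpha^*$ be the path with $\alpha\alpha^*=C_\alpha^{\mathbb m(C_\alpha)}$. The first cocycle is $\tilde\varphi^1(\alpha\beta)=\lambda e_{\bar h_1}$, $\tilde\varphi^1(\beta\alpha)=\lambda e_{\bar h_2}$, $\tilde\varphi^1(C_\beta^{\mathbb m(w)}\beta)=\lambda\alpha^*$; the second is $\tilde\varphi^2(\beta\alpha)=\kappa C_\beta^{\mathbb m(w)}$. -/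

import Mathlib

open scoped TensorProduct

set_option maxSynthPendingDepth 3

/-! ## Hochschild cohomology in degree two -/

section Hochschild

variable (k A : Type*) [Field k] [Ring A] [Algebra k A]

/-- The Hochschild `2`-cocycles of the `k`-algebra `A`:
bilinear maps `f` with `a f(b,c) - f(ab,c) + f(a,bc) - f(a,b) c = 0`. -/
def hochschildZ2 : Submodule k (A →ₗ[k] A →ₗ[k] A) where
  carrier := {f | ∀ a b c : A, a * f b c - f (a * b) c + f a (b * c) - f a b * c = 0}
  zero_mem' := by intro a b c; simp
  add_mem' := by
    intro f g hf hg a b c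
    have h := congrArg₂ (· + ·) (hf a b c) (hg a b c)
    simp only [add_zero] at h
    rw [← h]
    simp only [LinearMap.add_apply, mul_add, add_mul]
    abel
  smul_mem' := by
    intro r f hf a b c
    have h := congrArg (r • ·) (hf a b c)
    simp only [smul_zero] at h
    rw [← h]
    simp only [LinearMap.smul_apply, mul_smul_comm, smul_mul_assoc, smul_add, smul_sub]

/-- The Hochschild differential in degree one: `(δ g)(a,b) = a g(b) - g(ab) + g(a) b`. -/
def hochschildD1 : (A →ₗ[k] A) →ₗ[k] (A →ₗ[k] A →ₗ[k] A) where
  toFun g := LinearMap.mk₂ k (fun a b => a * g b - g (a * b) + g a * b)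
    (by intro a a' b; simp only [add_mul, map_add]; abel)
    (by intro r a b; simp only [smul_mul_assoc, map_smul, smul_add, smul_sub])
    (by intro a b b'; simp only [mul_add, map_add]; abel)
    (by intro r a b; simp only [mul_smul_comm, map_smul, smul_add, smul_sub])
  map_add' := by
    intro f g
    ext a b
    simp only [LinearMap.mk₂_apply, LinearMap.add_apply, mul_add, add_mul]
    abel
  map_smul' := by
    intro r f
    ext a b
    simp only [LinearMap.mk₂_apply, LinearMap.smul_apply, mul_smul_comm, smul_mul_assoc,
      smul_add, smul_sub, RingHom.id_apply]

/-- The second Hochschild cohomology `HH²(A)` of the `k`-algebra `A` with coefficients in `A`: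
Hochschild `2`-cocycles modulo Hochschild `2`-coboundaries. -/
abbrev HH2 : Type _ :=
  hochschildZ2 k A ⧸ (LinearMap.range (hochschildD1 k A)).submoduleOf (hochschildZ2 k A)

end Hochschild

/-! ## Path algebras -/

section PathAlgebra

variable (k : Type*) [Field k] {E A : Type*} [Finite E]

/-- The defining relations of the path algebra of a quiver with vertices `E`, arrows `A`, source
and target maps `src`, `tgt`, on the trivial paths and the arrows as generators.
Paths are written from right to left, so that an arrow `a` satisfies `e_{tgt a} a e_{src a} = a`. -/
inductive PathRel (src tgt : A → E) : FreeAlgebra k (E ⊕ A) → FreeAlgebra k (E ⊕ A) → Prop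
  | idem (i : E) : PathRel src tgt
      (FreeAlgebra.ι k (Sum.inl i) * FreeAlgebra.ι k (Sum.inl i)) (FreeAlgebra.ι k (Sum.inl i))
  | orth (i j : E) : i ≠ j → PathRel src tgt
      (FreeAlgebra.ι k (Sum.inl i) * FreeAlgebra.ι k (Sum.inl j)) 0
  | one : PathRel src tgt (∑ᶠ i : E, FreeAlgebra.ι k (Sum.inl i)) 1
  | tgt (a : A) : PathRel src tgt
      (FreeAlgebra.ι k (Sum.inl (tgt a)) * FreeAlgebra.ι k (Sum.inr a)) (FreeAlgebra.ι k (Sum.inr a))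
  | src (a : A) : PathRel src tgt
      (FreeAlgebra.ι k (Sum.inr a) * FreeAlgebra.ι k (Sum.inl (src a))) (FreeAlgebra.ι k (Sum.inr a))

/-- The path algebra `kQ` of the quiver `Q` with (finite) vertex set `E` and arrows `A`. -/
abbrev PathAlgebra (src tgt : A → E) : Type _ := RingQuot (PathRel k src tgt)

end PathAlgebra

/-! ## Ribbon graphs and Brauer graphs -/

/-- A ribbon graph with vertices `V` and half-edges `H`. The cycles of the permutation `ρ` are
exactly the (non-empty) sets `H_v = s⁻¹(v)`. -/
structure RibbonGraph (V H : Type*) where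
  s : H → V
  ι : H → H
  ι_involutive : Function.Involutive ι
  ι_ne : ∀ h, ι h ≠ h
  ρ : Equiv.Perm H
  sameCycle_iff : ∀ h h', ρ.SameCycle h h' ↔ s h = s h'
  s_surjective : Function.Surjective s

/-- A Brauer graph: a ribbon graph with a positive multiplicity at each vertex. -/
structure BrauerGraph (V H : Type*) extends RibbonGraph V H where
  m : V → ℕ
  m_pos : ∀ v, 0 < m v

namespace BrauerGraph

variable {V H : Type*} (Γ : BrauerGraph V H)

/-- The two half-edges `h` and `ι h` form an edge. -/
def edgeSetoid : Setoid H where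
  r h h' := h' = h ∨ h' = Γ.ι h
  iseqv :=
    { refl := fun _ => Or.inl rfl
      symm := by
        rintro h h' (rfl | rfl)
        · exact Or.inl rfl
        · exact Or.inr (Γ.ι_involutive h).symm
      trans := by
        rintro h h' h'' (rfl | rfl) (rfl | rfl)
        · exact Or.inl rfl
        · exact Or.inr rfl
        · exact Or.inr rfl
        · exact Or.inl (Γ.ι_involutive h) }

/-- The set `E(Γ)` of edges. -/
def Edge : Type _ := Quotient Γ.edgeSetoid

instance [Finite H] : Finite Γ.Edge := inferInstanceAs (Finite (Quotient Γ.edgeSetoid))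

/-- The edge `h̄ = {h, ι h}`. -/
def edge (h : H) : Γ.Edge := Quotient.mk Γ.edgeSetoid h

/-- The two end points of an edge. -/
def ends : Γ.Edge → Sym2 V :=
  Quotient.lift (fun h => s(Γ.s h, Γ.s (Γ.ι h))) (by
    rintro h h' (rfl | rfl)
    · rfl
    · simp only [Γ.ι_involutive h]
      exact Sym2.eq_swap)

/-- The underlying graph is connected (loops and multiple edges play no role for this). -/
def IsConnected : Prop := (SimpleGraph.fromEdgeSet (Set.range Γ.ends)).Connected

/-- `V = V₁ ⊔ V₁ᶜ` is a bipartition: each edge connects `V₁` with its complement `V₂`. -/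
def IsBipartition (V₁ : Set V) : Prop := ∀ h, Γ.s h ∈ V₁ ↔ Γ.s (Γ.ι h) ∉ V₁

/-- A set `T` of edges is (the edge set of) a spanning tree: it has no loops and no multiple edges,
and the simple graph on all of `V` that it forms is a tree. -/
def IsSpanningTree (T : Set Γ.Edge) : Prop :=
  (∀ i ∈ T, ¬ (Γ.ends i).IsDiag) ∧ Set.InjOn Γ.ends T ∧
    (SimpleGraph.fromEdgeSet (Γ.ends '' T)).IsTree

/-- The valency of a vertex. -/
noncomputable def val (v : V) : ℕ := Nat.card {h : H // Γ.s h = v}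

/-- Truncated vertices. -/
def IsTruncated (v : V) : Prop := Γ.m v = 1 ∧ Γ.val v = 1

/-- The Brauer graphs of local Brauer tree algebras `k[x]/(x^{m+1})`: two vertices, one of them of
multiplicity one, and a single edge. -/
def IsLocalBrauerTree : Prop := Nat.card V = 2 ∧ Nat.card Γ.Edge = 1 ∧ ∃ v, Γ.m v = 1

/-! ### The Brauer graph algebra

The quiver `Q_Γ` has the edges as vertices and one arrow `α_h : h̄ → ρ(h)‾` for each half-edge `h`;
so arrows are half-edges. A path of positive length `α_n ⋯ α_1` (the arrow `α_1` comes first) is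
the list `[α_n, …, α_1]` of its arrows. -/

/-- The source of the arrow `α_h`. -/
def src (h : H) : Γ.Edge := Γ.edge h

/-- The target of the arrow `α_h`. -/
def tgt (h : H) : Γ.Edge := Γ.edge (Γ.ρ h)

/-- The permutation `σ(α_h) = α_{h⁻}` of the arrows. -/
def σ (h : H) : H := Γ.ρ.symm h

/-- The path `C_α ^ i`, where `C_α = α σ(α) ⋯ σ^l(α)` is the full cycle around the vertex `v`
of the arrow `α`, with `l + 1 = val(v)`. It starts and ends at the target of `α`. -/
noncomputable def cyc (h : H) (i : ℕ) : List H :=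
  (List.replicate i (List.iterate Γ.σ h (Γ.val (Γ.s h)))).flatten

/-- The path `C_α ^ m(C_α)`. -/
noncomputable def fullCyc (h : H) : List H := Γ.cyc h (Γ.m (Γ.s h))

variable (k : Type*) [Field k] [Finite H]

/-- The arrow `α_h` in the path algebra `kQ_Γ`. -/
noncomputable def pathArrow (h : H) : PathAlgebra k Γ.src Γ.tgt :=
  RingQuot.mkAlgHom k (PathRel k Γ.src Γ.tgt) (FreeAlgebra.ι k (Sum.inr h))

/-- The generators of the ideal `I_Γ`. The two cycles around the end points of the edge `h̄` which
start and end at `h̄` are `C_{σ(α_h)}` and `C_{σ(α_{ι h})}`. -/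
inductive Rel : PathAlgebra k Γ.src Γ.tgt → PathAlgebra k Γ.src Γ.tgt → Prop
  | zero (a b : H) : Γ.src a = Γ.tgt b → b ≠ Γ.σ a → Rel (Γ.pathArrow k a * Γ.pathArrow k b) 0
  | comm (h : H) : Rel (((Γ.fullCyc (Γ.σ h)).map (Γ.pathArrow k)).prod)
      (((Γ.fullCyc (Γ.σ (Γ.ι h))).map (Γ.pathArrow k)).prod)

/-- The Brauer graph algebra `B_Γ = kQ_Γ / I_Γ`. -/
def Alg : Type _ := RingQuot (Γ.Rel k)

noncomputable instance : Ring (Γ.Alg k) := inferInstanceAs (Ring (RingQuot (Γ.Rel k)))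

noncomputable instance : Algebra k (Γ.Alg k) := inferInstanceAs (Algebra k (RingQuot (Γ.Rel k)))

/-- The projection `kQ_Γ → B_Γ`. -/
noncomputable def proj : PathAlgebra k Γ.src Γ.tgt →ₐ[k] Γ.Alg k :=
  RingQuot.mkAlgHom k (Γ.Rel k)

/-- The idempotent of `B_Γ` at an edge. -/
noncomputable def idem (i : Γ.Edge) : Γ.Alg k :=
  Γ.proj k (RingQuot.mkAlgHom k (PathRel k Γ.src Γ.tgt) (FreeAlgebra.ι k (Sum.inl i)))

/-- The arrow `α_h` in `B_Γ`. -/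
noncomputable def arrow (h : H) : Γ.Alg k := Γ.proj k (Γ.pathArrow k h)

/-- The element of `B_Γ` given by a path of positive length. -/
noncomputable def ev (p : List H) : Γ.Alg k := (p.map (Γ.arrow k)).prod

/-! ### The reduction system `R_Γ` of a bipartite Brauer graph -/

/-- The arrows of the quiver `Q'_Γ`, obtained from `Q_Γ` by removing the loops at the truncated
vertices in `V₁`. -/
def IsArrow' (V₁ : Set V) (h : H) : Prop := ¬ (Γ.s h ∈ V₁ ∧ Γ.IsTruncated (Γ.s h))

/-- The set `S` of tips of the reduction system `R_Γ`, see `Tip.path`.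
* `a h`: for each edge `h̄` with `h` at a vertex of `V₁` that is not truncated;
* `b h`: for each half-edge `h` at a vertex of `V₂`;
* `c a b`: for composable arrows `a`, `b` of `Q'_Γ` with `b ≠ σ(a)`. -/
inductive Tip (V₁ : Set V) : Type _
  | a (h : H) (h₁ : Γ.s h ∈ V₁) (h₂ : Γ.IsArrow' V₁ h) : Tip V₁
  | b (h : H) (h₂ : Γ.s h ∉ V₁) : Tip V₁
  | c (a b : H) (ha : Γ.IsArrow' V₁ a) (hb : Γ.IsArrow' V₁ b) (hab : Γ.src a = Γ.tgt b)
      (hσ : b ≠ Γ.σ a) : Tip V₁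

namespace Tip

variable {Γ} {V₁ : Set V}

/-- The tip `s` as a path: `C_α^{m(C_α)}` where `C_α` is the cycle around the `V₁`-end starting
from `h̄`, respectively `C_{α_h}^{m(C_{α_h})} α_h`, respectively `α β`. -/
noncomputable def path : Γ.Tip V₁ → List H
  | a h _ _ => Γ.fullCyc (Γ.σ h)
  | b h _ => Γ.fullCyc h ++ [h]
  | c x y _ _ _ _ => [x, y]

/-- The source of the path `s`. -/
def source : Γ.Tip V₁ → Γ.Edge
  | a h _ _ => Γ.edge h
  | b h _ => Γ.src h
  | c _ y _ _ _ _ => Γ.src y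

/-- The target of the path `s`. -/
def target : Γ.Tip V₁ → Γ.Edge
  | a h _ _ => Γ.edge h
  | b h _ => Γ.tgt h
  | c x _ _ _ _ _ => Γ.tgt x

/-- The linear combination `φ_s` of paths: `C_β^{m(C_β)}` for the tips of the first kind, where
`C_β` is the cycle around the `V₂`-end starting from `h̄`, and `0` for the others. -/
noncomputable def phi : Γ.Tip V₁ → (List H →₀ k)
  | a h _ _ => Finsupp.single (Γ.fullCyc (Γ.σ (Γ.ι h))) 1
  | b _ _ => 0
  | c _ _ _ _ _ _ => 0

/-- The relation `s - φ_s` as a linear combination of paths. -/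
noncomputable def relation (t : Γ.Tip V₁) : List H →₀ k :=
  Finsupp.single t.path 1 - t.phi k

end Tip

/-! ### The cochain complex of the reduction system in degrees one and two -/

variable (V₁ : Set V)

/-- The `1`-cochains `Hom_{kQ₀ᵉ}(kQ'₁, B_Γ)`, as families indexed by `H` that vanish outside of the
arrows of `Q'_Γ`. -/
def cochain1 : Submodule k (H → Γ.Alg k) where
  carrier := {ψ | (∀ h, Γ.idem k (Γ.tgt h) * ψ h * Γ.idem k (Γ.src h) = ψ h) ∧
    ∀ h, ¬ Γ.IsArrow' V₁ h → ψ h = 0}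
  zero_mem' := by simp
  add_mem' := by
    rintro ψ χ ⟨h₁, h₂⟩ ⟨h₃, h₄⟩
    refine ⟨fun h => ?_, fun h hh => ?_⟩
    · simp only [Pi.add_apply, mul_add, add_mul, h₁ h, h₃ h]
    · simp only [Pi.add_apply, h₂ h hh, h₄ h hh, add_zero]
  smul_mem' := by
    rintro r ψ ⟨h₁, h₂⟩
    refine ⟨fun h => ?_, fun h hh => ?_⟩
    · simp only [Pi.smul_apply, mul_smul_comm, smul_mul_assoc, h₁ h]
    · simp only [Pi.smul_apply, h₂ h hh, smul_zero]

/-- The `2`-cochains `Hom_{kQ₀ᵉ}(kS, B_Γ)`. -/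
def cochain2 : Submodule k (Γ.Tip V₁ → Γ.Alg k) where
  carrier := {φ | ∀ t, Γ.idem k t.target * φ t * Γ.idem k t.source = φ t}
  zero_mem' := by simp
  add_mem' := by
    intro φ χ h₁ h₂ t
    simp only [Pi.add_apply, mul_add, add_mul, h₁ t, h₂ t]
  smul_mem' := by
    intro r φ h₁ t
    simp only [Pi.smul_apply, mul_smul_comm, smul_mul_assoc, h₁ t]

/-- The differential `∂¹`: it sends `ψ` to
`s ↦ ∑_p c(p) ∑_i α_m ⋯ α_{i+1} ψ(α_i) α_{i-1} ⋯ α_1`, where `s - φ_s = ∑_p c(p) p` and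
`p = α_m ⋯ α_1`. -/
noncomputable def d1 (ψ : H → Γ.Alg k) (t : Γ.Tip V₁) : Γ.Alg k :=
  (t.relation k).sum fun p c => c • ∑ i : Fin p.length,
    Γ.ev k (p.take i) * ψ (p.get i) * Γ.ev k (p.drop (i + 1))

/-- The `2`-coboundaries, i.e. the image of `∂¹`. -/
noncomputable def coboundary2 : Submodule k (Γ.Tip V₁ → Γ.Alg k) :=
  Submodule.span k (Γ.d1 k V₁ '' (Γ.cochain1 k V₁ : Set (H → Γ.Alg k)))

/-- The differential `∂₂ : B ⊗ kS ⊗ B → B ⊗ kQ'₁ ⊗ B` (tensor products over `kQ₀`) of the bimodule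
resolution of `B = B_Γ` attached to the reduction system:
`a ⊗ s ⊗ b ↦ ∑_p c(p) ∑_i a α_m ⋯ α_{i+1} ⊗ α_i ⊗ α_{i-1} ⋯ α_1 b`.
Here `B ⊗_{kQ₀} ks ⊗_{kQ₀} B = B e_{t(s)} ⊗_k e_{o(s)} B` is a direct summand of `B ⊗_k B`, whose
complement is annihilated by the factors `e_{t(s)}`, `e_{o(s)}` below. -/
noncomputable def boundary2 :
    (Γ.Tip V₁ →₀ Γ.Alg k ⊗[k] Γ.Alg k) →ₗ[k] (H →₀ Γ.Alg k ⊗[k] Γ.Alg k) :=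
  Finsupp.lsum k fun t => (t.relation k).sum fun p c => c • ∑ i : Fin p.length,
    (Finsupp.lsingle (p.get i)).comp (TensorProduct.map
      (LinearMap.mulRight k (Γ.idem k t.target * Γ.ev k (p.take i)))
      (LinearMap.mulLeft k (Γ.ev k (p.drop (i + 1)) * Γ.idem k t.source)))

/-- The bimodule map `B ⊗ kS ⊗ B → B`, `a ⊗ s ⊗ b ↦ a φ(s) b`, attached to a `2`-cochain `φ`. -/
noncomputable def bimoduleMap (φ : Γ.Tip V₁ → Γ.Alg k) :
    (Γ.Tip V₁ →₀ Γ.Alg k ⊗[k] Γ.Alg k) →ₗ[k] Γ.Alg k :=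
  Finsupp.lsum k fun t => (LinearMap.mul' k (Γ.Alg k)).comp
    (TensorProduct.map (LinearMap.mulRight k (φ t)) LinearMap.id)

/-- The `2`-cocycles. As `(∂² φ)(w) = φ(∂₃(1 ⊗ w ⊗ 1))` and the bimodule resolution is exact,
i.e. `im ∂₃ = ker ∂₂`, a `2`-cochain is a cocycle if and only if the attached bimodule map
vanishes on `ker ∂₂` (so the choices in the construction of `∂₃` are irrelevant). -/
noncomputable def cocycle2 : Submodule k (Γ.Tip V₁ → Γ.Alg k) where
  carrier := {φ | φ ∈ Γ.cochain2 k V₁ ∧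
    ∀ x, Γ.boundary2 k V₁ x = 0 → Γ.bimoduleMap k V₁ φ x = 0}
  zero_mem' := by
    refine ⟨Submodule.zero_mem _, fun x _ => ?_⟩
    have h : Γ.bimoduleMap k V₁ 0 = 0 := by
      ext t a b
      simp [bimoduleMap]
    rw [h, LinearMap.zero_apply]
  add_mem' := by
    rintro φ χ ⟨h₁, h₂⟩ ⟨h₃, h₄⟩
    refine ⟨Submodule.add_mem _ h₁ h₃, fun x hx => ?_⟩
    have h : Γ.bimoduleMap k V₁ (φ + χ) = Γ.bimoduleMap k V₁ φ + Γ.bimoduleMap k V₁ χ := by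
      ext t a b
      simp [bimoduleMap, mul_add, add_mul]
    rw [h, LinearMap.add_apply, h₂ x hx, h₄ x hx, add_zero]
  smul_mem' := by
    rintro r φ ⟨h₁, h₂⟩
    refine ⟨Submodule.smul_mem _ r h₁, fun x hx => ?_⟩
    have h : Γ.bimoduleMap k V₁ (r • φ) = r • Γ.bimoduleMap k V₁ φ := by
      ext t a b
      simp [bimoduleMap]
    rw [h, LinearMap.smul_apply, h₂ x hx, smul_zero]

/-- The second cohomology of the cochain complex attached to the reduction system `R_Γ`. -/
abbrev H2 : Type _ :=
  Γ.cocycle2 k V₁ ⧸ (Γ.coboundary2 k V₁).submoduleOf (Γ.cocycle2 k V₁)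

/-- The comparison of the Hochschild complex with the complex attached to `R_Γ`, in degree two.
It is the pullback along the map of bimodule resolutions (to the bar resolution) given by
`1 ⊗ s ⊗ 1 ↦ ∑_p c(p) ∑_i e_{t(s)} ⊗ α_m ⋯ α_{i+1} ⊗ α_i ⊗ α_{i-1} ⋯ α_1`. -/
noncomputable def comparison (f : Γ.Alg k →ₗ[k] Γ.Alg k →ₗ[k] Γ.Alg k) (t : Γ.Tip V₁) : Γ.Alg k :=
  (t.relation k).sum fun p c => c • ∑ i : Fin p.length,
    Γ.idem k t.target * f (Γ.idem k t.target * Γ.ev k (p.take i)) (Γ.arrow k (p.get i)) *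
      (Γ.ev k (p.drop (i + 1)) * Γ.idem k t.source)

/-! ### The standard cocycles -/

variable {V₁}

/-- Type (A). -/
noncomputable def stdA (r : k) : Γ.Tip V₁ → Γ.Alg k
  | .a h _ _ => r • Γ.idem k (Γ.edge h)
  | .b h _ => -(r • Γ.arrow k h)
  | .c _ _ _ _ _ _ => 0

open Classical in
/-- Type (B) for a vertex `v ∈ V₁` and an exponent `i`. -/
noncomputable def stdB₁ (r : k) (v : V) (i : ℕ) : Γ.Tip V₁ → Γ.Alg k
  | .a h _ _ => if Γ.s h = v then r • Γ.ev k (Γ.cyc (Γ.σ h) i) else 0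
  | .b _ _ => 0
  | .c _ _ _ _ _ _ => 0

open Classical in
/-- Type (B) for a vertex `v ∈ V₂` and an exponent `i`. -/
noncomputable def stdB₂ (r : k) (v : V) (i : ℕ) : Γ.Tip V₁ → Γ.Alg k
  | .a h _ _ => if Γ.s (Γ.ι h) = v then r • Γ.ev k (Γ.cyc (Γ.σ (Γ.ι h)) i) else 0
  | .b h _ => if Γ.s h = v then -(r • Γ.ev k (Γ.cyc h i ++ [h])) else 0
  | .c _ _ _ _ _ _ => 0

open Classical in
/-- Type (C) for an edge `j`. -/
noncomputable def stdC (r : k) (j : Γ.Edge) : Γ.Tip V₁ → Γ.Alg k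
  | .a h _ _ => if Γ.edge h = j then r • Γ.ev k (Γ.fullCyc (Γ.σ (Γ.ι h))) else 0
  | .b _ _ => 0
  | .c _ _ _ _ _ _ => 0

open Classical in
/-- The first cocycle of type (D), for arrows `β : h̄₁ → h̄₂` around a vertex of `V₂` and
`α : h̄₂ → h̄₁` around a vertex of `V₁`: `αβ ↦ r e₁`, `βα ↦ r e₂`, `C_β^{m(C_β)} β ↦ r α^*`, where
`α α^* = C_α^{m(C_α)}`. -/
noncomputable def stdD₁ (r : k) (α β : H) : Γ.Tip V₁ → Γ.Alg k
  | .a _ _ _ => 0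
  | .b h _ => if h = β then r • Γ.ev k (Γ.fullCyc α).tail else 0
  | .c a b _ _ _ _ =>
      if a = α ∧ b = β then r • Γ.idem k (Γ.src β)
      else if a = β ∧ b = α then r • Γ.idem k (Γ.tgt β) else 0

open Classical in
/-- The second cocycle of type (D): `βα ↦ r C_β^{m(C_β)}`. -/
noncomputable def stdD₂ (r : k) (α β : H) : Γ.Tip V₁ → Γ.Alg k
  | .a _ _ _ => 0
  | .b _ _ => 0
  | .c a b _ _ _ _ => if a = β ∧ b = α then r • Γ.ev k (Γ.fullCyc β) else 0

variable (V₁) in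
/-- The pairs `h₁`, `h₂ = h₁⁺` of half-edges at a vertex of `V₂` with `ι(h₁)⁻ = ι(h₂)`, given by
`h₁`. -/
def Bigon : Type _ := {h₁ : H // Γ.s h₁ ∉ V₁ ∧ Γ.ρ.symm (Γ.ι h₁) = Γ.ι (Γ.ρ h₁)}

variable (V₁) in
/-- The index set of the standard cocycles, for a given spanning tree `T`: one of type (A);
`m(v) - 1` of type (B) for each vertex `v`; one of type (C) for each edge outside of `T`; two of
type (D) for each bigon. -/
inductive StdIndex (T : Set Γ.Edge) : Type _
  | A : StdIndex T
  | B (v : V) (i : ℕ) (h₁ : 1 ≤ i) (h₂ : i ≤ Γ.m v - 1) : StdIndex T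
  | C (j : Γ.Edge) (hj : j ∉ T) : StdIndex T
  | D₁ (x : Γ.Bigon V₁) : StdIndex T
  | D₂ (x : Γ.Bigon V₁) : StdIndex T

open Classical in
/-- The standard cocycle with a given index and scalar `r`. In type (D), with `h₂ = h₁⁺`, the arrows
are `β = α_{h₁} : h̄₁ → h̄₂` and `α = α_{ι(h₂)} : h̄₂ → h̄₁`. -/
noncomputable def stdCocycle {T : Set Γ.Edge} (r : k) : Γ.StdIndex V₁ T → Γ.Tip V₁ → Γ.Alg k
  | .A => Γ.stdA k r
  | .B v i _ _ => if v ∈ V₁ then Γ.stdB₁ k r v i else Γ.stdB₂ k r v i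
  | .C j _ => Γ.stdC k r j
  | .D₁ x => Γ.stdD₁ k r (Γ.ι (Γ.ρ x.1)) x.1
  | .D₂ x => Γ.stdD₂ k r (Γ.ι (Γ.ρ x.1)) x.1

end BrauerGraph

set_option linter.unusedSectionVars false

/-! The algebra B is symmetric, and everything is computed with its symmetrizing form. A basis
consists of the trivial paths, the proper subpaths of the full cycles and one socle element per
edge: left multiplication on formal labels for these is a representation (`rep`), so no further
relations hold. The sum τ of the socle coefficients is a trace (`τ_mul_comm`). Hence the coefficient
of a path in u is τ of u times the complementary path (`coef`), and u is recovered from these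
numbers (`idem_mul_eq`).

Comparison with Hochschild cohomology. Differentiating irreducible paths gives a linear map `deriv`
whose failure to satisfy the Leibniz rule lies in the image of ∂₂ (`derivDefect_mem`). A cocycle φ
is a bimodule map on that image; applied to the Leibniz defect it becomes a Hochschild cocycle with
comparison φ. The same map `deriv` integrates a Hochschild cocycle whose comparison is a coboundary.
No formula for ∂₃ is needed.

The standard cochains are cocycles. It suffices to deform left multiplication by the arrows to first
order, by linear operators Λ on B, so that every relation s - φ_s becomes left multiplication by the
value at s (`mem_cocycle2_of_operators`). For (A), (B), (C) and the second cocycle of (D) the Λ are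
rank one operators built from τ; for the first cocycle of (D) they are left divisions by the
opposite arrow of the bigon.

They span. Left division provides a 1-cochain whose coboundary agrees with a given cocycle on the
tips αβ, except for trivial paths and socle elements at bigons, which are the cocycles (D). Once the
values on these tips are zero, the overlaps of tips force the other values to be combinations of
powers of cycles with coefficients depending only on the vertex, plus socle elements. The
coefficients of the trivial paths agree on the whole graph by connectedness, which gives (A); the
positive powers give (B). What remains is a function on edges with values in the socle. In
characteristic zero, rescaling the arrows around each vertex changes it by X(v) - X(w) for any
function X on V, so it can be made zero on T (`exists_potential`), and the other edges give (C).

They are independent modulo coboundaries. Functionals φ ↦ τ(φ(s) u), with corrections at leaves,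
vanish on coboundaries and isolate the coefficients of (D), (A) and (B) successively. For (C), τ of
the derivative of a full cycle depends only on its vertex; if its differences vanish along T they
vanish on every edge. -/

namespace BrauerGraph

/-! ## Combinatorics of the arrows -/

section Combinatorics

variable {V H : Type*} (Γ : BrauerGraph V H)

theorem ρ_σ (h : H) : Γ.ρ (Γ.σ h) = h := Γ.ρ.apply_symm_apply h

theorem σ_ρ (h : H) : Γ.σ (Γ.ρ h) = h := Γ.ρ.symm_apply_apply h

theorem σ_injective : Function.Injective Γ.σ := Γ.ρ.symm.injective

theorem ι_ι (h : H) : Γ.ι (Γ.ι h) = h := Γ.ι_involutive h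

theorem ι_injective : Function.Injective Γ.ι := Γ.ι_involutive.injective

theorem s_ρ (h : H) : Γ.s (Γ.ρ h) = Γ.s h :=
  (Γ.sameCycle_iff _ _).1 (Equiv.Perm.sameCycle_apply_left.2 (Equiv.Perm.SameCycle.refl _ _))

theorem s_σ (h : H) : Γ.s (Γ.σ h) = Γ.s h := by
  rw [← Γ.s_ρ (Γ.σ h), Γ.ρ_σ]

theorem s_σ_iterate (n : ℕ) (h : H) : Γ.s (Γ.σ^[n] h) = Γ.s h := by
  induction n with
  | zero => rfl
  | succ n ih => rw [Function.iterate_succ_apply', s_σ, ih]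

theorem tgt_σ (h : H) : Γ.tgt (Γ.σ h) = Γ.src h := by
  rw [tgt, ρ_σ, src]

theorem edge_eq_iff {h h' : H} : Γ.edge h = Γ.edge h' ↔ h' = h ∨ h' = Γ.ι h :=
  ⟨fun e => Quotient.exact e, fun e => Quotient.sound e⟩

theorem edge_ι (h : H) : Γ.edge (Γ.ι h) = Γ.edge h :=
  Γ.edge_eq_iff.2 (Or.inr (Γ.ι_ι h).symm)

theorem edge_surjective : Function.Surjective Γ.edge := Quotient.mk_surjective

/-- The number of arrows in the cycle `C_α ^ m(C_α)`. -/
noncomputable def len (h : H) : ℕ := Γ.m (Γ.s h) * Γ.val (Γ.s h)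

/-- The arrow different from `α_h` with the same target. -/
def op (h : H) : H := Γ.σ (Γ.ι (Γ.ρ h))

theorem op_ne (h : H) : Γ.op h ≠ h := fun e => by
  rw [op] at e
  have := congrArg Γ.ρ e
  rw [ρ_σ] at this
  exact Γ.ι_ne _ this

theorem tgt_op (h : H) : Γ.tgt (Γ.op h) = Γ.tgt h := by
  rw [op, tgt_σ, src, edge_ι, tgt]

theorem op_σ (h : H) : Γ.op (Γ.σ h) = Γ.σ (Γ.ι h) := by rw [op, ρ_σ]

theorem tgt_eq_iff {h h' : H} : Γ.tgt h = Γ.tgt h' ↔ h' = h ∨ h' = Γ.op h := by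
  rw [tgt, tgt, edge_eq_iff, op]
  constructor
  · rintro (e | e)
    · exact Or.inl (Γ.ρ.injective e)
    · right
      rw [← e, σ_ρ]
  · rintro (rfl | rfl)
    · exact Or.inl rfl
    · right
      rw [ρ_σ]

theorem src_eq_tgt_iff {x y : H} : Γ.src x = Γ.tgt y ↔ y = Γ.σ x ∨ y = Γ.σ (Γ.ι x) := by
  rw [← tgt_σ, tgt_eq_iff, op_σ]

theorem σ_ι_ne (x : H) : Γ.σ (Γ.ι x) ≠ Γ.σ x := fun e => Γ.ι_ne _ (Γ.σ_injective e)

theorem src_eq_tgt_σ_ι (x : H) : Γ.src x = Γ.tgt (Γ.σ (Γ.ι x)) :=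
  Γ.src_eq_tgt_iff.2 (Or.inr rfl)

theorem len_σ (h : H) : Γ.len (Γ.σ h) = Γ.len h := by rw [len, len, s_σ]

theorem len_σ_iterate (n : ℕ) (h : H) : Γ.len (Γ.σ^[n] h) = Γ.len h := by
  rw [len, len, s_σ_iterate]

variable [Finite H]

theorem val_pos (h : H) : 0 < Γ.val (Γ.s h) := by
  have : Nonempty {h' : H // Γ.s h' = Γ.s h} := ⟨⟨h, rfl⟩⟩
  exact Nat.card_pos

theorem len_pos (h : H) : 0 < Γ.len h := Nat.mul_pos (Γ.m_pos _) (Γ.val_pos h)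

theorem σ_iterate_eq (n : ℕ) (h : H) : Γ.σ^[n] h = (Γ.ρ.symm ^ n) h := by
  rw [← Equiv.Perm.iterate_eq_pow]; rfl

theorem exists_σ_iterate_eq {h h' : H} (e : Γ.s h = Γ.s h') : ∃ n, Γ.σ^[n] h = h' := by
  have := (Equiv.Perm.sameCycle_inv.2 ((Γ.sameCycle_iff _ _).2 e)).exists_nat_pow_eq
  obtain ⟨n, hn⟩ := this
  exact ⟨n, by rw [σ_iterate_eq]; exact hn⟩

theorem σ_iterate_eq_self_iff {n : ℕ} {h : H} : Γ.σ^[n] h = h ↔ Γ.val (Γ.s h) ∣ n := by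
  classical
  have := Fintype.ofFinite H
  have hc : Equiv.Perm.IsCycleOn Γ.ρ.symm (↑(Finset.univ.filter fun h' => Γ.s h' = Γ.s h) : Set H)
    := by
    refine Equiv.Perm.isCycleOn_inv.2 ⟨⟨fun x hx => ?_, Γ.ρ.injective.injOn, fun x hx => ?_⟩,
      fun x hx y hy => ?_⟩
    · simpa [s_ρ] using hx
    · exact ⟨Γ.σ x, by simpa [s_σ] using hx, Γ.ρ_σ x⟩
    · simp only [Finset.coe_filter, Finset.mem_univ, true_and, Set.mem_ofPred_eq] at hx hy
      exact (Γ.sameCycle_iff _ _).2 (hx.trans hy.symm)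
  rw [σ_iterate_eq, hc.pow_apply_eq (by simp), val, Nat.card_eq_fintype_card,
    Fintype.card_subtype]

theorem σ_iterate_val (h : H) : Γ.σ^[Γ.val (Γ.s h)] h = h := Γ.σ_iterate_eq_self_iff.2 dvd_rfl

theorem σ_iterate_len (h : H) : Γ.σ^[Γ.len h] h = h :=
  Γ.σ_iterate_eq_self_iff.2 (Dvd.intro_left _ rfl)

theorem cyc_eq_iterate (h : H) (i : ℕ) :
    Γ.cyc h i = List.iterate Γ.σ h (i * Γ.val (Γ.s h)) := by
  induction i with
  | zero => simp [cyc]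
  | succ i ih =>
    rw [cyc] at ih
    rw [cyc, List.replicate_succ, List.flatten_cons, ih, Nat.add_mul, one_mul, add_comm,
      List.iterate_add, σ_iterate_val]

theorem fullCyc_eq_iterate (h : H) : Γ.fullCyc h = List.iterate Γ.σ h (Γ.len h) :=
  Γ.cyc_eq_iterate h _

theorem iterate_succ_last (h : H) (n : ℕ) :
    List.iterate Γ.σ h (n + 1) = List.iterate Γ.σ h n ++ [Γ.σ^[n] h] := by
  rw [List.iterate_add]; rfl

theorem σ_iterate_len_sub (h : H) {j : ℕ} (hj : j ≤ Γ.len h) :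
    Γ.σ^[Γ.len h - j] (Γ.σ^[j] h) = h := by
  rw [← Function.iterate_add_apply, Nat.sub_add_cancel hj, σ_iterate_len]

theorem σ_iterate_len_pred (h : H) : Γ.σ^[Γ.len h - 1] (Γ.σ h) = h :=
  Γ.σ_iterate_len_sub h (j := 1) (Γ.len_pos h)

end Combinatorics

/-! ## Multiplication of paths in the Brauer graph algebra -/

section Paths

open scoped Classical

variable {V H : Type*} (Γ : BrauerGraph V H) (k : Type*) [Field k] [Finite H]

theorem idem_mul_self (i : Γ.Edge) : Γ.idem k i * Γ.idem k i = Γ.idem k i := by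
  rw [idem, ← map_mul, ← map_mul, RingQuot.mkAlgHom_rel k (PathRel.idem i)]

theorem idem_mul_of_ne {i j : Γ.Edge} (e : i ≠ j) : Γ.idem k i * Γ.idem k j = 0 := by
  rw [idem, idem, ← map_mul, ← map_mul, RingQuot.mkAlgHom_rel k (PathRel.orth i j e), map_zero,
    map_zero]

theorem idem_mul_idem (i j : Γ.Edge) :
    Γ.idem k i * Γ.idem k j = if i = j then Γ.idem k i else 0 := by
  split_ifs with e
  · rw [← e, idem_mul_self]
  · exact Γ.idem_mul_of_ne k e

theorem sum_idem [Fintype Γ.Edge] : ∑ i, Γ.idem k i = 1 := by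
  have := RingQuot.mkAlgHom_rel k (PathRel.one (k := k) (src := Γ.src) (tgt := Γ.tgt))
  rw [finsum_eq_sum_of_fintype, map_one, map_sum] at this
  rw [← map_one (Γ.proj k), ← this, map_sum]
  rfl

theorem idem_tgt_mul_arrow (h : H) : Γ.idem k (Γ.tgt h) * Γ.arrow k h = Γ.arrow k h := by
  rw [idem, arrow, pathArrow, ← map_mul, ← map_mul, RingQuot.mkAlgHom_rel k (PathRel.tgt h)]

theorem arrow_mul_idem_src (h : H) : Γ.arrow k h * Γ.idem k (Γ.src h) = Γ.arrow k h := by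
  rw [idem, arrow, pathArrow, ← map_mul, ← map_mul, RingQuot.mkAlgHom_rel k (PathRel.src h)]

theorem arrow_mul_arrow_of_ne {x y : H} (e : y ≠ Γ.σ x) : Γ.arrow k x * Γ.arrow k y = 0 := by
  by_cases hc : Γ.src x = Γ.tgt y
  · rw [arrow, arrow, ← map_mul]
    have := RingQuot.mkAlgHom_rel k (Rel.zero (k := k) x y hc e)
    rw [map_zero] at this
    exact this
  · rw [← Γ.arrow_mul_idem_src k x, ← Γ.idem_tgt_mul_arrow k y, mul_assoc,
      ← mul_assoc (Γ.idem k (Γ.src x)), Γ.idem_mul_of_ne k hc, zero_mul, mul_zero]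

theorem ev_fullCyc (h : H) : Γ.ev k (Γ.fullCyc (Γ.σ h)) = Γ.ev k (Γ.fullCyc (Γ.σ (Γ.ι h))) := by
  have := RingQuot.mkAlgHom_rel k (Rel.comm (Γ := Γ) (k := k) h)
  rw [map_list_prod, map_list_prod, List.map_map, List.map_map] at this
  exact this

theorem ev_nil : Γ.ev k [] = 1 := rfl

theorem ev_cons (h : H) (l : List H) : Γ.ev k (h :: l) = Γ.arrow k h * Γ.ev k l := by
  rw [ev, ev, List.map_cons, List.prod_cons]

/-- The path `α_h σ(α_h) σ²(α_h) ⋯` with `n` arrows, as an element of the algebra. -/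
noncomputable def P (h : H) (n : ℕ) : Γ.Alg k :=
  Γ.idem k (Γ.tgt h) * Γ.ev k (List.iterate Γ.σ h n)

theorem P_zero (h : H) : Γ.P k h 0 = Γ.idem k (Γ.tgt h) := by
  rw [P, List.iterate, ev_nil, mul_one]

theorem P_succ_eq_ev (h : H) (n : ℕ) : Γ.P k h (n + 1) = Γ.ev k (List.iterate Γ.σ h (n + 1)) := by
  rw [P, List.iterate, ev_cons, ← mul_assoc, idem_tgt_mul_arrow]

theorem P_eq_ev {n : ℕ} (hn : 0 < n) (h : H) : Γ.P k h n = Γ.ev k (List.iterate Γ.σ h n) := by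
  obtain ⟨n, rfl⟩ := Nat.exists_eq_succ_of_ne_zero hn.ne'
  exact Γ.P_succ_eq_ev k h n

theorem P_one (h : H) : Γ.P k h 1 = Γ.arrow k h := by
  rw [P_succ_eq_ev, List.iterate, List.iterate, ev_cons, ev_nil, mul_one]

theorem idem_tgt_mul_P (h : H) (n : ℕ) : Γ.idem k (Γ.tgt h) * Γ.P k h n = Γ.P k h n := by
  rw [P, ← mul_assoc, idem_mul_self]

theorem arrow_mul_P (h : H) (n : ℕ) : Γ.arrow k h * Γ.P k (Γ.σ h) n = Γ.P k h (n + 1) := by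
  rw [P, ← mul_assoc, tgt_σ, arrow_mul_idem_src, P_succ_eq_ev, List.iterate, ev_cons]

theorem P_mul_P (h : H) (m n : ℕ) :
    Γ.P k h m * Γ.P k (Γ.σ^[m] h) n = Γ.P k h (m + n) := by
  induction m generalizing h with
  | zero => rw [P_zero, Function.iterate_zero, id, idem_tgt_mul_P, zero_add]
  | succ m ih =>
    rw [← arrow_mul_P, mul_assoc, Function.iterate_succ_apply, ih, arrow_mul_P]
    congr 1
    omega

theorem P_mul_idem_tgt (h : H) (n : ℕ) :
    Γ.P k h n * Γ.idem k (Γ.tgt (Γ.σ^[n] h)) = Γ.P k h n := by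
  rw [← P_zero, P_mul_P, add_zero]

theorem idem_mul_P (i : Γ.Edge) (h : H) (n : ℕ) :
    Γ.idem k i * Γ.P k h n = if i = Γ.tgt h then Γ.P k h n else 0 := by
  rw [← idem_tgt_mul_P, ← mul_assoc, idem_mul_idem]
  split_ifs with e
  · rw [e]
  · rw [zero_mul]

theorem P_mul_idem (i : Γ.Edge) (h : H) (n : ℕ) :
    Γ.P k h n * Γ.idem k i = if Γ.tgt (Γ.σ^[n] h) = i then Γ.P k h n else 0 := by
  rw [← P_mul_idem_tgt, mul_assoc, idem_mul_idem]
  split_ifs with e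
  · rfl
  · rw [mul_zero]

theorem P_mul_arrow (h : H) (n : ℕ) : Γ.P k h n * Γ.arrow k (Γ.σ^[n] h) = Γ.P k h (n + 1) := by
  rw [← P_one, P_mul_P]

theorem P_succ_mul_P_succ_of_ne {h h' : H} {m : ℕ} (n : ℕ) (e : Γ.σ^[m + 1] h ≠ h') :
    Γ.P k h (m + 1) * Γ.P k h' (n + 1) = 0 := by
  rw [← P_mul_arrow, ← arrow_mul_P, mul_assoc, ← mul_assoc (Γ.arrow k _),
    Γ.arrow_mul_arrow_of_ne k, zero_mul, mul_zero]
  rw [Function.iterate_succ_apply'] at e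
  exact e.symm

theorem P_mul_P_of_ne {h h' : H} {m n : ℕ} (hm : 0 < m) (hn : 0 < n) (e : Γ.σ^[m] h ≠ h') :
    Γ.P k h m * Γ.P k h' n = 0 := by
  obtain ⟨m, rfl⟩ := Nat.exists_eq_succ_of_ne_zero hm.ne'
  obtain ⟨n, rfl⟩ := Nat.exists_eq_succ_of_ne_zero hn.ne'
  exact Γ.P_succ_mul_P_succ_of_ne k n e

theorem P_len_op (h : H) : Γ.P k (Γ.op h) (Γ.len (Γ.op h)) = Γ.P k h (Γ.len h) := by
  rw [Γ.P_eq_ev k (Γ.len_pos _), Γ.P_eq_ev k (Γ.len_pos _), ← fullCyc_eq_iterate,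
    ← fullCyc_eq_iterate]
  have := Γ.ev_fullCyc k (Γ.ρ h)
  rw [σ_ρ] at this
  exact this.symm

theorem P_len_of_tgt_eq {h h' : H} (e : Γ.tgt h = Γ.tgt h') :
    Γ.P k h (Γ.len h) = Γ.P k h' (Γ.len h') := by
  obtain rfl | rfl := Γ.tgt_eq_iff.1 e
  · rfl
  · rw [P_len_op]

/-- After replacing the full cycle by the one around the other end of the edge, its last arrow and
`h` are not consecutive around any vertex. -/
theorem P_len_succ (h : H) : Γ.P k h (Γ.len h + 1) = 0 := by
  rw [← P_mul_arrow, σ_iterate_len, ← P_len_op]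
  obtain ⟨n, hn⟩ := Nat.exists_eq_succ_of_ne_zero (Γ.len_pos (Γ.op h)).ne'
  rw [hn, Nat.succ_eq_add_one, ← P_one]
  apply P_succ_mul_P_succ_of_ne
  rw [← Nat.succ_eq_add_one, ← hn, σ_iterate_len]
  exact Γ.op_ne h

theorem P_of_len_lt {h : H} {n : ℕ} (hn : Γ.len h < n) : Γ.P k h n = 0 := by
  obtain ⟨d, rfl⟩ := Nat.exists_eq_add_of_lt hn
  rw [show Γ.len h + d + 1 = Γ.len h + 1 + d by omega, ← P_mul_P, P_len_succ, zero_mul]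

theorem ev_cyc {i : ℕ} (hi : 0 < i) (h : H) :
    Γ.ev k (Γ.cyc h i) = Γ.P k h (i * Γ.val (Γ.s h)) := by
  rw [cyc_eq_iterate, Γ.P_eq_ev k (Nat.mul_pos hi (Γ.val_pos h))]

theorem ev_fullCyc_eq (h : H) : Γ.ev k (Γ.fullCyc h) = Γ.P k h (Γ.len h) :=
  Γ.ev_cyc k (Γ.m_pos _) h

theorem σ_iterate_mul_val (h : H) (i : ℕ) : Γ.σ^[i * Γ.val (Γ.s h)] h = h :=
  Γ.σ_iterate_eq_self_iff.2 (Dvd.intro_left _ rfl)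

theorem ev_cyc_append {h : H} {i : ℕ} :
    Γ.ev k (Γ.cyc h i ++ [h]) = Γ.P k h (i * Γ.val (Γ.s h) + 1) := by
  rw [P_succ_eq_ev, iterate_succ_last, cyc_eq_iterate, σ_iterate_mul_val]

end Paths

/-! ## Normal forms and the symmetrizing form -/

section NormalForms

open scoped Classical

variable {V H : Type*} (Γ : BrauerGraph V H)

/-- Labels of a basis of the Brauer graph algebra: the trivial paths, the paths `P h (n + 1)` with
`n + 1 < len h`, and the socle elements. -/
inductive Word
  | e (i : Γ.Edge) : Word
  | p (h : H) (n : ℕ) : Word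
  | z (i : Γ.Edge) : Word

variable (k : Type*) [Field k] [Finite H]

/-- The path with `n + 1` arrows starting with `α_h` on the left, in terms of labels. -/
noncomputable def pathVec (h : H) (n : ℕ) : Γ.Word →₀ k :=
  if n + 1 < Γ.len h then Finsupp.single (.p h n) 1
  else if n + 1 = Γ.len h then Finsupp.single (.z (Γ.tgt h)) 1 else 0

/-- Left multiplication by an arrow, in terms of labels. -/
noncomputable def arrowVec (a : H) : Γ.Word → (Γ.Word →₀ k)
  | .e i => if Γ.src a = i then Γ.pathVec k a 0 else 0
  | .p h n => if Γ.σ a = h then Γ.pathVec k a (n + 1) else 0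
  | .z _ => 0

/-- Left multiplication by a trivial path, in terms of labels. -/
noncomputable def idemVec (i : Γ.Edge) : Γ.Word → (Γ.Word →₀ k)
  | .e j => if i = j then Finsupp.single (.e j) 1 else 0
  | .p h n => if i = Γ.tgt h then Finsupp.single (.p h n) 1 else 0
  | .z j => if i = j then Finsupp.single (.z j) 1 else 0

/-- Left multiplication by an arrow, as an operator on the span of the labels. -/
noncomputable def arrowOp (a : H) : Module.End k (Γ.Word →₀ k) :=
  Finsupp.linearCombination k (Γ.arrowVec k a)

/-- Left multiplication by a trivial path, as an operator on the span of the labels. -/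
noncomputable def idemOp (i : Γ.Edge) : Module.End k (Γ.Word →₀ k) :=
  Finsupp.linearCombination k (Γ.idemVec k i)

theorem arrowOp_single (a : H) (w : Γ.Word) :
    Γ.arrowOp k a (Finsupp.single w 1) = Γ.arrowVec k a w := by
  rw [arrowOp, Finsupp.linearCombination_single, one_smul]

theorem idemOp_single (i : Γ.Edge) (w : Γ.Word) :
    Γ.idemOp k i (Finsupp.single w 1) = Γ.idemVec k i w := by
  rw [idemOp, Finsupp.linearCombination_single, one_smul]

theorem arrowOp_pathVec (a h : H) (n : ℕ) :
    Γ.arrowOp k a (Γ.pathVec k h n) = if Γ.σ a = h then Γ.pathVec k a (n + 1) else 0 := by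
  by_cases e : Γ.σ a = h
  · subst e
    rw [if_pos rfl, pathVec, len_σ]
    split_ifs with h1 h2
    · rw [arrowOp_single, arrowVec, if_pos rfl]
    · rw [arrowOp_single, arrowVec, pathVec, if_neg (by omega), if_neg (by omega)]
    · rw [map_zero, pathVec, if_neg (by omega), if_neg (by omega)]
  · rw [if_neg e, pathVec]
    split_ifs
    · rw [arrowOp_single, arrowVec, if_neg e]
    · rw [arrowOp_single, arrowVec]
    · rw [map_zero]

theorem idemOp_pathVec (i : Γ.Edge) (h : H) (n : ℕ) :
    Γ.idemOp k i (Γ.pathVec k h n) = if i = Γ.tgt h then Γ.pathVec k h n else 0 := by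
  rw [pathVec]
  split_ifs <;> first | rw [map_zero] | (rw [idemOp_single, idemVec]; simp [*])

theorem arrowOp_idemVec (a : H) (w : Γ.Word) (i : Γ.Edge) :
    Γ.arrowOp k a (Γ.idemVec k i w) = if i = Γ.src a then Γ.arrowVec k a w else 0 := by
  cases w with
  | e j =>
    rw [idemVec]
    split_ifs with h1 h2 h2
    · rw [arrowOp_single]
    · subst h1
      rw [arrowOp_single, arrowVec, if_neg (Ne.symm h2)]
    · subst h2
      rw [map_zero, arrowVec, if_neg h1]
    · rw [map_zero]
  | p h n =>
    rw [idemVec]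
    by_cases e : Γ.σ a = h
    · subst e
      rw [tgt_σ]
      split_ifs
      · rw [arrowOp_single]
      · rw [map_zero]
    · have : Γ.arrowVec k a (.p h n) = 0 := by rw [arrowVec, if_neg e]
      rw [this, ite_self]
      split_ifs
      · rw [arrowOp_single, this]
      · rw [map_zero]
  | z j =>
    rw [idemVec]
    split_ifs <;> simp [arrowOp_single, arrowVec]

theorem prod_arrowOp_e (a : H) (n : ℕ) (j : Γ.Edge) :
    ((List.iterate Γ.σ a (n + 1)).map (Γ.arrowOp k)).prod (Finsupp.single (.e j) 1) =
      if Γ.src (Γ.σ^[n] a) = j then Γ.pathVec k a n else 0 := by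
  induction n generalizing a with
  | zero =>
    rw [List.iterate, List.iterate, List.map_cons, List.prod_cons, List.map_nil, List.prod_nil,
      mul_one, arrowOp_single, arrowVec]
    rfl
  | succ n ih =>
    rw [List.iterate, List.map_cons, List.prod_cons, Module.End.mul_apply, ih,
      Function.iterate_succ_apply]
    split_ifs
    · rw [arrowOp_pathVec, if_pos rfl]
    · rw [map_zero]

theorem prod_arrowOp_p (a : H) (n : ℕ) (h : H) (n' : ℕ) :
    ((List.iterate Γ.σ a (n + 1)).map (Γ.arrowOp k)).prod (Finsupp.single (.p h n') 1) =
      if Γ.σ^[n + 1] a = h then Γ.pathVec k a (n + 1 + n') else 0 := by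
  induction n generalizing a with
  | zero =>
    rw [List.iterate, List.iterate, List.map_cons, List.prod_cons, List.map_nil, List.prod_nil,
      mul_one, arrowOp_single, arrowVec, add_comm (0 + 1)]
    rfl
  | succ n ih =>
    rw [List.iterate, List.map_cons, List.prod_cons, Module.End.mul_apply, ih,
      Function.iterate_succ_apply _ (n + 1)]
    split_ifs
    · rw [arrowOp_pathVec, if_pos rfl]
      congr 1
      omega
    · rw [map_zero]

theorem prod_arrowOp_z (a : H) (n : ℕ) (j : Γ.Edge) :
    ((List.iterate Γ.σ a (n + 1)).map (Γ.arrowOp k)).prod (Finsupp.single (.z j) 1) = 0 := by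
  rw [iterate_succ_last, List.map_append, List.prod_append, Module.End.mul_apply, List.map_cons,
    List.map_nil, List.prod_cons, List.prod_nil, mul_one, arrowOp_single, arrowVec, map_zero]

theorem end_ext {f g : Module.End k (Γ.Word →₀ k)}
    (hfg : ∀ w, f (Finsupp.single w 1) = g (Finsupp.single w 1)) : f = g :=
  Finsupp.lhom_ext' fun w => LinearMap.ext_ring (hfg w)

/-- The action of the path algebra on the span of the labels. -/
noncomputable def pathRep : PathAlgebra k Γ.src Γ.tgt →ₐ[k] Module.End k (Γ.Word →₀ k) :=
  RingQuot.liftAlgHom k ⟨FreeAlgebra.lift k (Sum.elim (Γ.idemOp k) (Γ.arrowOp k)), by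
    intro x y hxy
    cases hxy with
    | idem i =>
      rw [map_mul, FreeAlgebra.lift_ι_apply, Sum.elim_inl]
      refine Γ.end_ext k fun w => ?_
      rw [Module.End.mul_apply, idemOp_single]
      cases w <;> rw [idemVec] <;> split_ifs with e <;>
        simp [idemOp_single, idemVec, e]
    | orth i j hij =>
      rw [map_mul, FreeAlgebra.lift_ι_apply, FreeAlgebra.lift_ι_apply, Sum.elim_inl, Sum.elim_inl,
        map_zero]
      refine Γ.end_ext k fun w => ?_
      rw [Module.End.mul_apply, idemOp_single, LinearMap.zero_apply]
      cases w <;> rw [idemVec] <;> split_ifs with e <;>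
        first | rw [map_zero] | (subst e; simp [idemOp_single, idemVec, hij])
    | one =>
      have := Fintype.ofFinite Γ.Edge
      rw [finsum_eq_sum_of_fintype, map_one, map_sum]
      simp only [FreeAlgebra.lift_ι_apply, Sum.elim_inl]
      refine Γ.end_ext k fun w => ?_
      rw [LinearMap.sum_apply, Module.End.one_apply]
      simp only [idemOp_single]
      cases w <;> simp [idemVec]
    | tgt a =>
      rw [map_mul, FreeAlgebra.lift_ι_apply, FreeAlgebra.lift_ι_apply, Sum.elim_inl, Sum.elim_inr]
      refine Γ.end_ext k fun w => ?_
      rw [Module.End.mul_apply, arrowOp_single]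
      cases w <;> rw [arrowVec]
      · split_ifs
        · rw [idemOp_pathVec, if_pos rfl]
        · rw [map_zero]
      · split_ifs
        · rw [idemOp_pathVec, if_pos rfl]
        · rw [map_zero]
      · rw [map_zero]
    | src a =>
      rw [map_mul, FreeAlgebra.lift_ι_apply, FreeAlgebra.lift_ι_apply, Sum.elim_inl, Sum.elim_inr]
      refine Γ.end_ext k fun w => ?_
      rw [Module.End.mul_apply, idemOp_single, arrowOp_idemVec, if_pos rfl, arrowOp_single]⟩

theorem pathRep_pathArrow (h : H) : Γ.pathRep k (Γ.pathArrow k h) = Γ.arrowOp k h := by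
  rw [pathRep, pathArrow, RingQuot.liftAlgHom_mkAlgHom_apply, FreeAlgebra.lift_ι_apply,
    Sum.elim_inr]

theorem pathVec_last {n : ℕ} {h : H} (hn : n + 1 = Γ.len h) :
    Γ.pathVec k h n = Finsupp.single (.z (Γ.tgt h)) 1 := by
  rw [pathVec, if_neg (by omega), if_pos hn]

theorem pathVec_of_lt {n : ℕ} {h : H} (hn : n + 1 < Γ.len h) :
    Γ.pathVec k h n = Finsupp.single (.p h n) 1 := by
  rw [pathVec, if_pos hn]

/-- The resulting operator depends only on the edge of `h`, which is what the commutativity relation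
requires of the representation. -/
theorem prod_arrowOp_fullCyc (h : H) (w : Γ.Word) :
    ((Γ.fullCyc (Γ.σ h)).map (Γ.arrowOp k)).prod (Finsupp.single w 1) =
      if w = .e (Γ.edge h) then Finsupp.single (.z (Γ.edge h)) 1 else 0 := by
  obtain ⟨n, hn⟩ := Nat.exists_eq_succ_of_ne_zero (Γ.len_pos (Γ.σ h)).ne'
  have hl : Γ.σ^[n] (Γ.σ h) = h := by
    have := Γ.σ_iterate_len (Γ.σ h)
    rw [hn, Function.iterate_succ_apply'] at this
    exact Γ.σ_injective this
  rw [fullCyc_eq_iterate, hn]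
  cases w with
  | e j =>
    rw [prod_arrowOp_e, hl, src, Γ.pathVec_last k hn.symm, tgt_σ, src]
    simp only [Word.e.injEq, eq_comm]
  | p h' n' =>
    have h0 : Γ.pathVec k (Γ.σ h) (n + 1 + n') = 0 := by
      rw [pathVec, if_neg (by omega), if_neg (by omega)]
    rw [prod_arrowOp_p, h0, ite_self, if_neg (by simp)]
  | z j => rw [prod_arrowOp_z, if_neg (by simp)]

/-- The action of the Brauer graph algebra on the span of the labels. -/
noncomputable def rep : Γ.Alg k →ₐ[k] Module.End k (Γ.Word →₀ k) :=
  RingQuot.liftAlgHom k ⟨Γ.pathRep k, by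
    intro x y hxy
    cases hxy with
    | zero a b hab hb =>
      rw [map_mul, pathRep_pathArrow, pathRep_pathArrow, map_zero]
      refine Γ.end_ext k fun w => ?_
      rw [Module.End.mul_apply, arrowOp_single, LinearMap.zero_apply]
      cases w <;> rw [arrowVec]
      · split_ifs
        · rw [arrowOp_pathVec, if_neg (Ne.symm hb)]
        · rw [map_zero]
      · split_ifs
        · rw [arrowOp_pathVec, if_neg (Ne.symm hb)]
        · rw [map_zero]
      · rw [map_zero]
    | comm h =>
      rw [map_list_prod, map_list_prod, List.map_map, List.map_map]
      have : (Γ.pathRep k : PathAlgebra k Γ.src Γ.tgt → _) ∘ Γ.pathArrow k = Γ.arrowOp k :=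
        funext (Γ.pathRep_pathArrow k)
      rw [this]
      refine Γ.end_ext k fun w => ?_
      rw [prod_arrowOp_fullCyc, prod_arrowOp_fullCyc, edge_ι]⟩

theorem rep_arrow (h : H) : Γ.rep k (Γ.arrow k h) = Γ.arrowOp k h := by
  rw [← pathRep_pathArrow]
  exact RingQuot.liftAlgHom_mkAlgHom_apply k (Γ.pathRep k) _ (Γ.pathArrow k h)

theorem rep_idem (i : Γ.Edge) : Γ.rep k (Γ.idem k i) = Γ.idemOp k i := by
  refine (RingQuot.liftAlgHom_mkAlgHom_apply k (Γ.pathRep k) _ _).trans ?_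
  rw [pathRep, RingQuot.liftAlgHom_mkAlgHom_apply, FreeAlgebra.lift_ι_apply, Sum.elim_inl]

/-- The normal form of an element of the Brauer graph algebra. -/
noncomputable def nf : Γ.Alg k →ₗ[k] (Γ.Word →₀ k) :=
  (LinearMap.applyₗ (∑ᶠ i : Γ.Edge, Finsupp.single (Word.e i) (1 : k))).comp
    (Γ.rep k).toLinearMap

theorem nf_apply (b : Γ.Alg k) [Fintype Γ.Edge] :
    Γ.nf k b = ∑ i : Γ.Edge, Γ.rep k b (Finsupp.single (.e i) 1) := by
  rw [nf, finsum_eq_sum_of_fintype, map_sum, LinearMap.comp_apply, LinearMap.sum_apply]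
  rfl

theorem nf_idem (i : Γ.Edge) : Γ.nf k (Γ.idem k i) = Finsupp.single (.e i) 1 := by
  have := Fintype.ofFinite Γ.Edge
  rw [nf_apply, rep_idem]
  simp [idemOp_single, idemVec]

theorem nf_P (h : H) (n : ℕ) : Γ.nf k (Γ.P k h (n + 1)) = Γ.pathVec k h n := by
  have := Fintype.ofFinite Γ.Edge
  have h1 : (Γ.rep k : Γ.Alg k → _) ∘ Γ.arrow k = Γ.arrowOp k := funext (Γ.rep_arrow k)
  rw [nf_apply, P_succ_eq_ev, ev, map_list_prod, List.map_map, h1]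
  simp only [prod_arrowOp_e, Finset.sum_ite_eq, Finset.mem_univ, if_true]

/-! ### Generation -/

variable {Γ k} in
theorem alg_induction {C : Γ.Alg k → Prop} (b : Γ.Alg k)
    (algebraMap : ∀ r, C (algebraMap k _ r)) (idem : ∀ i, C (Γ.idem k i))
    (arrow : ∀ h, C (Γ.arrow k h)) (mul : ∀ a b, C a → C b → C (a * b))
    (add : ∀ a b, C a → C b → C (a + b)) : C b := by
  obtain ⟨p, rfl⟩ := RingQuot.mkAlgHom_surjective k (Γ.Rel k) b
  obtain ⟨x, rfl⟩ := RingQuot.mkAlgHom_surjective k (PathRel k Γ.src Γ.tgt) p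
  change C (Γ.proj k _)
  induction x using FreeAlgebra.induction with
  | grade0 r =>
    rw [AlgHom.commutes, AlgHom.commutes]
    exact algebraMap r
  | grade1 x =>
    cases x with
    | inl i => exact idem i
    | inr h => exact arrow h
  | mul a b ha hb =>
    rw [map_mul, map_mul]
    exact mul _ _ ha hb
  | add a b ha hb =>
    rw [map_add, map_add]
    exact add _ _ ha hb

theorem arrow_mul_idem (h : H) (i : Γ.Edge) :
    Γ.arrow k h * Γ.idem k i = if Γ.src h = i then Γ.arrow k h else 0 := by
  rw [← P_one, P_mul_idem, Function.iterate_one, tgt_σ]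

theorem idem_mul_arrow (h : H) (i : Γ.Edge) :
    Γ.idem k i * Γ.arrow k h = if i = Γ.tgt h then Γ.arrow k h else 0 := by
  rw [← P_one, idem_mul_P]

theorem arrow_mul_P_of_ne {a h : H} (e : Γ.σ a ≠ h) (n : ℕ) :
    Γ.arrow k a * Γ.P k h (n + 1) = 0 := by
  rw [← P_one]
  exact Γ.P_succ_mul_P_succ_of_ne k (m := 0) n e

theorem mem_of_idem_of_P (S : Submodule k (Γ.Alg k)) (he : ∀ i, Γ.idem k i ∈ S)
    (hP : ∀ h n, n + 1 ≤ Γ.len h → Γ.P k h (n + 1) ∈ S) (b : Γ.Alg k) : b ∈ S := by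
  have hP' : ∀ h n, Γ.P k h (n + 1) ∈ S := fun h n => by
    by_cases hn : n + 1 ≤ Γ.len h
    · exact hP h n hn
    · rw [Γ.P_of_len_lt k (not_le.1 hn)]
      exact S.zero_mem
  -- The submodule `S` need not be stable under left multiplication, so the induction on `b` runs
  -- over the span of all generators, which is a left ideal containing 1.
  set S' := Submodule.span k (Set.range (Γ.idem k) ∪ Set.range fun x : H × ℕ => Γ.P k x.1 (x.2 + 1))
  have hS : S' ≤ S := by
    rw [Submodule.span_le]
    rintro _ (⟨i, rfl⟩ | ⟨x, rfl⟩)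
    · exact he i
    · exact hP' _ _
  have e1 : ∀ i, Γ.idem k i ∈ S' := fun i => Submodule.subset_span (Or.inl ⟨i, rfl⟩)
  have e2 : ∀ h n, Γ.P k h (n + 1) ∈ S' := fun h n => Submodule.subset_span (Or.inr ⟨(h, n), rfl⟩)
  apply hS
  have key : ∀ c ∈ S', b * c ∈ S' := by
    induction b using alg_induction with
    | algebraMap r =>
      intro c hc
      rw [← Algebra.smul_def]
      exact S'.smul_mem _ hc
    | idem i =>
      intro c hc
      induction hc using Submodule.span_induction with
      | mem c hc =>
        rcases hc with ⟨j, rfl⟩ | ⟨x, rfl⟩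
        · rw [idem_mul_idem]
          split_ifs
          · exact e1 _
          · exact S'.zero_mem
        · rw [idem_mul_P]
          split_ifs
          · exact e2 _ _
          · exact S'.zero_mem
      | zero => rw [mul_zero]; exact S'.zero_mem
      | add a b _ _ ha hb => rw [mul_add]; exact S'.add_mem ha hb
      | smul r a _ ha => rw [mul_smul_comm]; exact S'.smul_mem _ ha
    | arrow h =>
      intro c hc
      induction hc using Submodule.span_induction with
      | mem c hc =>
        rcases hc with ⟨j, rfl⟩ | ⟨⟨x, n⟩, rfl⟩
        · rw [arrow_mul_idem]
          split_ifs
          · rw [← P_one]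
            exact e2 h 0
          · exact S'.zero_mem
        · by_cases e : Γ.σ h = x
          · subst e
            rw [arrow_mul_P]
            exact e2 _ _
          · rw [Γ.arrow_mul_P_of_ne k e]
            exact S'.zero_mem
      | zero => rw [mul_zero]; exact S'.zero_mem
      | add a b _ _ ha hb => rw [mul_add]; exact S'.add_mem ha hb
      | smul r a _ ha => rw [mul_smul_comm]; exact S'.smul_mem _ ha
    | mul a b ha hb =>
      intro c hc
      rw [mul_assoc]
      exact ha _ (hb _ hc)
    | add a b ha hb =>
      intro c hc
      rw [add_mul]
      exact S'.add_mem (ha _ hc) (hb _ hc)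
  have := Fintype.ofFinite Γ.Edge
  rw [← mul_one b, ← Γ.sum_idem k]
  exact key _ (Submodule.sum_mem _ fun i _ => e1 i)

theorem linearMap_ext {M : Type*} [AddCommGroup M] [Module k M] {f g : Γ.Alg k →ₗ[k] M}
    (he : ∀ i, f (Γ.idem k i) = g (Γ.idem k i))
    (hP : ∀ h n, n + 1 ≤ Γ.len h → f (Γ.P k h (n + 1)) = g (Γ.P k h (n + 1))) : f = g :=
  LinearMap.ext fun b => Γ.mem_of_idem_of_P k (LinearMap.eqLocus f g) he hP b

/-! ### The symmetrizing form -/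

/-- The symmetrizing form: the sum of the coefficients of the socle elements. -/
noncomputable def τ : Γ.Alg k →ₗ[k] k :=
  (Finsupp.linearCombination k fun w : Γ.Word => match w with
    | .e _ => (0 : k)
    | .p _ _ => 0
    | .z _ => 1).comp (Γ.nf k)

theorem τ_idem (i : Γ.Edge) : Γ.τ k (Γ.idem k i) = 0 := by
  rw [τ, LinearMap.comp_apply, nf_idem, Finsupp.linearCombination_single, smul_zero]

theorem τ_P_succ (h : H) (n : ℕ) :
    Γ.τ k (Γ.P k h (n + 1)) = if n + 1 = Γ.len h then 1 else 0 := by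
  rw [τ, LinearMap.comp_apply, nf_P, pathVec]
  split_ifs with h1 h2 h2
  · omega
  · rw [Finsupp.linearCombination_single, smul_zero]
  · rw [Finsupp.linearCombination_single, smul_eq_mul, one_mul]
  · rw [map_zero]

theorem τ_P (h : H) (n : ℕ) : Γ.τ k (Γ.P k h n) = if n = Γ.len h then 1 else 0 := by
  cases n with
  | zero => rw [P_zero, τ_idem, if_neg (Γ.len_pos h).ne]
  | succ n => exact Γ.τ_P_succ k h n

/-- Two nontrivial paths have a product with nonzero τ exactly when they are complementary in a full
cycle. This is symmetric, since rotating a full cycle gives a full cycle of the same length. -/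
theorem τ_mul_comm (a b : Γ.Alg k) : Γ.τ k (a * b) = Γ.τ k (b * a) := by
  suffices h : (LinearMap.mul k (Γ.Alg k)).compr₂ (Γ.τ k) =
      (LinearMap.mul k (Γ.Alg k)).flip.compr₂ (Γ.τ k) from
    LinearMap.congr_fun (LinearMap.congr_fun h a) b
  refine Γ.linearMap_ext k (fun i => Γ.linearMap_ext k (fun j => ?_) fun h n hn => ?_)
    fun h n hn => Γ.linearMap_ext k (fun j => ?_) fun h' n' hn' => ?_
  · simp only [LinearMap.compr₂_apply, LinearMap.flip_apply, LinearMap.mul_apply', idem_mul_idem]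
    split_ifs <;> simp_all [τ_idem]
  · simp only [LinearMap.compr₂_apply, LinearMap.flip_apply, LinearMap.mul_apply', idem_mul_P,
      P_mul_idem]
    by_cases e : n + 1 = Γ.len h
    · rw [e, σ_iterate_len]
      simp only [eq_comm]
    · split_ifs <;> simp [τ_P, e]
  · simp only [LinearMap.compr₂_apply, LinearMap.flip_apply, LinearMap.mul_apply', idem_mul_P,
      P_mul_idem]
    by_cases e : n + 1 = Γ.len h
    · rw [e, σ_iterate_len]
      simp only [eq_comm]
    · split_ifs <;> simp [τ_P, e]
  · simp only [LinearMap.compr₂_apply, LinearMap.flip_apply, LinearMap.mul_apply']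
    have key : ∀ {h h' : H} {n n' : ℕ}, Γ.σ^[n + 1] h = h' → n + 1 + (n' + 1) = Γ.len h →
        Γ.σ^[n' + 1] h' = h ∧ n' + 1 + (n + 1) = Γ.len h' := by
      rintro h h' n n' rfl e
      rw [← Function.iterate_add_apply, len_σ_iterate]
      refine ⟨?_, by omega⟩
      rw [add_comm (n' + 1), e, σ_iterate_len]
    have calc1 : ∀ {h h' : H} {n n' : ℕ}, Γ.τ k (Γ.P k h (n + 1) * Γ.P k h' (n' + 1)) =
        if Γ.σ^[n + 1] h = h' ∧ n + 1 + (n' + 1) = Γ.len h then 1 else 0 := by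
      intro h h' n n'
      by_cases e : Γ.σ^[n + 1] h = h'
      · rw [← e, P_mul_P, τ_P]
        simp
      · rw [Γ.P_succ_mul_P_succ_of_ne k _ e, map_zero, if_neg (fun h => e h.1)]
    rw [calc1, calc1]
    congr 1
    exact propext ⟨fun hh => key hh.1 hh.2, fun hh => key hh.1 hh.2⟩

theorem τ_P_mul_P_pos {h h' : H} {m n : ℕ} (hm : 0 < m) (hn : 0 < n) :
    Γ.τ k (Γ.P k h m * Γ.P k h' n) = if Γ.σ^[m] h = h' ∧ m + n = Γ.len h then 1 else 0 := by
  by_cases e : Γ.σ^[m] h = h'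
  · rw [← e, P_mul_P, τ_P]
    simp
  · rw [Γ.P_mul_P_of_ne k hm hn e, map_zero, if_neg (fun h => e h.1)]

/-- The coefficient of the path `P h j` in an element. -/
noncomputable def coef (h : H) (j : ℕ) : Γ.Alg k →ₗ[k] k :=
  (Γ.τ k).comp (LinearMap.mulLeft k (Γ.P k (Γ.σ^[j] h) (Γ.len h - j)))

theorem coef_apply (h : H) (j : ℕ) (u : Γ.Alg k) :
    Γ.coef k h j u = Γ.τ k (Γ.P k (Γ.σ^[j] h) (Γ.len h - j) * u) := rfl

theorem coef_apply' (h : H) (j : ℕ) (u : Γ.Alg k) :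
    Γ.coef k h j u = Γ.τ k (u * Γ.P k (Γ.σ^[j] h) (Γ.len h - j)) := by
  rw [coef_apply, τ_mul_comm]

theorem coef_idem {h : H} {j : ℕ} (hj : j ≤ Γ.len h) (i : Γ.Edge) :
    Γ.coef k h j (Γ.idem k i) = if j = 0 ∧ i = Γ.tgt h then 1 else 0 := by
  rw [coef_apply, P_mul_idem, σ_iterate_len_sub _ _ hj]
  rcases Nat.eq_zero_or_pos j with rfl | hj'
  · rw [Nat.sub_zero]
    split_ifs with h1 h2 h2
    · rw [Function.iterate_zero, id, τ_P, if_pos rfl]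
    · exact absurd ⟨rfl, h1.symm⟩ h2
    · exact absurd h2.2.symm h1
    · rw [map_zero]
  · rw [if_neg (fun hh : j = 0 ∧ _ => hj'.ne' hh.1)]
    split_ifs
    · rw [τ_P, len_σ_iterate, if_neg (by have := Γ.len_pos h; omega)]
    · rw [map_zero]

/-- The bound on `j` is strict because the two full cycles ending at an edge coincide: for `j = len
h` a path around the other end also has coefficient one, see `coef_len_P`. -/
theorem coef_P {h : H} {j : ℕ} (hj : j < Γ.len h) {q : H} {n : ℕ} (hn : 0 < n) :
    Γ.coef k h j (Γ.P k q n) = if q = h ∧ n = j then 1 else 0 := by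
  rw [coef_apply, Γ.τ_P_mul_P_pos k (by omega) hn, σ_iterate_len_sub _ _ hj.le, len_σ_iterate]
  congr 1
  refine propext ⟨fun hh => ⟨hh.1.symm, by omega⟩, fun hh => ⟨hh.1.symm, by omega⟩⟩

theorem coef_len (h : H) (u : Γ.Alg k) :
    Γ.coef k h (Γ.len h) u = Γ.τ k (Γ.idem k (Γ.tgt h) * u) := by
  rw [coef_apply, Nat.sub_self, P_zero, σ_iterate_len]

theorem coef_len_P (h q : H) (n : ℕ) : Γ.coef k h (Γ.len h) (Γ.P k q n) =
    if Γ.tgt q = Γ.tgt h ∧ n = Γ.len q then 1 else 0 := by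
  rw [coef_len, idem_mul_P]
  split_ifs with h1 h2 h2
  · rw [h2.2, τ_P, if_pos rfl]
  · rw [τ_P, if_neg (fun e => h2 ⟨h1.symm, e⟩)]
  · exact absurd h2.1.symm h1
  · rw [map_zero]

theorem coef_zero (h : H) (u : Γ.Alg k) :
    Γ.coef k h 0 u = Γ.τ k (Γ.P k h (Γ.len h) * u) := rfl

/-- The expansion of the elements ending at the target of `α_h` into paths. -/
theorem idem_mul_eq (h : H) (u : Γ.Alg k) :
    Γ.idem k (Γ.tgt h) * u = ∑ j ∈ Finset.range (Γ.len h), Γ.coef k h j u • Γ.P k h j +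
      ∑ j ∈ Finset.range (Γ.len (Γ.op h)),
        Γ.coef k (Γ.op h) (j + 1) u • Γ.P k (Γ.op h) (j + 1) := by
  suffices e : LinearMap.mulLeft k (Γ.idem k (Γ.tgt h)) =
      ∑ j ∈ Finset.range (Γ.len h), (Γ.coef k h j).smulRight (Γ.P k h j) +
      ∑ j ∈ Finset.range (Γ.len (Γ.op h)),
        (Γ.coef k (Γ.op h) (j + 1)).smulRight (Γ.P k (Γ.op h) (j + 1)) by
    simpa using LinearMap.congr_fun e u
  -- The index ranges avoid double counting: the trivial path occurs only in the first sum, at `j =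
  -- 0`, and the socle element only in the second, as the full cycle of `op h`.
  refine Γ.linearMap_ext k (fun i => ?_) fun q n hn => ?_
  · simp only [LinearMap.mulLeft_apply, LinearMap.add_apply, LinearMap.sum_apply,
      LinearMap.smulRight_apply]
    rw [Finset.sum_eq_single_of_mem 0 (Finset.mem_range.2 (Γ.len_pos h)), Finset.sum_eq_zero,
      add_zero, coef_idem _ _ (Nat.zero_le _), P_zero, idem_mul_idem]
    · simp [eq_comm]
    · intro j hj
      rw [coef_idem _ _ (by simpa using hj), if_neg (by simp), zero_smul]
    · intro j hj hj'
      rw [coef_idem _ _ (Finset.mem_range.1 hj).le, if_neg (by simp [hj']), zero_smul]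
  · simp only [LinearMap.mulLeft_apply, LinearMap.add_apply, LinearMap.sum_apply,
      LinearMap.smulRight_apply, idem_mul_P]
    rcases hn.lt_or_eq with hn | hn
    · have e1 : ∀ j ∈ Finset.range (Γ.len h), Γ.coef k h j (Γ.P k q (n + 1)) • Γ.P k h j =
          if n + 1 = j then (if q = h then Γ.P k q (n + 1) else 0) else 0 := by
        intro j hj
        rw [Γ.coef_P k (Finset.mem_range.1 hj) n.succ_pos]
        split_ifs with h1 h2 h3 h2 <;> simp_all
      have e2 : ∀ j ∈ Finset.range (Γ.len (Γ.op h)),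
          Γ.coef k (Γ.op h) (j + 1) (Γ.P k q (n + 1)) • Γ.P k (Γ.op h) (j + 1) =
          if n = j then (if q = Γ.op h then Γ.P k q (n + 1) else 0) else 0 := by
        intro j hj
        rcases (Nat.succ_le_of_lt (Finset.mem_range.1 hj)).lt_or_eq with hj' | hj'
        · rw [Γ.coef_P k hj' n.succ_pos]
          split_ifs with h1 h2 h3 h2 <;> simp_all
        · rw [← Nat.succ_eq_add_one j, hj', coef_len_P, if_neg (fun hh => hn.ne hh.2), zero_smul]
          split_ifs with h1 h2
          · subst h2
            omega
          · rfl
          · rfl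
      rw [Finset.sum_congr rfl e1, Finset.sum_congr rfl e2, Finset.sum_ite_eq, Finset.sum_ite_eq]
      simp only [Finset.mem_range]
      by_cases h1 : q = h
      · subst h1
        rw [if_pos rfl, if_pos hn, if_pos rfl, if_neg (Γ.op_ne q).symm, ite_self, add_zero]
      · rw [if_neg h1, ite_self, zero_add]
        by_cases h2 : q = Γ.op h
        · subst h2
          rw [if_pos rfl, if_pos (Γ.tgt_op h).symm, if_pos (by omega)]
        · rw [if_neg h2, ite_self, if_neg]
          rw [tgt_eq_iff]
          tauto
    · rw [Finset.sum_eq_zero, zero_add]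
      · obtain ⟨l, hl⟩ := Nat.exists_eq_succ_of_ne_zero (Γ.len_pos (Γ.op h)).ne'
        rw [hl, Finset.sum_range_succ, Finset.sum_eq_zero, zero_add, ← Nat.succ_eq_add_one l, ← hl,
          coef_len_P, tgt_op, hn, P_len_op]
        · by_cases e : Γ.tgt h = Γ.tgt q
          · rw [if_pos e, if_pos ⟨e.symm, rfl⟩, one_smul, Γ.P_len_of_tgt_eq k e]
          · rw [if_neg e, if_neg (fun hh => e hh.1.symm), zero_smul]
        · intro j hj
          have := Finset.mem_range.1 hj
          rw [Γ.coef_P k (by omega) n.succ_pos, if_neg, zero_smul]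
          rintro ⟨rfl, _⟩
          omega
      · intro j hj
        have := Finset.mem_range.1 hj
        rw [Γ.coef_P k (by omega) n.succ_pos, if_neg, zero_smul]
        rintro ⟨rfl, _⟩
        omega

/-- In the expansion of the part of `u` that is composable with the path, the paths beginning with
the other arrow `op` are annihilated because `l` is positive. -/
theorem P_mul_eq {l : ℕ} (hl : 0 < l) (q : H) (u : Γ.Alg k) :
    Γ.P k q l * u =
      ∑ j ∈ Finset.range (Γ.len q), Γ.coef k (Γ.σ^[l] q) j u • Γ.P k q (l + j) := by
  rw [← P_mul_idem_tgt, mul_assoc, idem_mul_eq, mul_add, Finset.mul_sum, Finset.mul_sum,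
    len_σ_iterate]
  simp only [mul_smul_comm, P_mul_P]
  rw [Finset.sum_eq_zero (s := Finset.range (Γ.len (Γ.op _))), add_zero]
  intro j _
  rw [Γ.P_mul_P_of_ne k hl j.succ_pos (Γ.op_ne _).symm, smul_zero]

end NormalForms

/-! ## The differential of the bimodule resolution -/

section Differential

open scoped Classical

variable {V H : Type*} (Γ : BrauerGraph V H) (k : Type*) [Field k] [Finite H]

/-- The bimodule `B ⊗ kQ₁ ⊗ B`, with tensor products over `k`. -/
abbrev Bim : Type _ := H →₀ Γ.Alg k ⊗[k] Γ.Alg k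

variable {Γ k} in
theorem bim_ext {I M : Type*} [AddCommGroup M] [Module k M]
    {f g : (I →₀ Γ.Alg k ⊗[k] Γ.Alg k) →ₗ[k] M}
    (hfg : ∀ h a b, f (Finsupp.single h (a ⊗ₜ[k] b)) = g (Finsupp.single h (a ⊗ₜ[k] b))) :
    f = g :=
  Finsupp.lhom_ext' fun h => TensorProduct.ext' fun a b => hfg h a b

/-- The two-sided action of `B` on `B ⊗ kQ₁ ⊗ B`. -/
noncomputable def act (a b : Γ.Alg k) : Γ.Bim k →ₗ[k] Γ.Bim k :=
  Finsupp.mapRange.linearMap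
    (TensorProduct.map (LinearMap.mulLeft k a) (LinearMap.mulRight k b))

theorem act_single (a b : Γ.Alg k) (h : H) (x y : Γ.Alg k) :
    Γ.act k a b (Finsupp.single h (x ⊗ₜ[k] y)) = Finsupp.single h ((a * x) ⊗ₜ[k] (y * b)) := by
  rw [act, Finsupp.mapRange.linearMap_apply, Finsupp.mapRange_single, TensorProduct.map_tmul,
    LinearMap.mulLeft_apply, LinearMap.mulRight_apply]

theorem act_act (a b a' b' : Γ.Alg k) (x : Γ.Bim k) :
    Γ.act k a b (Γ.act k a' b' x) = Γ.act k (a * a') (b' * b) x := by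
  suffices h : (Γ.act k a b).comp (Γ.act k a' b') = Γ.act k (a * a') (b' * b) from
    LinearMap.congr_fun h x
  refine bim_ext fun h x y => ?_
  rw [LinearMap.comp_apply, act_single, act_single, act_single, mul_assoc, mul_assoc]

theorem act_one_one (x : Γ.Bim k) : Γ.act k 1 1 x = x := by
  suffices h : Γ.act k 1 1 = LinearMap.id from LinearMap.congr_fun h x
  refine bim_ext fun h x y => ?_
  rw [act_single, one_mul, mul_one, LinearMap.id_apply]

theorem act_add_left (a a' b : Γ.Alg k) (x : Γ.Bim k) :
    Γ.act k (a + a') b x = Γ.act k a b x + Γ.act k a' b x := by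
  suffices h : Γ.act k (a + a') b = Γ.act k a b + Γ.act k a' b from LinearMap.congr_fun h x
  refine bim_ext fun h x y => ?_
  rw [LinearMap.add_apply, act_single, act_single, act_single, add_mul, TensorProduct.add_tmul,
    Finsupp.single_add]

theorem act_add_right (a b b' : Γ.Alg k) (x : Γ.Bim k) :
    Γ.act k a (b + b') x = Γ.act k a b x + Γ.act k a b' x := by
  suffices h : Γ.act k a (b + b') = Γ.act k a b + Γ.act k a b' from LinearMap.congr_fun h x
  refine bim_ext fun h x y => ?_
  rw [LinearMap.add_apply, act_single, act_single, act_single, mul_add, TensorProduct.tmul_add,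
    Finsupp.single_add]

theorem act_smul_left (r : k) (a b : Γ.Alg k) (x : Γ.Bim k) :
    Γ.act k (r • a) b x = r • Γ.act k a b x := by
  suffices h : Γ.act k (r • a) b = r • Γ.act k a b from LinearMap.congr_fun h x
  refine bim_ext fun h x y => ?_
  rw [LinearMap.smul_apply, act_single, act_single, smul_mul_assoc, ← TensorProduct.smul_tmul',
    Finsupp.smul_single]

theorem act_smul_right (r : k) (a b : Γ.Alg k) (x : Γ.Bim k) :
    Γ.act k a (r • b) x = r • Γ.act k a b x := by
  suffices h : Γ.act k a (r • b) = r • Γ.act k a b from LinearMap.congr_fun h x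
  refine bim_ext fun h x y => ?_
  rw [LinearMap.smul_apply, act_single, act_single, mul_smul_comm, TensorProduct.tmul_smul,
    Finsupp.smul_single]

theorem act_zero_left (b : Γ.Alg k) (x : Γ.Bim k) : Γ.act k 0 b x = 0 := by
  rw [← zero_smul k (0 : Γ.Alg k), act_smul_left, zero_smul]

theorem act_zero_right (a : Γ.Alg k) (x : Γ.Bim k) : Γ.act k a 0 x = 0 := by
  rw [← zero_smul k (0 : Γ.Alg k), act_smul_right, zero_smul]

/-- The universal derivative of the path `P h n`. -/
noncomputable def nab (h : H) (n : ℕ) : Γ.Bim k :=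
  ∑ j ∈ Finset.range n,
    Finsupp.single (Γ.σ^[j] h) (Γ.P k h j ⊗ₜ[k] Γ.P k (Γ.σ^[j + 1] h) (n - 1 - j))

theorem nab_one (h : H) : Γ.nab k h 1 =
    Finsupp.single h (Γ.idem k (Γ.tgt h) ⊗ₜ[k] Γ.idem k (Γ.src h)) := by
  rw [nab, Finset.sum_range_one, P_zero, Nat.sub_self, P_zero]
  rw [Function.iterate_zero, id, zero_add, Function.iterate_one, tgt_σ]

/-- The Leibniz rule for a product of two consecutive paths. -/
theorem nab_add (h : H) (m n : ℕ) : Γ.nab k h (m + n) =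
    Γ.act k 1 (Γ.P k (Γ.σ^[m] h) n) (Γ.nab k h m) +
      Γ.act k (Γ.P k h m) 1 (Γ.nab k (Γ.σ^[m] h) n) := by
  rw [nab, Finset.sum_range_add, nab, nab, map_sum, map_sum]
  congr 1
  · refine Finset.sum_congr rfl fun j hj => ?_
    have hj := Finset.mem_range.1 hj
    rw [act_single, one_mul, show Γ.σ^[m] h = Γ.σ^[m - 1 - j] (Γ.σ^[j + 1] h) by
      rw [← Function.iterate_add_apply]; congr 1; omega, P_mul_P]
    congr 4
    omega
  · refine Finset.sum_congr rfl fun j hj => ?_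
    have hj := Finset.mem_range.1 hj
    rw [act_single, mul_one, P_mul_P, ← Function.iterate_add_apply, ← Function.iterate_add_apply,
      add_comm j m, show j + 1 + m = m + j + 1 by omega,
      show m + n - 1 - (m + j) = n - 1 - j by omega]

theorem act_nab (h : H) (n : ℕ) :
    Γ.act k (Γ.idem k (Γ.tgt h)) (Γ.idem k (Γ.tgt (Γ.σ^[n] h))) (Γ.nab k h n) = Γ.nab k h n := by
  rw [nab, map_sum]
  refine Finset.sum_congr rfl fun j hj => ?_
  have hj := Finset.mem_range.1 hj
  rw [act_single, idem_tgt_mul_P, show Γ.σ^[n] h = Γ.σ^[n - 1 - j] (Γ.σ^[j + 1] h) by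
      rw [← Function.iterate_add_apply]; congr 1; omega, P_mul_idem_tgt]

theorem nab_succ (h : H) (n : ℕ) : Γ.nab k h (n + 1) =
    Finsupp.single h (Γ.idem k (Γ.tgt h) ⊗ₜ[k] Γ.P k (Γ.σ h) n) +
      Γ.act k (Γ.arrow k h) 1 (Γ.nab k (Γ.σ h) n) := by
  rw [add_comm n, nab_add, nab_one, act_single, one_mul, P_one, ← tgt_σ, Function.iterate_one,
    idem_tgt_mul_P]

theorem nab_succ' (h : H) (n : ℕ) : Γ.nab k h (n + 1) =
    Γ.act k 1 (Γ.arrow k (Γ.σ^[n] h)) (Γ.nab k h n) +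
      Finsupp.single (Γ.σ^[n] h) (Γ.P k h n ⊗ₜ[k] Γ.idem k (Γ.src (Γ.σ^[n] h))) := by
  rw [nab_add, nab_one, act_single, mul_one, P_one, P_mul_idem_tgt]

theorem drop_iterate {α : Type*} (f : α → α) (a : α) {n j : ℕ} (hj : j ≤ n) :
    (List.iterate f a n).drop j = List.iterate f (f^[j] a) (n - j) := by
  obtain ⟨d, rfl⟩ := Nat.exists_eq_add_of_le hj
  rw [List.iterate_add, List.drop_left' (by simp)]
  congr 1
  omega

theorem sum_iterate {α M : Type*} [AddCommMonoid M] (f : α → α) (a : α) (n : ℕ)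
    (G : List α → α → List α → M) :
    ∑ i : Fin (List.iterate f a n).length, G ((List.iterate f a n).take i)
      ((List.iterate f a n).get i) ((List.iterate f a n).drop (i + 1)) =
    ∑ j ∈ Finset.range n, G (List.iterate f a j) (f^[j] a)
      (List.iterate f (f^[j + 1] a) (n - 1 - j)) := by
  rw [Finset.sum_range]
  refine Fintype.sum_equiv (finCongr (List.length_iterate f a n)) _ _ fun i => ?_
  have hi : (i : ℕ) < n := by simpa using i.2
  rw [List.take_iterate, min_eq_left hi.le, drop_iterate f a (by omega), List.get_eq_getElem,
    List.getElem_iterate, finCongr_apply_coe]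
  congr 2
  omega

theorem ev_mul_idem_tgt (h : H) (n : ℕ) :
    Γ.ev k (List.iterate Γ.σ h n) * Γ.idem k (Γ.tgt (Γ.σ^[n] h)) = Γ.P k h n := by
  cases n with
  | zero => rw [P_zero, List.iterate, ev_nil, one_mul, Function.iterate_zero, id]
  | succ n => rw [← P_succ_eq_ev, P_mul_idem_tgt]

variable (V₁ : Set V)

theorem relation_sum_a {M : Type*} [AddCommGroup M] [Module k M] {h : H} (h₁ : Γ.s h ∈ V₁)
    (h₂ : Γ.IsArrow' V₁ h) (g : List H → M) :
    (((Tip.a h h₁ h₂).relation k).sum fun p c => c • g p) =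
      g (List.iterate Γ.σ (Γ.σ h) (Γ.len h)) -
        g (List.iterate Γ.σ (Γ.σ (Γ.ι h)) (Γ.len (Γ.ι h))) := by
  change Finsupp.linearCombination k g _ = _
  rw [Tip.relation, map_sub, Finsupp.linearCombination_single, one_smul, Tip.phi,
    Finsupp.linearCombination_single, one_smul, Tip.path, fullCyc_eq_iterate, fullCyc_eq_iterate,
    len_σ, len_σ]

theorem relation_sum_b {M : Type*} [AddCommGroup M] [Module k M] {h : H} (h₂ : Γ.s h ∉ V₁)
    (g : List H → M) : (((Tip.b h h₂).relation k).sum fun p c => c • g p) =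
      g (List.iterate Γ.σ h (Γ.len h + 1)) := by
  change Finsupp.linearCombination k g _ = _
  rw [Tip.relation, map_sub, Finsupp.linearCombination_single, one_smul, Tip.phi, map_zero,
    sub_zero, Tip.path, iterate_succ_last, σ_iterate_len, fullCyc_eq_iterate]

theorem relation_sum_c {M : Type*} [AddCommGroup M] [Module k M] {x y : H}
    (hx : Γ.IsArrow' V₁ x) (hy : Γ.IsArrow' V₁ y) (hxy : Γ.src x = Γ.tgt y) (hσ : y ≠ Γ.σ x)
    (g : List H → M) : (((Tip.c x y hx hy hxy hσ).relation k).sum fun p c => c • g p) =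
      g [x, y] := by
  change Finsupp.linearCombination k g _ = _
  rw [Tip.relation, map_sub, Finsupp.linearCombination_single, one_smul, Tip.phi, map_zero,
    sub_zero, Tip.path]

theorem sum_pair {α M : Type*} [AddCommMonoid M] (x y : α) (G : List α → α → List α → M) :
    ∑ i : Fin [x, y].length, G ([x, y].take i) ([x, y].get i) ([x, y].drop (i + 1)) =
      G [] x [y] + G [x] y [] :=
  Fin.sum_univ_two fun i : Fin 2 => G ([x, y].take i) ([x, y].get i) ([x, y].drop (i + 1))

variable {V₁} in
/-- The image of `1 ⊗ s ⊗ 1` under the differential. -/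
noncomputable def relBim : Γ.Tip V₁ → Γ.Bim k
  | .a h _ _ => Γ.nab k (Γ.σ h) (Γ.len h) - Γ.nab k (Γ.σ (Γ.ι h)) (Γ.len (Γ.ι h))
  | .b h _ => Γ.nab k h (Γ.len h + 1)
  | .c x y _ _ _ _ => Finsupp.single x (Γ.idem k (Γ.tgt x) ⊗ₜ[k] Γ.arrow k y) +
      Finsupp.single y (Γ.arrow k x ⊗ₜ[k] Γ.idem k (Γ.src y))

theorem sum_iterate_single {h : H} {n : ℕ} {i j : Γ.Edge} (hi : i = Γ.tgt h)
    (hj : j = Γ.tgt (Γ.σ^[n] h)) (a b : Γ.Alg k) :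
    ∑ l : Fin (List.iterate Γ.σ h n).length,
      (Finsupp.single ((List.iterate Γ.σ h n).get l)
        ((a * (Γ.idem k i * Γ.ev k ((List.iterate Γ.σ h n).take l))) ⊗ₜ[k]
          (Γ.ev k ((List.iterate Γ.σ h n).drop (l + 1)) * Γ.idem k j * b)) : Γ.Bim k) =
      Γ.act k a b (Γ.nab k h n) := by
  subst hi hj
  rw [sum_iterate Γ.σ h n fun p x q => (Finsupp.single x
    ((a * (Γ.idem k (Γ.tgt h) * Γ.ev k p)) ⊗ₜ[k]
      (Γ.ev k q * Γ.idem k (Γ.tgt (Γ.σ^[n] h)) * b)) : Γ.Bim k), nab, map_sum]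
  refine Finset.sum_congr rfl fun l hl => ?_
  have hl := Finset.mem_range.1 hl
  rw [act_single, show Γ.σ^[n] h = Γ.σ^[n - 1 - l] (Γ.σ^[l + 1] h) by
      rw [← Function.iterate_add_apply]; congr 1; omega, ev_mul_idem_tgt]
  rfl

theorem boundary2_single (t : Γ.Tip V₁) (a b : Γ.Alg k) :
    Γ.boundary2 k V₁ (Finsupp.single t (a ⊗ₜ[k] b)) = Γ.act k a b (Γ.relBim k t) := by
  rw [boundary2, Finsupp.lsum_single]
  cases t with
  | a h _ _ =>
    rw [relation_sum_a]
    simp only [LinearMap.sub_apply, LinearMap.sum_apply, LinearMap.comp_apply,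
      TensorProduct.map_tmul, LinearMap.mulRight_apply, LinearMap.mulLeft_apply,
      Finsupp.lsingle_apply]
    rw [sum_iterate_single, sum_iterate_single, relBim, map_sub]
    · rw [tgt_σ, src, edge_ι]; rfl
    · rw [← Γ.len_σ (Γ.ι h), σ_iterate_len, tgt_σ, src, edge_ι]; rfl
    · rw [tgt_σ, src]; rfl
    · rw [← Γ.len_σ h, σ_iterate_len, tgt_σ, src]; rfl
  | b h _ =>
    rw [relation_sum_b]
    simp only [LinearMap.sum_apply, LinearMap.comp_apply,
      TensorProduct.map_tmul, LinearMap.mulRight_apply, LinearMap.mulLeft_apply,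
      Finsupp.lsingle_apply]
    rw [sum_iterate_single, relBim]
    · rfl
    · rw [Function.iterate_succ_apply', σ_iterate_len, tgt_σ]; rfl
  | c x y _ _ _ _ =>
    rw [relation_sum_c]
    simp only [LinearMap.sum_apply, LinearMap.comp_apply,
      TensorProduct.map_tmul, LinearMap.mulRight_apply, LinearMap.mulLeft_apply,
      Finsupp.lsingle_apply]
    rw [relBim, map_add, act_single, act_single, Tip.target, Tip.source,
      sum_pair x y fun p z q => (Finsupp.single z ((a * (Γ.idem k (Γ.tgt x) * Γ.ev k p)) ⊗ₜ[k]
        (Γ.ev k q * Γ.idem k (Γ.src y) * b)) : Γ.Bim k)]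
    simp only [ev_nil, ev_cons, mul_one, one_mul, arrow_mul_idem_src, idem_tgt_mul_arrow]

theorem act_relBim (t : Γ.Tip V₁) :
    Γ.act k (Γ.idem k t.target) (Γ.idem k t.source) (Γ.relBim k t) = Γ.relBim k t := by
  cases t with
  | a h _ _ =>
    rw [Tip.target, Tip.source, relBim, map_sub]
    congr 1
    · have := Γ.act_nab k (Γ.σ h) (Γ.len (Γ.σ h))
      rw [σ_iterate_len, tgt_σ, src, len_σ] at this
      exact this
    · have := Γ.act_nab k (Γ.σ (Γ.ι h)) (Γ.len (Γ.σ (Γ.ι h)))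
      rw [σ_iterate_len, tgt_σ, src, len_σ, edge_ι] at this
      exact this
  | b h _ =>
    have := Γ.act_nab k h (Γ.len h + 1)
    rw [Function.iterate_succ_apply', σ_iterate_len, tgt_σ] at this
    exact this
  | c x y _ _ _ _ =>
    rw [Tip.target, Tip.source, relBim, map_add, act_single, act_single, idem_mul_self,
      idem_mul_self, idem_tgt_mul_arrow, arrow_mul_idem_src]

/-- The bimodule map `a ⊗ α_h ⊗ b ↦ a ψ(h) b`. -/
noncomputable def evalBim (ψ : H → Γ.Alg k) : Γ.Bim k →ₗ[k] Γ.Alg k :=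
  Finsupp.lsum k fun h => (LinearMap.mul' k (Γ.Alg k)).comp
    (TensorProduct.map (LinearMap.mulRight k (ψ h)) LinearMap.id)

theorem evalBim_single (ψ : H → Γ.Alg k) (h : H) (a b : Γ.Alg k) :
    Γ.evalBim k ψ (Finsupp.single h (a ⊗ₜ[k] b)) = a * ψ h * b := by
  rw [evalBim, Finsupp.lsum_single, LinearMap.comp_apply, TensorProduct.map_tmul,
    LinearMap.mul'_apply, LinearMap.mulRight_apply, LinearMap.id_apply]

theorem bimoduleMap_single (φ : Γ.Tip V₁ → Γ.Alg k) (t : Γ.Tip V₁) (a b : Γ.Alg k) :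
    Γ.bimoduleMap k V₁ φ (Finsupp.single t (a ⊗ₜ[k] b)) = a * φ t * b := by
  rw [bimoduleMap, Finsupp.lsum_single, LinearMap.comp_apply, TensorProduct.map_tmul,
    LinearMap.mul'_apply, LinearMap.mulRight_apply, LinearMap.id_apply]

theorem evalBim_act (ψ : H → Γ.Alg k) (a b : Γ.Alg k) (x : Γ.Bim k) :
    Γ.evalBim k ψ (Γ.act k a b x) = a * Γ.evalBim k ψ x * b := by
  suffices h : (Γ.evalBim k ψ).comp (Γ.act k a b) =
      (LinearMap.mulLeft k a).comp ((LinearMap.mulRight k b).comp (Γ.evalBim k ψ)) by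
    simpa [mul_assoc] using LinearMap.congr_fun h x
  refine bim_ext fun h x y => ?_
  simp [act_single, evalBim_single, mul_assoc]

theorem evalBim_nab (ψ : H → Γ.Alg k) (h : H) (n : ℕ) : Γ.evalBim k ψ (Γ.nab k h n) =
    ∑ j ∈ Finset.range n, Γ.P k h j * ψ (Γ.σ^[j] h) * Γ.P k (Γ.σ^[j + 1] h) (n - 1 - j) := by
  rw [nab, map_sum]
  simp only [evalBim_single]

variable {V₁} in
theorem idem_mul_of_mem_cochain1 {ψ : H → Γ.Alg k} (hψ : ψ ∈ Γ.cochain1 k V₁) (h : H) :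
    Γ.idem k (Γ.tgt h) * ψ h = ψ h := by
  rw [← hψ.1 h, ← mul_assoc, ← mul_assoc, idem_mul_self]

variable {V₁} in
theorem mul_idem_of_mem_cochain1 {ψ : H → Γ.Alg k} (hψ : ψ ∈ Γ.cochain1 k V₁) (h : H) :
    ψ h * Γ.idem k (Γ.src h) = ψ h := by
  rw [← hψ.1 h, mul_assoc, idem_mul_self]

variable {V₁} in
theorem sum_iterate_cochain {ψ : H → Γ.Alg k} (hψ : ψ ∈ Γ.cochain1 k V₁) (h : H) (n : ℕ) :
    ∑ i : Fin (List.iterate Γ.σ h n).length, Γ.ev k ((List.iterate Γ.σ h n).take i) *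
      ψ ((List.iterate Γ.σ h n).get i) * Γ.ev k ((List.iterate Γ.σ h n).drop (i + 1)) =
      Γ.evalBim k ψ (Γ.nab k h n) := by
  rw [sum_iterate Γ.σ h n fun p x q => Γ.ev k p * ψ x * Γ.ev k q, evalBim_nab]
  refine Finset.sum_congr rfl fun l hl => ?_
  have e1 : ∀ l, Γ.ev k (List.iterate Γ.σ h l) * ψ (Γ.σ^[l] h) = Γ.P k h l * ψ (Γ.σ^[l] h) := by
    intro l
    rw [← Γ.idem_mul_of_mem_cochain1 k hψ, ← mul_assoc, ev_mul_idem_tgt,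
      Γ.idem_mul_of_mem_cochain1 k hψ]
  have e2 : ∀ q l, ψ q * Γ.ev k (List.iterate Γ.σ (Γ.σ q) l) = ψ q * Γ.P k (Γ.σ q) l := by
    intro q l
    rw [P, tgt_σ, ← mul_assoc, Γ.mul_idem_of_mem_cochain1 k hψ]
  rw [e1, mul_assoc, Function.iterate_succ_apply', e2, mul_assoc]

variable {V₁} in
theorem d1_eq {ψ : H → Γ.Alg k} (hψ : ψ ∈ Γ.cochain1 k V₁) (t : Γ.Tip V₁) :
    Γ.d1 k V₁ ψ t = Γ.evalBim k ψ (Γ.relBim k t) := by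
  rw [d1]
  cases t with
  | a h _ _ =>
    rw [relation_sum_a, Γ.sum_iterate_cochain k hψ, Γ.sum_iterate_cochain k hψ, relBim, map_sub]
  | b h _ => rw [relation_sum_b, Γ.sum_iterate_cochain k hψ, relBim]
  | c x y _ _ _ _ =>
    rw [relation_sum_c, relBim, map_add, evalBim_single, evalBim_single,
      Γ.idem_mul_of_mem_cochain1 k hψ, mul_assoc _ (ψ y), Γ.mul_idem_of_mem_cochain1 k hψ,
      sum_pair x y fun p z q => Γ.ev k p * ψ z * Γ.ev k q]
    simp only [ev_nil, ev_cons, mul_one, one_mul]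

variable {V₁} in
theorem bimoduleMap_d1 {ψ : H → Γ.Alg k} (hψ : ψ ∈ Γ.cochain1 k V₁)
    (x : Γ.Tip V₁ →₀ Γ.Alg k ⊗[k] Γ.Alg k) :
    Γ.bimoduleMap k V₁ (Γ.d1 k V₁ ψ) x = Γ.evalBim k ψ (Γ.boundary2 k V₁ x) := by
  suffices h : Γ.bimoduleMap k V₁ (Γ.d1 k V₁ ψ) = (Γ.evalBim k ψ).comp (Γ.boundary2 k V₁) from
    LinearMap.congr_fun h x
  refine bim_ext fun t a b => ?_
  rw [bimoduleMap_single, LinearMap.comp_apply, boundary2_single, evalBim_act, Γ.d1_eq k hψ]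

/-- By `d1_eq`, the differential is linear on the 1-cochains, so its image is already a submodule
and taking the span adds nothing. -/
theorem mem_coboundary2 {φ : Γ.Tip V₁ → Γ.Alg k} :
    φ ∈ Γ.coboundary2 k V₁ ↔ ∃ ψ ∈ Γ.cochain1 k V₁, Γ.d1 k V₁ ψ = φ := by
  constructor
  · intro h
    rw [coboundary2] at h
    induction h using Submodule.span_induction with
    | mem φ hφ =>
      obtain ⟨ψ, hψ, rfl⟩ := hφ
      exact ⟨ψ, hψ, rfl⟩
    | zero =>
      refine ⟨0, Submodule.zero_mem _, funext fun t => ?_⟩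
      rw [Γ.d1_eq k (Submodule.zero_mem _)]
      suffices h : Γ.evalBim k (0 : H → Γ.Alg k) = 0 by rw [h]; rfl
      refine bim_ext fun h a b => ?_
      simp [evalBim_single]
    | add φ φ' _ _ h h' =>
      obtain ⟨ψ, hψ, rfl⟩ := h
      obtain ⟨ψ', hψ', rfl⟩ := h'
      refine ⟨ψ + ψ', Submodule.add_mem _ hψ hψ', funext fun t => ?_⟩
      rw [Γ.d1_eq k (Submodule.add_mem _ hψ hψ'), Pi.add_apply, Γ.d1_eq k hψ, Γ.d1_eq k hψ']
      suffices h : Γ.evalBim k (ψ + ψ') = Γ.evalBim k ψ + Γ.evalBim k ψ' by rw [h]; rfl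
      refine bim_ext fun h a b => ?_
      simp [evalBim_single, mul_add, add_mul]
    | smul r φ _ h =>
      obtain ⟨ψ, hψ, rfl⟩ := h
      refine ⟨r • ψ, Submodule.smul_mem _ _ hψ, funext fun t => ?_⟩
      rw [Γ.d1_eq k (Submodule.smul_mem _ _ hψ), Pi.smul_apply, Γ.d1_eq k hψ]
      suffices h : Γ.evalBim k (r • ψ) = r • Γ.evalBim k ψ by rw [h]; rfl
      refine bim_ext fun h a b => ?_
      simp [evalBim_single]
  · rintro ⟨ψ, hψ, rfl⟩
    exact Submodule.subset_span ⟨ψ, hψ, rfl⟩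

theorem evalBim_relBim_mem_cochain2 (ψ : H → Γ.Alg k) :
    (fun t : Γ.Tip V₁ => Γ.evalBim k ψ (Γ.relBim k t)) ∈ Γ.cochain2 k V₁ := fun t => by
  change Γ.idem k t.target * Γ.evalBim k ψ (Γ.relBim k t) * Γ.idem k t.source = _
  rw [← evalBim_act, act_relBim]

theorem coboundary2_le_cocycle2 : Γ.coboundary2 k V₁ ≤ Γ.cocycle2 k V₁ := by
  intro φ hφ
  obtain ⟨ψ, hψ, rfl⟩ := (Γ.mem_coboundary2 k V₁).1 hφ
  refine ⟨?_, fun x hx => by rw [Γ.bimoduleMap_d1 k hψ, hx, map_zero]⟩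
  rw [show Γ.d1 k V₁ ψ = _ from funext (Γ.d1_eq k hψ)]
  exact Γ.evalBim_relBim_mem_cochain2 k V₁ ψ

/-- The map `a ⊗ α_h ⊗ b ↦ a Λ_h b` to the operators on `B`. -/
noncomputable def opBim (Λ : H → Γ.Alg k →ₗ[k] Γ.Alg k) :
    Γ.Bim k →ₗ[k] Γ.Alg k →ₗ[k] Γ.Alg k :=
  Finsupp.lsum k fun h => TensorProduct.lift
    (LinearMap.mk₂ k (fun a b => (LinearMap.mulLeft k a).comp ((Λ h).comp (LinearMap.mulLeft k b)))
      (fun a a' b => by ext; simp [add_mul]) (fun r a b => by ext; simp)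
      (fun a b b' => by ext; simp [add_mul, mul_add]) (fun r a b => by ext; simp))

theorem opBim_single (Λ : H → Γ.Alg k →ₗ[k] Γ.Alg k) (h : H) (a b u : Γ.Alg k) :
    Γ.opBim k Λ (Finsupp.single h (a ⊗ₜ[k] b)) u = a * Λ h (b * u) := by
  rw [opBim, Finsupp.lsum_single, TensorProduct.lift.tmul, LinearMap.mk₂_apply]
  rfl

theorem opBim_nab (Λ : H → Γ.Alg k →ₗ[k] Γ.Alg k) (h : H) (n : ℕ) (u : Γ.Alg k) :
    Γ.opBim k Λ (Γ.nab k h n) u = ∑ j ∈ Finset.range n,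
      Γ.P k h j * Λ (Γ.σ^[j] h) (Γ.P k (Γ.σ^[j + 1] h) (n - 1 - j) * u) := by
  rw [nab, map_sum, LinearMap.sum_apply]
  simp only [opBim_single]

theorem opBim_act (Λ : H → Γ.Alg k →ₗ[k] Γ.Alg k) (a b u : Γ.Alg k) (x : Γ.Bim k) :
    Γ.opBim k Λ (Γ.act k a b x) u = a * Γ.opBim k Λ x (b * u) := by
  suffices h : ((LinearMap.applyₗ u).comp (Γ.opBim k Λ)).comp (Γ.act k a b) =
      (LinearMap.mulLeft k a).comp ((LinearMap.applyₗ (b * u)).comp (Γ.opBim k Λ)) from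
    LinearMap.congr_fun h x
  refine bim_ext fun h x y => ?_
  simp [act_single, opBim_single, mul_assoc]

/-- A criterion for cocycles: it suffices to deform left multiplications by arrows to first
order. -/
theorem mem_cocycle2_of_operators {φ : Γ.Tip V₁ → Γ.Alg k} (Λ : H → Γ.Alg k →ₗ[k] Γ.Alg k)
    (hφ : φ ∈ Γ.cochain2 k V₁) (h : ∀ t u, Γ.opBim k Λ (Γ.relBim k t) u = φ t * u) :
    φ ∈ Γ.cocycle2 k V₁ := by
  refine ⟨hφ, fun x hx => ?_⟩
  -- Evaluating the operators at 1 factors the bimodule map of φ through ∂₂, so it vanishes on the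
  -- kernel.
  have key : ((LinearMap.applyₗ (1 : Γ.Alg k)).comp (Γ.opBim k Λ)).comp (Γ.boundary2 k V₁) =
      Γ.bimoduleMap k V₁ φ := by
    refine bim_ext fun t a b => ?_
    rw [bimoduleMap_single, LinearMap.comp_apply, boundary2_single, LinearMap.comp_apply,
      LinearMap.applyₗ_apply_apply, opBim_act, h, mul_one, mul_assoc]
  rw [← key, LinearMap.comp_apply, hx, map_zero]

end Differential

end BrauerGraph

theorem hochschildD1_apply {k A : Type*} [Field k] [Ring A] [Algebra k A] (g : A →ₗ[k] A)
    (a b : A) : hochschildD1 k A g a b = a * g b - g (a * b) + g a * b := rfl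

namespace BrauerGraph

/-! ## Comparison with Hochschild cohomology -/

section Comparison

open scoped Classical

variable {V H : Type*} (Γ : BrauerGraph V H) (k : Type*) [Field k] [Finite H]

/-- The differential `B ⊗ kQ₁ ⊗ B → B ⊗ B`. -/
noncomputable def boundary1 : Γ.Bim k →ₗ[k] Γ.Alg k ⊗[k] Γ.Alg k :=
  Finsupp.lsum k fun h => TensorProduct.map (LinearMap.mulRight k (Γ.arrow k h)) LinearMap.id -
    TensorProduct.map LinearMap.id (LinearMap.mulLeft k (Γ.arrow k h))

theorem boundary1_single (h : H) (x y : Γ.Alg k) :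
    Γ.boundary1 k (Finsupp.single h (x ⊗ₜ[k] y)) =
      (x * Γ.arrow k h) ⊗ₜ[k] y - x ⊗ₜ[k] (Γ.arrow k h * y) := by
  rw [boundary1, Finsupp.lsum_single, LinearMap.sub_apply, TensorProduct.map_tmul,
    TensorProduct.map_tmul]
  rfl

/-- The sum telescopes: each arrow is moved from the right tensor factor to the left one. -/
theorem boundary1_nab (h : H) (n : ℕ) : Γ.boundary1 k (Γ.nab k h n) =
    Γ.P k h n ⊗ₜ[k] Γ.idem k (Γ.tgt (Γ.σ^[n] h)) - Γ.idem k (Γ.tgt h) ⊗ₜ[k] Γ.P k h n := by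
  have := Finset.sum_range_sub (fun j => Γ.P k h j ⊗ₜ[k] Γ.P k (Γ.σ^[j] h) (n - j)) n
  rw [Nat.sub_self, P_zero, P_zero, Nat.sub_zero] at this
  rw [nab, map_sum]
  refine Eq.trans (Finset.sum_congr rfl fun j hj => ?_) this
  have hj := Finset.mem_range.1 hj
  rw [boundary1_single, P_mul_arrow, Function.iterate_succ_apply', arrow_mul_P,
    show n - 1 - j + 1 = n - j by omega, show n - 1 - j = n - (j + 1) by omega]

variable (V₁ : Set V)

theorem boundary1_relBim (t : Γ.Tip V₁) : Γ.boundary1 k (Γ.relBim k t) = 0 := by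
  cases t with
  | a h _ _ =>
    have e1 := Γ.boundary1_nab k (Γ.σ h) (Γ.len (Γ.σ h))
    have e2 := Γ.boundary1_nab k (Γ.op (Γ.σ h)) (Γ.len (Γ.op (Γ.σ h)))
    rw [σ_iterate_len, P_len_op, tgt_op] at e2
    rw [σ_iterate_len] at e1
    rw [relBim, map_sub, ← Γ.len_σ h, ← Γ.len_σ (Γ.ι h), ← op_σ, e1, e2, sub_self]
  | b h _ => rw [relBim, boundary1_nab, P_len_succ, TensorProduct.zero_tmul,
      TensorProduct.tmul_zero, sub_self]
  | c x y _ _ _ hσ =>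
    rw [relBim, map_add, boundary1_single, boundary1_single, idem_tgt_mul_arrow,
      arrow_mul_idem_src, Γ.arrow_mul_arrow_of_ne k hσ]
    simp

/-- The map `a ⊗ α_h ⊗ b ↦ f(a, α_h) b` attached to a bilinear map `f`. -/
noncomputable def hochBim (f : Γ.Alg k →ₗ[k] Γ.Alg k →ₗ[k] Γ.Alg k) : Γ.Bim k →ₗ[k] Γ.Alg k :=
  Finsupp.lsum k fun h => (LinearMap.mul' k (Γ.Alg k)).comp
    (TensorProduct.map (f.flip (Γ.arrow k h)) LinearMap.id)

theorem hochBim_single (f : Γ.Alg k →ₗ[k] Γ.Alg k →ₗ[k] Γ.Alg k) (h : H) (a b : Γ.Alg k) :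
    Γ.hochBim k f (Finsupp.single h (a ⊗ₜ[k] b)) = f a (Γ.arrow k h) * b := by
  rw [hochBim, Finsupp.lsum_single, LinearMap.comp_apply, TensorProduct.map_tmul,
    LinearMap.mul'_apply, LinearMap.flip_apply, LinearMap.id_apply]

/-- This is the cocycle identity for `(a, x, α_h)`. The failure of left linearity factors through
∂₁, so `hochBim f` is left linear on the kernel of ∂₁, in particular on the image of ∂₂. -/
theorem mul_hochBim {f : Γ.Alg k →ₗ[k] Γ.Alg k →ₗ[k] Γ.Alg k}
    (hf : f ∈ hochschildZ2 k (Γ.Alg k)) (a : Γ.Alg k) (x : Γ.Bim k) :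
    a * Γ.hochBim k f x = Γ.hochBim k f (Γ.act k a 1 x) -
      LinearMap.mul' k (Γ.Alg k) (TensorProduct.map (f a) LinearMap.id (Γ.boundary1 k x)) := by
  suffices h : (LinearMap.mulLeft k a).comp (Γ.hochBim k f) =
      (Γ.hochBim k f).comp (Γ.act k a 1) - (LinearMap.mul' k (Γ.Alg k)).comp
        ((TensorProduct.map (f a) LinearMap.id).comp (Γ.boundary1 k)) from
    LinearMap.congr_fun h x
  refine bim_ext fun h x y => ?_
  simp only [LinearMap.comp_apply, LinearMap.sub_apply, hochBim_single, act_single,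
    boundary1_single, LinearMap.mulLeft_apply, map_sub, TensorProduct.map_tmul,
    LinearMap.mul'_apply, LinearMap.id_apply, mul_one]
  have := hf a x (Γ.arrow k h)
  rw [← mul_assoc, ← mul_assoc, ← sub_eq_zero, ← zero_mul y, ← this]
  simp only [sub_mul, add_mul]
  abel

theorem hochBim_act_one_left (f : Γ.Alg k →ₗ[k] Γ.Alg k →ₗ[k] Γ.Alg k) (b : Γ.Alg k)
    (x : Γ.Bim k) : Γ.hochBim k f (Γ.act k 1 b x) = Γ.hochBim k f x * b := by
  suffices h : (Γ.hochBim k f).comp (Γ.act k 1 b) =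
      (LinearMap.mulRight k b).comp (Γ.hochBim k f) from LinearMap.congr_fun h x
  refine bim_ext fun h x y => ?_
  simp [act_single, hochBim_single, mul_assoc]

theorem comparison_eq (f : Γ.Alg k →ₗ[k] Γ.Alg k →ₗ[k] Γ.Alg k) (t : Γ.Tip V₁) :
    Γ.comparison k V₁ f t = Γ.idem k t.target * Γ.hochBim k f (Γ.relBim k t) := by
  rw [← Γ.act_one_one k (Γ.relBim k t), ← boundary2_single, boundary2, Finsupp.lsum_single]
  refine Eq.trans ?_ (Finsupp.apply_linearCombination k
    ((LinearMap.mulLeft k (Γ.idem k t.target)).comp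
    ((Γ.hochBim k f).comp (LinearMap.applyₗ ((1 : Γ.Alg k) ⊗ₜ[k] (1 : Γ.Alg k))))) _
      (t.relation k)).symm
  rw [Finsupp.linearCombination_apply, comparison]
  refine Finsupp.sum_congr fun p _ => ?_
  congr 1
  simp only [Function.comp_apply, LinearMap.comp_apply, LinearMap.applyₗ_apply_apply,
    map_sum, TensorProduct.map_tmul, Finsupp.lsingle_apply, hochBim_single,
    LinearMap.mulRight_apply, LinearMap.mulLeft_apply, one_mul, mul_one, mul_assoc]

theorem bimoduleMap_comparison {f : Γ.Alg k →ₗ[k] Γ.Alg k →ₗ[k] Γ.Alg k}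
    (hf : f ∈ hochschildZ2 k (Γ.Alg k)) (x : Γ.Tip V₁ →₀ Γ.Alg k ⊗[k] Γ.Alg k) :
    Γ.bimoduleMap k V₁ (Γ.comparison k V₁ f) x = Γ.hochBim k f (Γ.boundary2 k V₁ x) := by
  suffices h : Γ.bimoduleMap k V₁ (Γ.comparison k V₁ f) =
      (Γ.hochBim k f).comp (Γ.boundary2 k V₁) from LinearMap.congr_fun h x
  refine bim_ext fun t a b => ?_
  rw [bimoduleMap_single, LinearMap.comp_apply, boundary2_single, comparison_eq, ← mul_assoc,
    Γ.mul_hochBim k hf, boundary1_relBim, map_zero, map_zero, sub_zero, ← hochBim_act_one_left,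
    act_act, one_mul, one_mul]
  conv_rhs => rw [← act_relBim, act_act]
  conv_lhs => rw [← act_relBim, act_act, mul_assoc, idem_mul_self]

theorem comparison_mem_cocycle2 {f : Γ.Alg k →ₗ[k] Γ.Alg k →ₗ[k] Γ.Alg k}
    (hf : f ∈ hochschildZ2 k (Γ.Alg k)) : Γ.comparison k V₁ f ∈ Γ.cocycle2 k V₁ := by
  refine ⟨fun t => ?_, fun x hx => by rw [Γ.bimoduleMap_comparison k V₁ hf, hx, map_zero]⟩
  rw [comparison_eq, ← mul_assoc, idem_mul_self, mul_assoc, ← hochBim_act_one_left]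
  conv_lhs => rw [← act_relBim, act_act, one_mul, idem_mul_self, act_relBim]

variable {V₁}

/-- The arrows of `Q'` generate a sub-bimodule that contains the relations. -/
theorem relBim_mem (S : Submodule k (Γ.Bim k)) (hbip : Γ.IsBipartition V₁)
    (hS : ∀ h x y, Γ.IsArrow' V₁ h → x * Γ.idem k (Γ.tgt h) = x → Γ.idem k (Γ.src h) * y = y →
      Finsupp.single h (x ⊗ₜ[k] y) ∈ S) (t : Γ.Tip V₁) : Γ.relBim k t ∈ S := by
  have hn : ∀ h n, Γ.IsArrow' V₁ h → Γ.nab k h n ∈ S := fun h n hh => by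
    refine Submodule.sum_mem _ fun j _ => hS _ _ _ ?_ ?_ ?_
    · rw [IsArrow', s_σ_iterate]
      exact hh
    · rw [P_mul_idem_tgt]
    · rw [Function.iterate_succ_apply', ← tgt_σ, idem_tgt_mul_P]
  have h2 : ∀ h, Γ.s h ∉ V₁ → Γ.IsArrow' V₁ h := fun h hh hh' => hh hh'.1
  cases t with
  | a h h₁ h₂ =>
    refine S.sub_mem (hn _ _ ?_) (hn _ _ (h2 _ ?_))
    · rw [IsArrow', s_σ]
      exact h₂
    · rw [s_σ]
      exact (hbip h).1 h₁
  | b h h₂ => exact hn _ _ (h2 _ h₂)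
  | c x y hx hy hxy hσ =>
    refine S.add_mem (hS _ _ _ hx (idem_mul_self _ _ _) ?_) (hS _ _ _ hy ?_ (idem_mul_self _ _ _))
    · rw [hxy, idem_tgt_mul_arrow]
    · rw [← hxy, arrow_mul_idem_src]

/-- The required 1-cochain is `g` on the arrows of Q', cut down by the idempotents. On the bimodule
generated by these arrows the two evaluations differ by a term factoring through ∂₁, and ∂₁ kills
the relations. -/
theorem comparison_hochschildD1 (hbip : Γ.IsBipartition V₁) (g : Γ.Alg k →ₗ[k] Γ.Alg k) :
    Γ.comparison k V₁ (hochschildD1 k (Γ.Alg k) g) ∈ Γ.coboundary2 k V₁ := by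
  rw [mem_coboundary2]
  set ψ : H → Γ.Alg k := fun h => if Γ.IsArrow' V₁ h then
    Γ.idem k (Γ.tgt h) * g (Γ.arrow k h) * Γ.idem k (Γ.src h) else 0 with hψd
  have hψ : ψ ∈ Γ.cochain1 k V₁ := by
    refine ⟨fun h => ?_, fun h hh => if_neg hh⟩
    by_cases hh : Γ.IsArrow' V₁ h
    · simp only [hψd, if_pos hh]
      rw [← mul_assoc, ← mul_assoc, idem_mul_self, mul_assoc, idem_mul_self]
    · simp only [hψd, if_neg hh, mul_zero, zero_mul]
  refine ⟨ψ, hψ, funext fun t => ?_⟩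
  have key : Γ.evalBim k ψ (Γ.relBim k t) = Γ.hochBim k (hochschildD1 k (Γ.Alg k) g)
      (Γ.relBim k t) + LinearMap.mul' k (Γ.Alg k)
        (TensorProduct.map g LinearMap.id (Γ.boundary1 k (Γ.relBim k t))) := by
    refine Γ.relBim_mem k (LinearMap.eqLocus (Γ.evalBim k ψ)
      (Γ.hochBim k (hochschildD1 k (Γ.Alg k) g) + (LinearMap.mul' k (Γ.Alg k)).comp
        ((TensorProduct.map g LinearMap.id).comp (Γ.boundary1 k)))) hbip
      (fun h x y hh hx hy => ?_) t
    rw [LinearMap.mem_eqLocus, evalBim_single, LinearMap.add_apply, LinearMap.comp_apply,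
      LinearMap.comp_apply, boundary1_single, map_sub, map_sub, TensorProduct.map_tmul,
      TensorProduct.map_tmul, LinearMap.mul'_apply, LinearMap.mul'_apply, hochBim_single,
      hochschildD1_apply]
    simp only [hψd, if_pos hh, LinearMap.id_apply]
    rw [← mul_assoc, ← mul_assoc, hx, mul_assoc _ _ y, hy]
    simp only [sub_mul, add_mul, mul_assoc]
    abel
  rw [boundary1_relBim, map_zero, map_zero, add_zero] at key
  rw [Γ.d1_eq k hψ, comparison_eq, ← key]
  have := Γ.evalBim_relBim_mem_cochain2 k V₁ ψ t
  simp only at this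
  rw [← this, ← mul_assoc, ← mul_assoc, idem_mul_self]

theorem s_op_mem_iff (hbip : Γ.IsBipartition V₁) (h : H) : Γ.s (Γ.op h) ∈ V₁ ↔ Γ.s h ∉ V₁ := by
  rw [op, s_σ, ← Γ.s_ρ h, hbip (Γ.ρ h), not_not]

/-- These are the irreducible paths for R_Γ. A full cycle around a vertex of V₁, including the loop
at a truncated one, is replaced by the full cycle around the other end. -/
theorem mem_of_idem_of_P' (hbip : Γ.IsBipartition V₁) (S : Submodule k (Γ.Alg k))
    (he : ∀ i, Γ.idem k i ∈ S)
    (hP : ∀ h n, n + 1 ≤ Γ.len h → (Γ.s h ∈ V₁ → n + 1 < Γ.len h) → Γ.P k h (n + 1) ∈ S)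
    (b : Γ.Alg k) : b ∈ S := by
  refine Γ.mem_of_idem_of_P k S he (fun h n hn => ?_) b
  by_cases hh : Γ.s h ∈ V₁ → n + 1 < Γ.len h
  · exact hP h n hn hh
  · push Not at hh
    rw [le_antisymm hn hh.2, ← P_len_op]
    obtain ⟨l, hl⟩ := Nat.exists_eq_succ_of_ne_zero (Γ.len_pos (Γ.op h)).ne'
    rw [hl]
    exact hP _ _ hl.ge fun h' => absurd hh.1 ((Γ.s_op_mem_iff hbip h).1 h')

variable (V₁) in
/-- The universal derivative of the words. -/
noncomputable def wordDeriv : Γ.Word → Γ.Bim k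
  | .e _ => 0
  | .p h n => Γ.nab k h (n + 1)
  | .z i => if hx : ∃ h, Γ.tgt h = i ∧ Γ.s h ∉ V₁ then Γ.nab k hx.choose (Γ.len hx.choose) else 0

variable (V₁) in
/-- A linear lift of the universal derivation `B → coker ∂₂`. -/
noncomputable def deriv : Γ.Alg k →ₗ[k] Γ.Bim k :=
  (Finsupp.linearCombination k (Γ.wordDeriv k V₁)).comp (Γ.nf k)

theorem deriv_idem (i : Γ.Edge) : Γ.deriv k V₁ (Γ.idem k i) = 0 := by
  rw [deriv, LinearMap.comp_apply, nf_idem, Finsupp.linearCombination_single, wordDeriv, smul_zero]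

theorem deriv_one : Γ.deriv k V₁ 1 = 0 := by
  have := Fintype.ofFinite Γ.Edge
  rw [← sum_idem, map_sum]
  exact Finset.sum_eq_zero fun i _ => Γ.deriv_idem k i

theorem deriv_P (hbip : Γ.IsBipartition V₁) {h : H} {n : ℕ} (hn : 0 < n) (hn' : n ≤ Γ.len h)
    (hh : Γ.s h ∈ V₁ → n < Γ.len h) : Γ.deriv k V₁ (Γ.P k h n) = Γ.nab k h n := by
  obtain ⟨n, rfl⟩ := Nat.exists_eq_succ_of_ne_zero hn.ne'
  rw [deriv, LinearMap.comp_apply, nf_P]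
  rcases hn'.lt_or_eq with hl | hl
  · rw [Γ.pathVec_of_lt k hl, Finsupp.linearCombination_single, one_smul, wordDeriv]
  · have hV : Γ.s h ∉ V₁ := fun h' => (hh h').ne hl
    rw [Γ.pathVec_last k hl, Finsupp.linearCombination_single, one_smul, wordDeriv]
    have hx : ∃ h', Γ.tgt h' = Γ.tgt h ∧ Γ.s h' ∉ V₁ := ⟨h, rfl, hV⟩
    rw [dif_pos hx]
    have e : hx.choose = h := by
      rcases Γ.tgt_eq_iff.1 hx.choose_spec.1 with e | e
      · exact e.symm
      · exfalso
        rw [e] at hV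
        exact hV ((Γ.s_op_mem_iff hbip _).2 hx.choose_spec.2)
    rw [e, hl]

theorem isArrow'_of_not_mem {h : H} (hh : Γ.s h ∉ V₁) : Γ.IsArrow' V₁ h := fun h' => hh h'.1

theorem isArrow'_iff_of_mem {h : H} (hh : Γ.s h ∈ V₁) : Γ.IsArrow' V₁ h ↔ 1 < Γ.len h := by
  have h1 := Γ.val_pos h
  have h2 := Γ.m_pos (Γ.s h)
  constructor
  · intro h'
    by_contra hl
    have hl : Γ.m (Γ.s h) * Γ.val (Γ.s h) ≤ 1 := not_lt.1 hl
    refine h' ⟨hh, ?_, ?_⟩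
    · exact le_antisymm ((Nat.le_mul_of_pos_right _ h1).trans hl) h2
    · exact le_antisymm ((Nat.le_mul_of_pos_left _ h2).trans hl) h1
  · rintro hl ⟨_, h3, h4⟩
    rw [len, h3, h4] at hl
    omega

theorem isArrow'_of_lt {h : H} (hl : 1 < Γ.len h) : Γ.IsArrow' V₁ h := by
  by_cases hh : Γ.s h ∈ V₁
  · exact (Γ.isArrow'_iff_of_mem hh).2 hl
  · exact Γ.isArrow'_of_not_mem hh

theorem deriv_arrow (hbip : Γ.IsBipartition V₁) {h : H} (hh : Γ.IsArrow' V₁ h) :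
    Γ.deriv k V₁ (Γ.arrow k h) =
      Finsupp.single h (Γ.idem k (Γ.tgt h) ⊗ₜ[k] Γ.idem k (Γ.src h)) := by
  rw [← P_one, Γ.deriv_P k hbip one_pos (Γ.len_pos h) fun h' => (Γ.isArrow'_iff_of_mem h').1 hh,
    nab_one]

variable (V₁) in
/-- The failure of `deriv` to be a derivation. -/
noncomputable def derivDefect : Γ.Alg k →ₗ[k] Γ.Alg k →ₗ[k] Γ.Bim k :=
  LinearMap.mk₂ k (fun a b => Γ.act k a 1 (Γ.deriv k V₁ b) + Γ.act k 1 b (Γ.deriv k V₁ a) -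
    Γ.deriv k V₁ (a * b))
    (fun a a' b => by rw [act_add_left, add_mul, map_add, map_add, map_add]; abel)
    (fun r a b => by
      rw [act_smul_left, smul_mul_assoc, map_smul, map_smul, map_smul, smul_sub, smul_add])
    (fun a b b' => by rw [act_add_right, mul_add, map_add, map_add, map_add]; abel)
    (fun r a b => by
      rw [act_smul_right, mul_smul_comm, map_smul, map_smul, map_smul, smul_sub, smul_add])

theorem derivDefect_apply (a b : Γ.Alg k) : Γ.derivDefect k V₁ a b =
    Γ.act k a 1 (Γ.deriv k V₁ b) + Γ.act k 1 b (Γ.deriv k V₁ a) - Γ.deriv k V₁ (a * b) := rfl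

theorem act_mem_range (a b : Γ.Alg k) {x : Γ.Bim k}
    (hx : x ∈ LinearMap.range (Γ.boundary2 k V₁)) :
    Γ.act k a b x ∈ LinearMap.range (Γ.boundary2 k V₁) := by
  obtain ⟨w, rfl⟩ := hx
  induction w using Finsupp.induction_linear with
  | zero => rw [map_zero, map_zero]; exact Submodule.zero_mem _
  | add w w' h h' => rw [map_add, map_add]; exact Submodule.add_mem _ h h'
  | single t y =>
    induction y using TensorProduct.induction_on with
    | zero => rw [Finsupp.single_zero, map_zero, map_zero]; exact Submodule.zero_mem _
    | add w w' h h' =>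
      rw [Finsupp.single_add, map_add, map_add]
      exact Submodule.add_mem _ h h'
    | tmul x y =>
      rw [boundary2_single, act_act, ← boundary2_single]
      exact ⟨_, rfl⟩

theorem relBim_mem_range (t : Γ.Tip V₁) :
    Γ.relBim k t ∈ LinearMap.range (Γ.boundary2 k V₁) := by
  refine ⟨Finsupp.single t (1 ⊗ₜ[k] 1), ?_⟩
  rw [boundary2_single, act_one_one]

theorem act_mul_left (a a' : Γ.Alg k) (x : Γ.Bim k) :
    Γ.act k (a * a') 1 x = Γ.act k a 1 (Γ.act k a' 1 x) := by
  rw [act_act, mul_one]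

theorem act_idem_nab (i : Γ.Edge) (h : H) (n : ℕ) :
    Γ.act k (Γ.idem k i) 1 (Γ.nab k h n) = if i = Γ.tgt h then Γ.nab k h n else 0 := by
  split_ifs with e
  · rw [e]
    conv_lhs => rw [← act_nab, act_act, idem_mul_self, mul_one, act_nab]
  · conv_lhs => rw [← act_nab, act_act, Γ.idem_mul_of_ne k e, act_zero_left]

/-- The relation at a composable pair of arrows around different vertices. -/
theorem act_relBim_c {x y : H} (hx : Γ.IsArrow' V₁ x) (hy : Γ.IsArrow' V₁ y)
    (hxy : Γ.src x = Γ.tgt y) (hσ : y ≠ Γ.σ x) (n : ℕ) :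
    Γ.act k (Γ.arrow k x) 1 (Γ.nab k y (n + 1)) +
      Finsupp.single x (Γ.idem k (Γ.tgt x) ⊗ₜ[k] Γ.P k y (n + 1)) =
    Γ.act k 1 (Γ.P k (Γ.σ y) n) (Γ.relBim k (.c x y hx hy hxy hσ)) := by
  rw [nab_succ, map_add, act_single, act_act, Γ.arrow_mul_arrow_of_ne k hσ, act_zero_left,
    relBim, map_add, act_single, act_single, ← hxy, arrow_mul_idem_src, arrow_mul_P, ← tgt_σ,
    idem_tgt_mul_P, one_mul, one_mul, mul_one, add_zero, add_comm]

/-- An arrow times an irreducible path is irreducible, or zero because the two are not composable,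
or reducible by a single tip at its left end. In the last case the defect is the image of that tip
under ∂₂: type (a) if a full cycle around V₁ is completed, type (b) if the path was already a full
cycle around V₂, and type (c), up to a right factor, if the arrows are not consecutive. -/
theorem derivDefect_arrow_mem (hbip : Γ.IsBipartition V₁) {x : H} (hx : Γ.IsArrow' V₁ x)
    (b : Γ.Alg k) : Γ.derivDefect k V₁ (Γ.arrow k x) b ∈ LinearMap.range (Γ.boundary2 k V₁) := by
  refine Γ.mem_of_idem_of_P' k hbip ((LinearMap.range (Γ.boundary2 k V₁)).comap
    (Γ.derivDefect k V₁ (Γ.arrow k x))) (fun i => ?_) (fun h n hn hn' => ?_) b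
  · rw [Submodule.mem_comap, derivDefect_apply, deriv_idem, map_zero, zero_add,
      Γ.deriv_arrow k hbip hx, act_single, arrow_mul_idem, idem_mul_idem, one_mul]
    split_ifs
    · rw [Γ.deriv_arrow k hbip hx, sub_self]
      exact Submodule.zero_mem _
    · rw [map_zero, TensorProduct.tmul_zero, Finsupp.single_zero, sub_zero]
      exact Submodule.zero_mem _
  · rw [Submodule.mem_comap, derivDefect_apply, Γ.deriv_P k hbip n.succ_pos hn hn',
      Γ.deriv_arrow k hbip hx, act_single, one_mul]
    by_cases e : Γ.src x = Γ.tgt h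
    · rw [e, idem_tgt_mul_P]
      by_cases e' : h = Γ.σ x
      · subst e'
        rw [arrow_mul_P, add_comm (Γ.act k _ _ _), ← nab_succ]
        rw [len_σ, s_σ] at hn'
        rw [len_σ] at hn
        rcases hn.lt_or_eq with hl | hl
        · by_cases hh : Γ.s x ∈ V₁ → n + 1 + 1 < Γ.len x
          · rw [Γ.deriv_P k hbip (Nat.succ_pos _) hl hh, sub_self]
            exact Submodule.zero_mem _
          · push Not at hh
            obtain ⟨hh, hl'⟩ := hh
            have hl := le_antisymm hl hl'
            have hV : Γ.s (Γ.op x) ∉ V₁ := by rw [s_op_mem_iff _ hbip, not_not]; exact hh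
            rw [hl, ← Γ.P_len_op k x, Γ.deriv_P k hbip (Γ.len_pos _) le_rfl fun h' => absurd h' hV]
            have := Γ.relBim_mem_range k (.a (Γ.ρ x) (V₁ := V₁) (by rw [s_ρ]; exact hh)
              (by rw [IsArrow', s_ρ]; exact hx))
            rw [relBim, σ_ρ, ← Γ.len_σ (Γ.ρ x), ← Γ.len_σ (Γ.ι _), σ_ρ] at this
            exact this
        · have hV : Γ.s x ∉ V₁ := fun h' => (hn' h').ne hl
          rw [hl, P_len_succ, map_zero, sub_zero]
          exact Γ.relBim_mem_range k (.b x hV)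
      · rw [Γ.arrow_mul_P_of_ne k (Ne.symm e'), map_zero, sub_zero, Γ.act_relBim_c k hx _ e e']
        · exact Γ.act_mem_range k _ _ (Γ.relBim_mem_range k _)
        · by_cases hh : Γ.s h ∈ V₁
          · have := hn' hh
            exact Γ.isArrow'_of_lt (by omega)
          · exact Γ.isArrow'_of_not_mem hh
    · rw [idem_mul_P, if_neg e, TensorProduct.tmul_zero, Finsupp.single_zero, add_zero,
        ← arrow_mul_idem_src, act_mul_left, act_idem_nab, if_neg e, map_zero, mul_assoc,
        idem_mul_P, if_neg e, mul_zero, map_zero, sub_zero]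
      exact Submodule.zero_mem _

/-- The defect satisfies the Hochschild 2-cocycle identity and the image of ∂₂ is a sub-bimodule, so
the admissible left factors are closed under products. Generators suffice; a loop at a truncated
vertex of V₁ is not an arrow of Q', but it equals a full cycle around V₂ and hence a product of
arrows of Q'. -/
theorem derivDefect_mem (hbip : Γ.IsBipartition V₁) (a b : Γ.Alg k) :
    Γ.derivDefect k V₁ a b ∈ LinearMap.range (Γ.boundary2 k V₁) := by
  have hmul : ∀ a a', (∀ b, Γ.derivDefect k V₁ a b ∈ LinearMap.range (Γ.boundary2 k V₁)) →
      (∀ b, Γ.derivDefect k V₁ a' b ∈ LinearMap.range (Γ.boundary2 k V₁)) →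
      ∀ b, Γ.derivDefect k V₁ (a * a') b ∈ LinearMap.range (Γ.boundary2 k V₁) := by
    intro a a' ha ha' b
    have : Γ.derivDefect k V₁ (a * a') b = Γ.act k a 1 (Γ.derivDefect k V₁ a' b) +
        Γ.derivDefect k V₁ a (a' * b) - Γ.act k 1 b (Γ.derivDefect k V₁ a a') := by
      simp only [derivDefect_apply, map_add, map_sub, act_act, mul_one, one_mul, mul_assoc]
      abel
    rw [this]
    exact Submodule.sub_mem _ (Submodule.add_mem _ (Γ.act_mem_range k _ _ (ha' _)) (ha _))
      (Γ.act_mem_range k _ _ (ha _))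
  have hidem : ∀ i b, Γ.derivDefect k V₁ (Γ.idem k i) b ∈
      LinearMap.range (Γ.boundary2 k V₁) := by
    intro i b
    refine Γ.mem_of_idem_of_P' k hbip ((LinearMap.range (Γ.boundary2 k V₁)).comap
      (Γ.derivDefect k V₁ (Γ.idem k i))) (fun j => ?_) (fun h n hn hn' => ?_) b
    · rw [Submodule.mem_comap, derivDefect_apply, deriv_idem, deriv_idem, idem_mul_idem]
      split_ifs <;> simp [deriv_idem]
    · rw [Submodule.mem_comap, derivDefect_apply, deriv_idem, Γ.deriv_P k hbip n.succ_pos hn hn',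
        act_idem_nab, idem_mul_P]
      split_ifs <;> simp [Γ.deriv_P k hbip n.succ_pos hn hn']
  have hP : ∀ n h, Γ.s h ∉ V₁ → ∀ b, Γ.derivDefect k V₁ (Γ.P k h n) b ∈
      LinearMap.range (Γ.boundary2 k V₁) := by
    intro n
    induction n with
    | zero =>
      intro h _ b
      rw [P_zero]
      exact hidem _ b
    | succ n ih =>
      intro h hh b
      rw [← arrow_mul_P]
      exact hmul _ _ (Γ.derivDefect_arrow_mem k hbip (Γ.isArrow'_of_not_mem hh))
        (ih _ (by rw [s_σ]; exact hh)) b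
  induction a using alg_induction generalizing b with
  | algebraMap r =>
    rw [derivDefect_apply, ← Algebra.smul_def, Algebra.algebraMap_eq_smul_one, map_smul, deriv_one,
      smul_zero, map_zero, add_zero, act_smul_left, act_one_one, map_smul, sub_self]
    exact Submodule.zero_mem _
  | idem i => exact hidem i b
  | arrow h =>
    by_cases hh : Γ.IsArrow' V₁ h
    · exact Γ.derivDefect_arrow_mem k hbip hh b
    · rw [IsArrow', not_not] at hh
      have : Γ.len h = 1 := by rw [len, hh.2.1, hh.2.2]
      rw [← P_one, ← this, ← P_len_op]
      refine hP _ _ ?_ b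
      rw [s_op_mem_iff _ hbip, not_not]
      exact hh.1
  | mul a a' ha ha' => exact hmul _ _ ha ha' b
  | add a a' ha ha' =>
    rw [map_add]
    exact Submodule.add_mem _ (ha b) (ha' b)

end Comparison

/-! ### Bijectivity of the comparison map in degree two -/

section Isomorphism

open scoped Classical

variable {V H : Type*} (Γ : BrauerGraph V H) (k : Type*) [Field k] [Finite H] {V₁ : Set V}

/-- Over kQ₀ the right-hand side would be `a ⊗ 1 - 1 ⊗ a`; the sums over idempotents express this
with tensor products over `k`. -/
theorem boundary1_deriv (hbip : Γ.IsBipartition V₁) [Fintype Γ.Edge] (a : Γ.Alg k) :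
    Γ.boundary1 k (Γ.deriv k V₁ a) = ∑ i, (a * Γ.idem k i) ⊗ₜ[k] Γ.idem k i -
      ∑ i, Γ.idem k i ⊗ₜ[k] (Γ.idem k i * a) := by
  suffices h : ∀ a, a ∈ LinearMap.eqLocus ((Γ.boundary1 k).comp (Γ.deriv k V₁))
      (∑ i, ((TensorProduct.mk k _ _).flip (Γ.idem k i)).comp (LinearMap.mulRight k (Γ.idem k i)) -
      ∑ i, (TensorProduct.mk k _ _ (Γ.idem k i)).comp (LinearMap.mulLeft k (Γ.idem k i))) by
    simpa [LinearMap.mem_eqLocus, LinearMap.sum_apply] using h a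
  refine Γ.mem_of_idem_of_P' k hbip _ (fun j => ?_) fun h n hn hn' => ?_
  · simp only [LinearMap.mem_eqLocus, LinearMap.comp_apply, LinearMap.sub_apply,
      LinearMap.sum_apply, deriv_idem, map_zero, LinearMap.mulRight_apply, LinearMap.mulLeft_apply,
      LinearMap.flip_apply, TensorProduct.mk_apply, idem_mul_idem, TensorProduct.ite_tmul,
      TensorProduct.tmul_ite, Finset.sum_ite_eq, Finset.sum_ite_eq', Finset.mem_univ, if_true,
      sub_self]
  · simp only [LinearMap.mem_eqLocus, LinearMap.comp_apply, LinearMap.sub_apply,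
      LinearMap.sum_apply, Γ.deriv_P k hbip n.succ_pos hn hn', LinearMap.mulRight_apply,
      LinearMap.mulLeft_apply, boundary1_nab, LinearMap.flip_apply, TensorProduct.mk_apply,
      idem_mul_P, P_mul_idem, TensorProduct.ite_tmul,
      TensorProduct.tmul_ite, Finset.sum_ite_eq, Finset.sum_ite_eq', Finset.mem_univ, if_true]

/-- The cocycle condition makes φ a well-defined bimodule map on the image of ∂₂. Its linear
extension `G` to the whole of `Bim` is not a bimodule map, but the Leibniz defect takes values in
that image, so `G` composed with the defect is a Hochschild cocycle. -/
theorem exists_hochschild_comparison_eq (hbip : Γ.IsBipartition V₁) {φ : Γ.Tip V₁ → Γ.Alg k}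
    (hφ : φ ∈ Γ.cocycle2 k V₁) :
    ∃ f ∈ hochschildZ2 k (Γ.Alg k), Γ.comparison k V₁ f = φ := by
  obtain ⟨G, hG⟩ : ∃ G : Γ.Bim k →ₗ[k] Γ.Alg k,
      ∀ w, G (Γ.boundary2 k V₁ w) = Γ.bimoduleMap k V₁ φ w := by
    obtain ⟨s, hs⟩ := (Γ.boundary2 k V₁).rangeRestrict.exists_rightInverse_of_surjective
      (LinearMap.range_rangeRestrict _)
    obtain ⟨G, hG⟩ := LinearMap.exists_extend ((Γ.bimoduleMap k V₁ φ).comp s)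
    refine ⟨G, fun w => ?_⟩
    have e1 : G (Γ.boundary2 k V₁ w) =
        Γ.bimoduleMap k V₁ φ (s ((Γ.boundary2 k V₁).rangeRestrict w)) :=
      LinearMap.congr_fun hG ((Γ.boundary2 k V₁).rangeRestrict w)
    have e2 : Γ.boundary2 k V₁ (s ((Γ.boundary2 k V₁).rangeRestrict w)) = Γ.boundary2 k V₁ w :=
      congrArg Subtype.val (LinearMap.congr_fun hs ((Γ.boundary2 k V₁).rangeRestrict w))
    rw [e1, ← sub_eq_zero, ← map_sub]
    exact hφ.2 _ (by rw [map_sub, e2, sub_self])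
  have hact : ∀ a b, ∀ x ∈ LinearMap.range (Γ.boundary2 k V₁),
      G (Γ.act k a b x) = a * G x * b := by
    rintro a b _ ⟨w, rfl⟩
    induction w using Finsupp.induction_linear with
    | zero => simp
    | add w w' h h' => simp only [map_add, mul_add, add_mul, h, h']
    | single t y =>
      induction y using TensorProduct.induction_on with
      | zero => simp
      | add w w' h h' => simp only [Finsupp.single_add, map_add, mul_add, add_mul, h, h']
      | tmul x y =>
        rw [hG, boundary2_single, act_act, ← boundary2_single, hG, bimoduleMap_single,
          bimoduleMap_single]
        simp only [mul_assoc]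
  have hD := Γ.derivDefect_mem k hbip
  set f := (Γ.derivDefect k V₁).compr₂ G with hf
  have hfa : ∀ a b, f a b = G (Γ.derivDefect k V₁ a b) := fun a b => rfl
  refine ⟨f, fun a b c => ?_, funext fun t => ?_⟩
  · have e1 : a * f b c = G (Γ.act k a 1 (Γ.derivDefect k V₁ b c)) := by
      rw [hact _ _ _ (hD _ _), mul_one, hfa]
    have e2 : f a b * c = G (Γ.act k 1 c (Γ.derivDefect k V₁ a b)) := by
      rw [hact _ _ _ (hD _ _), one_mul, hfa]
    rw [e1, e2, hfa, hfa, ← map_sub, ← map_add, ← map_sub]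
    have : Γ.act k a 1 (Γ.derivDefect k V₁ b c) - Γ.derivDefect k V₁ (a * b) c +
        Γ.derivDefect k V₁ a (b * c) - Γ.act k 1 c (Γ.derivDefect k V₁ a b) = 0 := by
      simp only [derivDefect_apply, map_add, map_sub, act_act, mul_one, one_mul, mul_assoc]
      abel
    rw [this, map_zero]
  -- The right linear extension of `deriv`. On the arrows of Q', `hochBim f` is `G` of the identity
  -- minus `R ∂₁`, and the correction disappears on relations because ∂₁ kills them.
  · set R : Γ.Alg k ⊗[k] Γ.Alg k →ₗ[k] Γ.Bim k := TensorProduct.lift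
      (LinearMap.mk₂ k (fun x y => Γ.act k 1 y (Γ.deriv k V₁ x))
        (fun a a' b => by rw [map_add, map_add]) (fun r a b => by rw [map_smul, map_smul])
        (fun a b b' => by rw [act_add_right]) (fun r a b => by rw [act_smul_right])) with hR
    have hRa : ∀ x y, R (x ⊗ₜ[k] y) = Γ.act k 1 y (Γ.deriv k V₁ x) := fun x y => by
      rw [hR, TensorProduct.lift.tmul, LinearMap.mk₂_apply]
    have key : Γ.hochBim k f (Γ.relBim k t) =
        G (Γ.relBim k t - R (Γ.boundary1 k (Γ.relBim k t))) := by
      refine Γ.relBim_mem k (LinearMap.eqLocus (Γ.hochBim k f)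
        (G.comp (LinearMap.id - R.comp (Γ.boundary1 k)))) hbip (fun h x y hh hx hy => ?_) t
      rw [LinearMap.mem_eqLocus, hochBim_single, LinearMap.comp_apply, LinearMap.sub_apply,
        LinearMap.comp_apply, LinearMap.id_apply, boundary1_single, map_sub R, hRa, hRa, hfa,
        ← one_mul (G _), ← hact _ _ _ (hD _ _), derivDefect_apply, Γ.deriv_arrow k hbip hh,
        map_sub, map_add, act_act, act_act, act_single, one_mul, one_mul, one_mul, hx, hy]
      congr 1
      abel
    rw [boundary1_relBim, map_zero, sub_zero] at key
    have e : G (Γ.relBim k t) = φ t := by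
      have := hG (Finsupp.single t (1 ⊗ₜ[k] 1))
      rwa [boundary2_single, act_one_one, bimoduleMap_single, one_mul, mul_one] at this
    rw [comparison_eq, key, e, ← hφ.1 t, ← mul_assoc, ← mul_assoc, idem_mul_self]

/-- Both `hochBim f` and `evalBim ψ` are defined on `Bim` and agree on the image of ∂₂, in
particular on the Leibniz defects. Expanding this equality expresses `f` as the coboundary of their
difference along `deriv`. -/
theorem exists_hochschildD1_eq (hbip : Γ.IsBipartition V₁)
    {f : Γ.Alg k →ₗ[k] Γ.Alg k →ₗ[k] Γ.Alg k} (hf : f ∈ hochschildZ2 k (Γ.Alg k))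
    (hc : Γ.comparison k V₁ f ∈ Γ.coboundary2 k V₁) :
    ∃ g, hochschildD1 k (Γ.Alg k) g = f := by
  have := Fintype.ofFinite Γ.Edge
  obtain ⟨ψ, hψ, hc⟩ := (Γ.mem_coboundary2 k V₁).1 hc
  have key : ∀ a b, Γ.hochBim k f (Γ.derivDefect k V₁ a b) =
      Γ.evalBim k ψ (Γ.derivDefect k V₁ a b) := by
    intro a b
    obtain ⟨w, hw⟩ := Γ.derivDefect_mem k hbip a b
    rw [← hw, ← Γ.bimoduleMap_comparison k V₁ hf, ← hc, Γ.bimoduleMap_d1 k hψ]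
  -- A correction term: `f` is not assumed to be normalized with respect to the trivial paths.
  set s : Γ.Alg k →ₗ[k] Γ.Alg k :=
    ∑ i, (LinearMap.mulRight k (Γ.idem k i)).comp (f.flip (Γ.idem k i)) with hs
  have hsa : ∀ a, s a = ∑ i, f a (Γ.idem k i) * Γ.idem k i := fun a => by
    rw [hs, LinearMap.sum_apply]
    rfl
  refine ⟨(Γ.evalBim k ψ).comp (Γ.deriv k V₁) - (Γ.hochBim k f).comp (Γ.deriv k V₁) + s, ?_⟩
  ext a b
  have e1 : ∀ a b, Γ.hochBim k f (Γ.derivDefect k V₁ a b) =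
      a * Γ.hochBim k f (Γ.deriv k V₁ b) + Γ.hochBim k f (Γ.deriv k V₁ a) * b -
        Γ.hochBim k f (Γ.deriv k V₁ (a * b)) + f a b - a * s b + s (a * b) - s a * b := by
    intro a b
    have h1 := Γ.mul_hochBim k hf a (Γ.deriv k V₁ b)
    rw [Γ.boundary1_deriv k hbip, map_sub, map_sub, map_sum, map_sum, map_sum, map_sum] at h1
    simp only [TensorProduct.map_tmul, LinearMap.mul'_apply, LinearMap.id_apply] at h1
    have h2 : ∑ i, f a (b * Γ.idem k i) * Γ.idem k i = f a b - a * s b + s (a * b) := by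
      have : ∀ i, f a (b * Γ.idem k i) * Γ.idem k i = f a b * Γ.idem k i -
          a * (f b (Γ.idem k i) * Γ.idem k i) + f (a * b) (Γ.idem k i) * Γ.idem k i := by
        intro i
        have h := congrArg (· * Γ.idem k i) (hf a b (Γ.idem k i))
        simp only [sub_mul, add_mul, zero_mul, mul_assoc, idem_mul_self] at h
        rw [← sub_eq_zero, ← h]
        abel
      rw [Finset.sum_congr rfl fun i _ => this i, Finset.sum_add_distrib, Finset.sum_sub_distrib,
        ← Finset.mul_sum, ← Finset.mul_sum, sum_idem, mul_one, hsa, hsa]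
    have h3 : ∑ i, f a (Γ.idem k i) * (Γ.idem k i * b) = s a * b := by
      rw [hsa, Finset.sum_mul]
      exact Finset.sum_congr rfl fun i _ => (mul_assoc _ _ _).symm
    rw [h2, h3] at h1
    rw [derivDefect_apply, map_sub, map_add, hochBim_act_one_left, h1]
    abel
  have e2 : ∀ a b, Γ.evalBim k ψ (Γ.derivDefect k V₁ a b) =
      a * Γ.evalBim k ψ (Γ.deriv k V₁ b) + Γ.evalBim k ψ (Γ.deriv k V₁ a) * b -
        Γ.evalBim k ψ (Γ.deriv k V₁ (a * b)) := by
    intro a b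
    rw [derivDefect_apply, map_sub, map_add, evalBim_act, evalBim_act, one_mul, mul_one]
  have h := key a b
  rw [e1, e2, ← sub_eq_zero] at h
  rw [hochschildD1_apply, ← sub_eq_zero, ← neg_eq_zero, ← h]
  simp only [LinearMap.add_apply, LinearMap.sub_apply, LinearMap.comp_apply, mul_add, mul_sub,
    add_mul, sub_mul]
  abel

variable (V₁) in
/-- The comparison map as a linear map. -/
noncomputable def comparisonMap : hochschildZ2 k (Γ.Alg k) →ₗ[k] Γ.cocycle2 k V₁ where
  toFun f := ⟨Γ.comparison k V₁ f.1, Γ.comparison_mem_cocycle2 k V₁ f.2⟩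
  map_add' f g := Subtype.ext <| funext fun t => by
    have : Γ.hochBim k (f.1 + g.1) = Γ.hochBim k f.1 + Γ.hochBim k g.1 :=
      bim_ext fun h a b => by simp [hochBim_single, add_mul]
    change Γ.comparison k V₁ (f.1 + g.1) t = Γ.comparison k V₁ f.1 t + Γ.comparison k V₁ g.1 t
    rw [comparison_eq, comparison_eq, comparison_eq, this, LinearMap.add_apply, mul_add]
  map_smul' r f := Subtype.ext <| funext fun t => by
    have : Γ.hochBim k (r • f.1) = r • Γ.hochBim k f.1 :=
      bim_ext fun h a b => by simp [hochBim_single]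
    change Γ.comparison k V₁ (r • f.1) t = r • Γ.comparison k V₁ f.1 t
    rw [comparison_eq, comparison_eq, this, LinearMap.smul_apply, mul_smul_comm]

/-- The comparison map is an isomorphism in degree two. -/
theorem exists_comparison_equiv (hbip : Γ.IsBipartition V₁) :
    ∃ Φ : HH2 k (Γ.Alg k) ≃ₗ[k] Γ.H2 k V₁, ∀ f : hochschildZ2 k (Γ.Alg k),
      ∃ hf : Γ.comparison k V₁ f.1 ∈ Γ.cocycle2 k V₁,
        Φ (Submodule.Quotient.mk f) = Submodule.Quotient.mk ⟨Γ.comparison k V₁ f.1, hf⟩ := by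
  set q := Submodule.mapQ ((LinearMap.range (hochschildD1 k (Γ.Alg k))).submoduleOf
    (hochschildZ2 k (Γ.Alg k))) ((Γ.coboundary2 k V₁).submoduleOf (Γ.cocycle2 k V₁))
    (Γ.comparisonMap k V₁) (by
      rintro ⟨f, hf⟩ ⟨g, hg⟩
      obtain rfl : hochschildD1 k (Γ.Alg k) g = f := hg
      exact Γ.comparison_hochschildD1 k hbip g) with hq
  have hqa : ∀ f, q (Submodule.Quotient.mk f) = Submodule.Quotient.mk (Γ.comparisonMap k V₁ f) :=
    fun f => Submodule.mapQ_apply _ _ _ f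
  refine ⟨LinearEquiv.ofBijective q ⟨?_, ?_⟩, fun f =>
    ⟨Γ.comparison_mem_cocycle2 k V₁ f.2, hqa f⟩⟩
  · rw [← LinearMap.ker_eq_bot, LinearMap.ker_eq_bot']
    intro x hx
    obtain ⟨f, rfl⟩ := Submodule.Quotient.mk_surjective _ x
    rw [hqa, Submodule.Quotient.mk_eq_zero] at hx
    rw [Submodule.Quotient.mk_eq_zero]
    exact Γ.exists_hochschildD1_eq k hbip f.2 hx
  · intro x
    obtain ⟨φ, rfl⟩ := Submodule.Quotient.mk_surjective _ x
    obtain ⟨f, hf, h⟩ := Γ.exists_hochschild_comparison_eq k hbip φ.2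
    exact ⟨Submodule.Quotient.mk ⟨f, hf⟩, by
      rw [hqa]
      exact congrArg _ (Subtype.ext h)⟩

end Isomorphism

/-! ## The standard cochains are cocycles -/

section StandardCocycles

open scoped Classical

variable {V H : Type*} (Γ : BrauerGraph V H) (k : Type*) [Field k] [Finite H] {V₁ : Set V}

theorem s_ι_σ_mem_iff (hbip : Γ.IsBipartition V₁) (h : H) :
    Γ.s (Γ.σ (Γ.ι h)) ∈ V₁ ↔ Γ.s h ∉ V₁ := by
  rw [s_σ, hbip h, not_not]

theorem P_len_σ_ι (h : H) :
    Γ.P k (Γ.σ (Γ.ι h)) (Γ.len (Γ.ι h)) = Γ.P k (Γ.σ h) (Γ.len h) := by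
  have := Γ.P_len_op k (Γ.σ h)
  rwa [op_σ, len_σ, len_σ] at this

theorem P_len_mul (h : H) (u : Γ.Alg k) :
    Γ.P k h (Γ.len h) * u = Γ.coef k h 0 u • Γ.P k h (Γ.len h) := by
  rw [Γ.P_mul_eq k (Γ.len_pos h), Finset.sum_eq_single_of_mem 0 (Finset.mem_range.2 (Γ.len_pos h)),
    σ_iterate_len, add_zero]
  intro j _ hj
  rw [Γ.P_of_len_lt k (by omega), smul_zero]

theorem coef_zero_op (h : H) (u : Γ.Alg k) : Γ.coef k (Γ.op h) 0 u = Γ.coef k h 0 u := by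
  rw [coef_zero, coef_zero, P_len_op]

/-- The operator `u ↦ τ(c u) a`. -/
noncomputable def rankOne (c a : Γ.Alg k) : Γ.Alg k →ₗ[k] Γ.Alg k :=
  ((Γ.τ k).comp (LinearMap.mulLeft k c)).smulRight a

theorem rankOne_apply (c a u : Γ.Alg k) : Γ.rankOne k c a u = Γ.τ k (c * u) • a := rfl

/-- The arrow in the functional and the path behind it together form the complement of the path in
front, so τ returns a coefficient of `u`. -/
theorem opBim_nab_of_left {x : H} (Λ : H → Γ.Alg k →ₗ[k] Γ.Alg k) (a : H → Γ.Alg k)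
    (hΛ : ∀ j, Λ (Γ.σ^[j] x) = Γ.rankOne k (Γ.arrow k (Γ.σ^[j] x)) (a (Γ.σ^[j] x)))
    (u : Γ.Alg k) : Γ.opBim k Λ (Γ.nab k x (Γ.len x)) u =
      ∑ j ∈ Finset.range (Γ.len x), Γ.coef k x j u • (Γ.P k x j * a (Γ.σ^[j] x)) := by
  rw [opBim_nab]
  refine Finset.sum_congr rfl fun j hj => ?_
  have hj := Finset.mem_range.1 hj
  rw [hΛ, rankOne_apply, ← mul_assoc, Function.iterate_succ_apply', arrow_mul_P, mul_smul_comm,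
    coef_apply, show Γ.len x - 1 - j + 1 = Γ.len x - j by omega]

theorem opBim_nab_of_right {x : H} (Λ : H → Γ.Alg k →ₗ[k] Γ.Alg k) (a : H → Γ.Alg k)
    (hΛ : ∀ j, Λ (Γ.σ^[j] x) = -Γ.rankOne k (Γ.idem k (Γ.src (Γ.σ^[j] x))) (a (Γ.σ^[j] x)))
    (u : Γ.Alg k) : Γ.opBim k Λ (Γ.nab k x (Γ.len x)) u =
      -∑ j ∈ Finset.range (Γ.len x), Γ.coef k x (j + 1) u • (Γ.P k x j * a (Γ.σ^[j] x)) := by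
  rw [opBim_nab, ← Finset.sum_neg_distrib]
  refine Finset.sum_congr rfl fun j hj => ?_
  rw [hΛ, LinearMap.neg_apply, rankOne_apply, ← mul_assoc, Function.iterate_succ_apply', ← tgt_σ,
    idem_tgt_mul_P, mul_neg, mul_smul_comm, coef_apply, Function.iterate_succ_apply',
    Nat.sub_sub, add_comm 1 j]

theorem opBim_nab_succ_of_right {x : H} (Λ : H → Γ.Alg k →ₗ[k] Γ.Alg k) (a : H → Γ.Alg k)
    (hΛ : ∀ j, Λ (Γ.σ^[j] x) = -Γ.rankOne k (Γ.idem k (Γ.src (Γ.σ^[j] x))) (a (Γ.σ^[j] x)))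
    (u : Γ.Alg k) : Γ.opBim k Λ (Γ.nab k x (Γ.len x + 1)) u =
      -∑ j ∈ Finset.range (Γ.len x + 1),
        Γ.coef k (Γ.σ x) j u • (Γ.P k x j * a (Γ.σ^[j] x)) := by
  rw [opBim_nab, ← Finset.sum_neg_distrib]
  refine Finset.sum_congr rfl fun j hj => ?_
  rw [hΛ, LinearMap.neg_apply, rankOne_apply, ← mul_assoc, Function.iterate_succ_apply', ← tgt_σ,
    idem_tgt_mul_P, mul_neg, mul_smul_comm, coef_apply, ← Function.iterate_succ_apply,
    Function.iterate_succ_apply', len_σ, Nat.add_sub_cancel]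

/-- Around V₁ the operator is `u ↦ τ(α_x u) a(x)`, around V₂ it is `u ↦ -τ(e u) c(x)`. Along the
tips (a) and (b) these produce the sums of `h₃` and `h₄`. On a tip `α_x α_y` of type (c) the two
contributions cancel by `h₁` if `x` is around V₂; otherwise one vanishes since `α_x α_y = 0` and the
other by `h₂`. -/
theorem mem_cocycle2_of_rankOne (hbip : Γ.IsBipartition V₁) {φ : Γ.Tip V₁ → Γ.Alg k}
    (a c : H → Γ.Alg k) (hφ : φ ∈ Γ.cochain2 k V₁)
    (h₁ : ∀ x, Γ.s x ∉ V₁ → Γ.arrow k x * a (Γ.σ (Γ.ι x)) = c x)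
    (h₂ : ∀ x, Γ.s x ∈ V₁ → Γ.arrow k x * c (Γ.σ (Γ.ι x)) = 0)
    (h₃ : ∀ h h₁ h₂ u, φ (.a h h₁ h₂) * u = ∑ j ∈ Finset.range (Γ.len h),
        Γ.coef k (Γ.σ h) j u • (Γ.P k (Γ.σ h) j * a (Γ.σ^[j] (Γ.σ h))) +
      ∑ j ∈ Finset.range (Γ.len (Γ.ι h)), Γ.coef k (Γ.σ (Γ.ι h)) (j + 1) u •
        (Γ.P k (Γ.σ (Γ.ι h)) j * c (Γ.σ^[j] (Γ.σ (Γ.ι h)))))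
    (h₄ : ∀ h h₂ u, φ (.b h h₂) * u = -∑ j ∈ Finset.range (Γ.len h + 1),
      Γ.coef k (Γ.σ h) j u • (Γ.P k h j * c (Γ.σ^[j] h)))
    (h₅ : ∀ x y hx hy hxy hσ, φ (.c x y hx hy hxy hσ) = 0) : φ ∈ Γ.cocycle2 k V₁ := by
  set Λ : H → Γ.Alg k →ₗ[k] Γ.Alg k := fun x => if Γ.s x ∈ V₁ then
    Γ.rankOne k (Γ.arrow k x) (a x) else -Γ.rankOne k (Γ.idem k (Γ.src x)) (c x) with hΛ
  refine Γ.mem_cocycle2_of_operators k V₁ Λ hφ fun t u => ?_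
  cases t with
  | a h hh _ =>
    rw [relBim, map_sub, LinearMap.sub_apply, ← Γ.len_σ h, ← Γ.len_σ (Γ.ι h),
      Γ.opBim_nab_of_left k Λ a, Γ.opBim_nab_of_right k Λ c, h₃, sub_neg_eq_add, len_σ, len_σ]
    · intro j
      rw [hΛ]
      exact if_neg (by rw [s_σ_iterate, s_ι_σ_mem_iff _ hbip, not_not]; exact hh)
    · intro j
      rw [hΛ]
      exact if_pos (by rw [s_σ_iterate, s_σ]; exact hh)
  | b h hh =>
    rw [relBim, Γ.opBim_nab_succ_of_right k Λ c, h₄]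
    intro j
    rw [hΛ]
    exact if_neg (by rw [s_σ_iterate]; exact hh)
  | c x y hx hy hxy hσ =>
    obtain rfl : y = Γ.σ (Γ.ι x) := (Γ.src_eq_tgt_iff.1 hxy).resolve_left hσ
    rw [relBim, map_add, LinearMap.add_apply, opBim_single, opBim_single, h₅, zero_mul]
    by_cases hV : Γ.s x ∈ V₁
    · have e1 : Λ x = Γ.rankOne k (Γ.arrow k x) (a x) := if_pos hV
      have e2 : Λ (Γ.σ (Γ.ι x)) = -Γ.rankOne k (Γ.idem k (Γ.src (Γ.σ (Γ.ι x)))) (c _) :=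
        if_neg (by rw [s_ι_σ_mem_iff _ hbip, not_not]; exact hV)
      rw [e1, e2, LinearMap.neg_apply, rankOne_apply, rankOne_apply, ← mul_assoc,
        Γ.arrow_mul_arrow_of_ne k hσ, zero_mul, map_zero, zero_smul, mul_neg, mul_smul_comm,
        h₂ _ hV, smul_zero, mul_zero, neg_zero, add_zero]
    · have e1 : Λ x = -Γ.rankOne k (Γ.idem k (Γ.src x)) (c x) := if_neg hV
      have e2 : Λ (Γ.σ (Γ.ι x)) = Γ.rankOne k (Γ.arrow k (Γ.σ (Γ.ι x))) (a _) :=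
        if_pos ((Γ.s_ι_σ_mem_iff hbip x).2 hV)
      rw [e1, e2, LinearMap.neg_apply, rankOne_apply, rankOne_apply, ← mul_assoc, ← mul_assoc,
        arrow_mul_idem_src, hxy, idem_tgt_mul_arrow, mul_neg, mul_smul_comm, mul_smul_comm,
        h₁ _ hV, ← h₁ _ hV, ← mul_assoc, idem_tgt_mul_arrow, neg_add_cancel]

/-! ### Types (A), (B), (C) -/

theorem stdA_smul (r : k) : Γ.stdA k r = r • (Γ.stdA k 1 : Γ.Tip V₁ → Γ.Alg k) := by
  funext t
  cases t <;> simp [stdA]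

theorem stdB₁_smul (r : k) (v : V) (i : ℕ) :
    Γ.stdB₁ k r v i = r • (Γ.stdB₁ k 1 v i : Γ.Tip V₁ → Γ.Alg k) := by
  funext t
  cases t <;> simp [stdB₁]

theorem stdB₂_smul (r : k) (v : V) (i : ℕ) :
    Γ.stdB₂ k r v i = r • (Γ.stdB₂ k 1 v i : Γ.Tip V₁ → Γ.Alg k) := by
  funext t
  cases t <;> simp [stdB₂]

theorem stdC_smul (r : k) (j : Γ.Edge) :
    Γ.stdC k r j = r • (Γ.stdC k 1 j : Γ.Tip V₁ → Γ.Alg k) := by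
  funext t
  cases t <;> simp [stdC]

theorem stdD₁_smul (r : k) (α β : H) :
    Γ.stdD₁ k r α β = r • (Γ.stdD₁ k 1 α β : Γ.Tip V₁ → Γ.Alg k) := by
  funext t
  cases t <;> simp [stdD₁]

theorem stdD₂_smul (r : k) (α β : H) :
    Γ.stdD₂ k r α β = r • (Γ.stdD₂ k 1 α β : Γ.Tip V₁ → Γ.Alg k) := by
  funext t
  cases t <;> simp [stdD₂]

/-- With trivial paths for `a` and arrows for `c`, condition `h₃` is the expansion `idem_mul_eq` of
`u`, and `h₄` is the expansion of `α_h u`. -/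
theorem stdA_mem (hbip : Γ.IsBipartition V₁) (r : k) :
    (Γ.stdA k r : Γ.Tip V₁ → Γ.Alg k) ∈ Γ.cocycle2 k V₁ := by
  rw [stdA_smul]
  refine Submodule.smul_mem _ _ (Γ.mem_cocycle2_of_rankOne k hbip (fun x => Γ.idem k (Γ.tgt x))
    (Γ.arrow k) (fun t => ?_) (fun x _ => ?_) (fun x _ => ?_) (fun h h₁ h₂ u => ?_)
    (fun h h₂ u => ?_) fun _ _ _ _ _ _ => rfl)
  · cases t <;> simp [stdA, Tip.target, Tip.source, idem_mul_self, idem_tgt_mul_arrow,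
      arrow_mul_idem_src]
  · rw [← src_eq_tgt_σ_ι, arrow_mul_idem_src]
  · exact Γ.arrow_mul_arrow_of_ne k (Γ.σ_ι_ne x)
  · have := Γ.idem_mul_eq k (Γ.σ h) u
    rw [tgt_σ, src, op_σ, len_σ, len_σ] at this
    rw [stdA, one_smul, this]
    simp only [P_mul_idem_tgt, P_mul_arrow]
  · rw [stdA, one_smul, Finset.sum_range_succ]
    simp only [P_mul_arrow]
    rw [P_len_succ, smul_zero, add_zero, neg_mul, ← P_one, Γ.P_mul_eq k one_pos]
    simp only [Function.iterate_one, add_comm]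

theorem stdB₁_mem (hbip : Γ.IsBipartition V₁) (r : k) (v : V) {i : ℕ} (hi : 1 ≤ i) :
    (Γ.stdB₁ k r v i : Γ.Tip V₁ → Γ.Alg k) ∈ Γ.cocycle2 k V₁ := by
  rw [stdB₁_smul]
  refine Submodule.smul_mem _ _ (Γ.mem_cocycle2_of_rankOne k hbip
    (fun x => if Γ.s x = v then Γ.P k x (i * Γ.val (Γ.s x)) else 0)
    (fun _ => 0) (fun t => ?_) (fun x _ => ?_) (fun x _ => mul_zero _) (fun h h₁ h₂ u => ?_)
    (fun h h₂ u => ?_) fun _ _ _ _ _ _ => rfl)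
  · cases t with
    | a h _ _ =>
      rw [stdB₁, Tip.target, Tip.source]
      split_ifs
      · rw [one_smul, Γ.ev_cyc k hi, idem_mul_P, tgt_σ, src, if_pos rfl, P_mul_idem,
          σ_iterate_mul_val, tgt_σ, src, if_pos rfl]
      · rw [mul_zero, zero_mul]
    | b => simp [stdB₁]
    | c => simp [stdB₁]
  · split_ifs
    · rw [← P_one, Γ.P_mul_P_of_ne k one_pos (Nat.mul_pos hi (Γ.val_pos _))]
      exact (Γ.σ_ι_ne x).symm
    · rw [mul_zero]
  · simp only [mul_zero, smul_zero, Finset.sum_const_zero, add_zero, s_σ_iterate, s_σ]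
    rw [stdB₁]
    split_ifs
    · rw [one_smul, Γ.ev_cyc k hi, Γ.P_mul_eq k (Nat.mul_pos hi (Γ.val_pos _)),
        σ_iterate_mul_val, len_σ, s_σ]
      simp only [P_mul_P, add_comm]
    · simp
  · simp [stdB₁]

/-- The powers of the cycle around V₂ have to be attached to arrows around V₁ with the same target,
whence `op`. In `h₃` only `j = 0` survives in the sum over the V₁-cycle. It supplies the constant
term that is missing from the shifted sum over the V₂-cycle, since the coefficient at 0 is the same
for both cycles. -/
theorem stdB₂_mem (hbip : Γ.IsBipartition V₁) (r : k) (w : V) {i : ℕ} (hi : 1 ≤ i) :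
    (Γ.stdB₂ k r w i : Γ.Tip V₁ → Γ.Alg k) ∈ Γ.cocycle2 k V₁ := by
  rw [stdB₂_smul]
  refine Submodule.smul_mem _ _ (Γ.mem_cocycle2_of_rankOne k hbip
    (fun x => if Γ.s (Γ.op x) = w then Γ.P k (Γ.op x) (i * Γ.val (Γ.s (Γ.op x))) else 0)
    (fun y => if Γ.s y = w then Γ.P k y (i * Γ.val (Γ.s y) + 1) else 0) (fun t => ?_)
    (fun x _ => ?_) (fun x _ => ?_) (fun h h₁ h₂ u => ?_)
    (fun h h₂ u => ?_) fun _ _ _ _ _ _ => rfl)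
  · cases t with
    | a h _ _ =>
      rw [stdB₂, Tip.target, Tip.source]
      split_ifs
      · rw [one_smul, Γ.ev_cyc k hi, idem_mul_P, tgt_σ, src, edge_ι, if_pos rfl, P_mul_idem,
          σ_iterate_mul_val, tgt_σ, src, edge_ι, if_pos rfl]
      · rw [mul_zero, zero_mul]
    | b h _ =>
      rw [stdB₂, Tip.target, Tip.source]
      split_ifs
      · rw [one_smul, ev_cyc_append, mul_neg, neg_mul, idem_mul_P, if_pos rfl, P_mul_idem,
          Function.iterate_succ_apply', σ_iterate_mul_val, tgt_σ, if_pos rfl]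
      · rw [mul_zero, zero_mul]
    | c => simp [stdB₂]
  · rw [op_σ, ι_ι, s_σ]
    split_ifs
    · rw [arrow_mul_P]
    · rw [mul_zero]
  · split_ifs
    · rw [Γ.arrow_mul_P_of_ne k (Γ.σ_ι_ne x).symm]
    · rw [mul_zero]
  · have h1 : ∀ j ∈ Finset.range (Γ.len h), j ≠ 0 → Γ.coef k (Γ.σ h) j u •
        (Γ.P k (Γ.σ h) j * if Γ.s (Γ.op (Γ.σ^[j] (Γ.σ h))) = w then Γ.P k (Γ.op (Γ.σ^[j] (Γ.σ h)))
          (i * Γ.val (Γ.s (Γ.op (Γ.σ^[j] (Γ.σ h))))) else 0) = 0 := by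
      intro j _ hj
      split_ifs
      · rw [Γ.P_mul_P_of_ne k (Nat.pos_of_ne_zero hj) (Nat.mul_pos hi (Γ.val_pos _))
          (Γ.op_ne _).symm, smul_zero]
      · rw [mul_zero, smul_zero]
    rw [Finset.sum_eq_single_of_mem 0 (Finset.mem_range.2 (Γ.len_pos h)) h1]
    simp only [s_σ_iterate, s_σ, Function.iterate_zero, id, op_σ]
    rw [stdB₂]
    split_ifs
    · rw [one_smul, Γ.ev_cyc k hi, Γ.P_mul_eq k (Nat.mul_pos hi (Γ.val_pos _)),
        σ_iterate_mul_val, len_σ, s_σ]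
      obtain ⟨l, hl⟩ := Nat.exists_eq_succ_of_ne_zero (Γ.len_pos (Γ.ι h)).ne'
      rw [hl, Finset.sum_range_succ', Finset.sum_range_succ, P_mul_P, ← op_σ, coef_zero_op, P_zero,
        ← Γ.tgt_op (Γ.σ h), idem_tgt_mul_P, op_σ, add_zero,
        Γ.P_of_len_lt k (n := l + (i * Γ.val (Γ.s (Γ.ι h)) + 1)), smul_zero, add_zero, add_comm]
      · congr 1
        refine Finset.sum_congr rfl fun j _ => ?_
        rw [P_mul_P]
        congr 2
        omega
      · rw [len_σ, hl]
        have := Nat.mul_pos hi (Γ.val_pos (Γ.ι h))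
        omega
    · simp
  · simp only [s_σ_iterate]
    rw [stdB₂]
    split_ifs
    · rw [one_smul, ev_cyc_append, neg_mul, Γ.P_mul_eq k (Nat.succ_pos _),
        Function.iterate_succ_apply', σ_iterate_mul_val, Finset.sum_range_succ]
      simp only [P_mul_P]
      rw [Γ.P_of_len_lt k (n := Γ.len h + _) (by omega), smul_zero, add_zero, neg_inj]
      refine Finset.sum_congr rfl fun j _ => ?_
      congr 2
      omega
    · simp

theorem stdC_mem (hbip : Γ.IsBipartition V₁) (r : k) (i : Γ.Edge) :
    (Γ.stdC k r i : Γ.Tip V₁ → Γ.Alg k) ∈ Γ.cocycle2 k V₁ := by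
  rw [stdC_smul]
  refine Submodule.smul_mem _ _ (Γ.mem_cocycle2_of_rankOne k hbip
    (fun x => if Γ.tgt x = i then Γ.P k x (Γ.len x) else 0)
    (fun _ => 0) (fun t => ?_) (fun x _ => ?_) (fun x _ => mul_zero _) (fun h h₁ h₂ u => ?_)
    (fun h h₂ u => ?_) fun _ _ _ _ _ _ => rfl)
  · cases t with
    | a h _ _ =>
      rw [stdC, Tip.target, Tip.source]
      split_ifs
      · rw [one_smul, ev_fullCyc_eq, idem_mul_P, tgt_σ, src, edge_ι, if_pos rfl, P_mul_idem,
          σ_iterate_len, tgt_σ, src, edge_ι, if_pos rfl]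
      · rw [mul_zero, zero_mul]
    | b => simp [stdC]
    | c => simp [stdC]
  · split_ifs
    · rw [← P_one, Γ.P_mul_P_of_ne k one_pos (Γ.len_pos _)]
      exact (Γ.σ_ι_ne x).symm
    · rw [mul_zero]
  -- The values of `a` lie in the socle, so a nontrivial path in front of them gives zero.
  · have h1 : ∀ j ∈ Finset.range (Γ.len h), j ≠ 0 → Γ.coef k (Γ.σ h) j u •
        (Γ.P k (Γ.σ h) j * if Γ.tgt (Γ.σ^[j] (Γ.σ h)) = i then Γ.P k (Γ.σ^[j] (Γ.σ h))
          (Γ.len (Γ.σ^[j] (Γ.σ h))) else 0) = 0 := by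
      intro j _ hj
      split_ifs
      · rw [P_mul_P, Γ.P_of_len_lt k, smul_zero]
        rw [len_σ_iterate]
        omega
      · rw [mul_zero, smul_zero]
    rw [Finset.sum_eq_single_of_mem 0 (Finset.mem_range.2 (Γ.len_pos h)) h1]
    simp only [mul_zero, smul_zero, Finset.sum_const_zero, add_zero, Function.iterate_zero, id]
    simp only [stdC, tgt_σ, src]
    split_ifs
    · rw [one_smul, ev_fullCyc_eq, len_σ, P_len_σ_ι, ← Γ.len_σ h, P_len_mul, P_zero,
        idem_tgt_mul_P]
    · simp
  · simp [stdC]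

end StandardCocycles

/-! ### Bigons, left division by arrows, and the cocycles of type (D) -/

section Bigons

open scoped Classical

variable {V H : Type*} (Γ : BrauerGraph V H) (k : Type*) [Field k] [Finite H] {V₁ : Set V}

theorem vertex_induction (hconn : Γ.IsConnected) {p : V → Prop} {v₀ : V} (h₀ : p v₀)
    (step : ∀ h, p (Γ.s h) → p (Γ.s (Γ.ι h))) (v : V) : p v := by
  obtain ⟨w⟩ := hconn.preconnected v₀ v
  induction w with
  | nil => exact h₀
  | cons e _ ih =>
    refine ih ?_
    rw [SimpleGraph.fromEdgeSet_adj] at e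
    obtain ⟨⟨i, hi⟩, -⟩ := e
    obtain ⟨h, rfl⟩ := Γ.edge_surjective i
    have hi : s(Γ.s h, Γ.s (Γ.ι h)) = s(_, _) := hi
    rw [Sym2.eq_iff] at hi
    obtain ⟨rfl, rfl⟩ | ⟨rfl, rfl⟩ := hi
    · exact step h h₀
    · simpa only [ι_ι] using step (Γ.ι h) h₀

theorem σ_eq_self_iff {h : H} : Γ.σ h = h ↔ Γ.val (Γ.s h) = 1 := by
  have := Γ.σ_iterate_eq_self_iff (n := 1) (h := h)
  rwa [Function.iterate_one, Nat.dvd_one] at this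

theorem eq_of_σ_eq_self {h h' : H} (e : Γ.σ h = h) (hs : Γ.s h = Γ.s h') : h' = h := by
  obtain ⟨n, hn⟩ := Γ.exists_σ_iterate_eq hs
  rw [← hn, Function.iterate_fixed e]

theorem len_eq_one_iff {h : H} : Γ.len h = 1 ↔ Γ.m (Γ.s h) = 1 ∧ Γ.val (Γ.s h) = 1 :=
  mul_eq_one

/-- If both ends of an edge are leaves, there is only this edge. -/
theorem one_lt_len_of_leaves (hconn : Γ.IsConnected) (hbip : Γ.IsBipartition V₁)
    (hloc : ¬ Γ.IsLocalBrauerTree) {h : H} (h₁ : Γ.σ h = h) (h₂ : Γ.σ (Γ.ι h) = Γ.ι h) :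
    1 < Γ.len h := by
  by_contra hlt
  have hlen : Γ.len h = 1 := by have := Γ.len_pos h; omega
  have hV : ∀ v, v = Γ.s h ∨ v = Γ.s (Γ.ι h) :=
    Γ.vertex_induction hconn (p := fun v => v = Γ.s h ∨ v = Γ.s (Γ.ι h)) (Or.inl rfl) (by
      rintro h' (e | e)
      · rw [Γ.eq_of_σ_eq_self h₁ e.symm]
        exact Or.inr rfl
      · rw [Γ.eq_of_σ_eq_self h₂ e.symm, ι_ι]
        exact Or.inl rfl)
  have hne : Γ.s h ≠ Γ.s (Γ.ι h) := fun e => by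
    have := hbip h
    rw [← e] at this
    exact iff_not_self this
  refine hloc ⟨Nat.card_eq_two_iff.2 ⟨_, _, hne, ?_⟩, Nat.card_eq_one_iff_exists.2
    ⟨Γ.edge h, fun i => ?_⟩, Γ.s h, (Γ.len_eq_one_iff.1 hlen).1⟩
  · ext v
    simpa using hV v
  · obtain ⟨h', rfl⟩ := Γ.edge_surjective i
    rw [edge_eq_iff]
    obtain e | e := hV (Γ.s h')
    · exact Or.inl (Γ.eq_of_σ_eq_self h₁ e.symm).symm
    · exact Or.inr (by rw [Γ.eq_of_σ_eq_self h₂ e.symm, ι_ι])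

/-- Two arrows `x`, `y` in opposite directions between the same two edges, around different
vertices. -/
structure IsBigon (x y : H) : Prop where
  σ_ι_left : Γ.σ (Γ.ι x) = y
  σ_ι_right : Γ.σ (Γ.ι y) = x
  s_ne : Γ.s x ≠ Γ.s y
  len_left : 1 < Γ.len x
  len_right : 1 < Γ.len y

variable {Γ} in
theorem IsBigon.symm {x y : H} (e : Γ.IsBigon x y) : Γ.IsBigon y x :=
  ⟨e.2, e.1, e.3.symm, e.5, e.4⟩

variable {Γ} in
theorem IsBigon.tgt_eq {x y : H} (e : Γ.IsBigon x y) : Γ.tgt x = Γ.src y := by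
  rw [Γ.src_eq_tgt_σ_ι y, e.σ_ι_right]

variable {Γ} in
theorem IsBigon.op_eq {x y : H} (e : Γ.IsBigon x y) : Γ.op y = Γ.σ x := by
  rw [← e.σ_ι_left, op_σ, ι_ι]

variable {Γ} in
theorem IsBigon.P_len {x y : H} (e : Γ.IsBigon x y) :
    Γ.P k (Γ.σ x) (Γ.len x) = Γ.P k y (Γ.len y) := by
  rw [← Γ.P_len_op k y, e.op_eq, len_σ]

/-- An arrow `x` of length one is a loop at a leaf; then `y = ι x` is also fixed by σ. The graph is
then a single edge with multiplicity one at an end, which is the excluded case. -/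
theorem isBigon_of_σ_ι (hconn : Γ.IsConnected) (hbip : Γ.IsBipartition V₁)
    (hloc : ¬ Γ.IsLocalBrauerTree) {x y : H} (hx : Γ.σ (Γ.ι x) = y) (hy : Γ.σ (Γ.ι y) = x) :
    Γ.IsBigon x y := by
  have key : ∀ x y, Γ.σ (Γ.ι x) = y → Γ.σ (Γ.ι y) = x → 1 < Γ.len x := by
    intro x y hx hy
    by_contra hlt
    have hlen : Γ.len x = 1 := by have := Γ.len_pos x; omega
    have h₁ : Γ.σ x = x := Γ.σ_eq_self_iff.2 (Γ.len_eq_one_iff.1 hlen).2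
    have h₂ : y = Γ.ι x := by
      rw [← Γ.ι_ι y]
      congr 1
      exact Γ.σ_injective (hy.trans h₁.symm)
    exact hlt (Γ.one_lt_len_of_leaves hconn hbip hloc h₁ (hx.trans h₂))
  refine ⟨hx, hy, fun e => ?_, key x y hx hy, key y x hy hx⟩
  rw [← hx, s_σ] at e
  have := hbip x
  rw [← e] at this
  exact iff_not_self this

theorem isBigon_of_mem (hconn : Γ.IsConnected) (hbip : Γ.IsBipartition V₁)
    (hloc : ¬ Γ.IsLocalBrauerTree) (x : Γ.Bigon V₁) : Γ.IsBigon (Γ.ι (Γ.ρ x.1)) x.1 :=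
  Γ.isBigon_of_σ_ι hconn hbip hloc (by rw [ι_ι, σ_ρ]) x.2.2

/-- Division by the arrow `x` from the left, on the paths that start with `x`. -/
noncomputable def leftDiv (x : H) : Γ.Alg k →ₗ[k] Γ.Alg k :=
  ∑ l ∈ Finset.range (Γ.len x), (Γ.coef k x (l + 1)).smulRight (Γ.P k (Γ.σ x) l)

theorem leftDiv_apply (x : H) (u : Γ.Alg k) : Γ.leftDiv k x u =
    ∑ l ∈ Finset.range (Γ.len x), Γ.coef k x (l + 1) u • Γ.P k (Γ.σ x) l := by
  simp [leftDiv]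

theorem arrow_mul_leftDiv (x : H) (u : Γ.Alg k) : Γ.arrow k x * Γ.leftDiv k x u =
    ∑ l ∈ Finset.range (Γ.len x), Γ.coef k x (l + 1) u • Γ.P k x (l + 1) := by
  simp only [leftDiv_apply, Finset.mul_sum, mul_smul_comm, arrow_mul_P]

theorem coef_succ_arrow_mul {x : H} {l : ℕ} (hl : l < Γ.len x) (u : Γ.Alg k) :
    Γ.coef k x (l + 1) (Γ.arrow k x * u) = Γ.coef k (Γ.σ x) l u := by
  have := Γ.P_mul_arrow k (Γ.σ^[l + 1] x) (Γ.len x - (l + 1))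
  rw [Γ.σ_iterate_len_sub x hl] at this
  rw [coef_apply, ← mul_assoc, this, coef_apply, len_σ, Function.iterate_succ_apply]
  congr 3
  omega

theorem leftDiv_arrow_mul (x : H) (u : Γ.Alg k) : Γ.leftDiv k x (Γ.arrow k x * u) =
    ∑ l ∈ Finset.range (Γ.len x), Γ.coef k (Γ.σ x) l u • Γ.P k (Γ.σ x) l := by
  rw [leftDiv_apply]
  refine Finset.sum_congr rfl fun l hl => ?_
  rw [Γ.coef_succ_arrow_mul k (Finset.mem_range.1 hl)]

theorem coef_idem_tgt_mul {x : H} {l : ℕ} (hl : l ≤ Γ.len x) (u : Γ.Alg k) :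
    Γ.coef k x l (Γ.idem k (Γ.tgt x) * u) = Γ.coef k x l u := by
  have := Γ.P_mul_idem_tgt k (Γ.σ^[l] x) (Γ.len x - l)
  rw [Γ.σ_iterate_len_sub x hl] at this
  rw [coef_apply, ← mul_assoc, this, coef_apply]

theorem leftDiv_idem_tgt_mul (x : H) (u : Γ.Alg k) :
    Γ.leftDiv k x (Γ.idem k (Γ.tgt x) * u) = Γ.leftDiv k x u := by
  rw [leftDiv_apply, leftDiv_apply]
  refine Finset.sum_congr rfl fun l hl => ?_
  rw [Γ.coef_idem_tgt_mul k (Finset.mem_range.1 hl)]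

/-- A path beginning with the other arrow meets the paths beginning with `x` only in the socle, so
only the top term of the division remains. -/
theorem leftDiv_P_op_mul (x : H) {n : ℕ} (hn : 0 < n) (u : Γ.Alg k) :
    Γ.leftDiv k x (Γ.P k (Γ.op x) n * u) =
      Γ.τ k (Γ.P k (Γ.op x) n * u) • Γ.P k (Γ.σ x) (Γ.len x - 1) := by
  have h0 := Γ.len_pos x
  rw [leftDiv_apply, Finset.sum_eq_single_of_mem (Γ.len x - 1) (Finset.mem_range.2 (by omega)),
    Nat.sub_add_cancel h0, coef_len, ← mul_assoc, ← tgt_op, idem_tgt_mul_P]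
  intro l hl hl'
  have hl := Finset.mem_range.1 hl
  rw [coef_apply, ← mul_assoc, Γ.P_mul_P_of_ne k (by omega) hn, zero_mul, map_zero, zero_smul]
  rw [Γ.σ_iterate_len_sub x hl]
  exact (Γ.op_ne x).symm

theorem P_mul_leftDiv {h x : H} {n : ℕ} (hn : 0 < n) (hne : Γ.σ^[n] h ≠ Γ.σ x)
    (ht : Γ.tgt (Γ.σ^[n] h) = Γ.src x) (u : Γ.Alg k) :
    Γ.P k h n * Γ.leftDiv k x u = Γ.coef k x 1 u • Γ.P k h n := by
  rw [leftDiv_apply, Finset.mul_sum,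
    Finset.sum_eq_single_of_mem 0 (Finset.mem_range.2 (Γ.len_pos x)), P_zero, tgt_σ, ← ht,
    mul_smul_comm, P_mul_idem_tgt]
  intro l _ hl
  rw [mul_smul_comm, Γ.P_mul_P_of_ne k hn (Nat.pos_of_ne_zero hl) hne, smul_zero]

/-- An occurrence of `x` strictly inside the path contributes nothing: division by `y` of a
nontrivial path around the vertex of `x` leaves only a multiple of `P (σ y) (len y - 1)`, and the
path in front annihilates it. So only the first and the last arrow count; `hn` ensures that these
are different when `h = x`. -/
theorem opBim_nab_leftDiv {x y h : H} (e : Γ.IsBigon x y) {n : ℕ} (hn : h = x → 2 ≤ n)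
    {Λ : H → Γ.Alg k →ₗ[k] Γ.Alg k}
    (hΛ : ∀ j, Λ (Γ.σ^[j] h) = if Γ.σ^[j] h = x then Γ.leftDiv k y else 0) (u : Γ.Alg k) :
    Γ.opBim k Λ (Γ.nab k h n) u =
      (if h = x then Γ.τ k (Γ.P k (Γ.σ x) (n - 1) * u) • Γ.P k (Γ.σ y) (Γ.len y - 1) else 0) +
      (if Γ.σ^[n - 1] h = x then Γ.coef k y 1 u • Γ.P k h (n - 1) else 0) := by
  have hs : ∀ a b, Γ.s a = Γ.s x → Γ.s b = Γ.s y → a ≠ b := by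
    rintro a b h₁ h₂ rfl
    exact e.s_ne (h₁.symm.trans h₂)
  rw [opBim_nab]
  obtain rfl | rfl | ⟨n, rfl⟩ : n = 0 ∨ n = 1 ∨ ∃ n', n = n' + 2 :=
    match n with
    | 0 => .inl rfl
    | 1 => .inr (.inl rfl)
    | n + 2 => .inr (.inr ⟨n, rfl⟩)
  · have h1 : h ≠ x := fun e => by have := hn e; omega
    simp [h1]
  · have h1 : h ≠ x := fun e => by have := hn e; omega
    have := hΛ 0
    rw [Function.iterate_zero_apply, if_neg h1] at this
    simp [h1, this]
  · rw [Finset.sum_range_succ, Finset.sum_range_succ']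
    have hmid : ∀ j ∈ Finset.range n, Γ.P k h (j + 1) * Λ (Γ.σ^[j + 1] h)
        (Γ.P k (Γ.σ^[j + 1 + 1] h) (n + 2 - 1 - (j + 1)) * u) = 0 := by
      intro j hj
      have hj := Finset.mem_range.1 hj
      rw [hΛ]
      split_ifs with hx
      · rw [Function.iterate_succ_apply', hx, ← e.op_eq, Γ.leftDiv_P_op_mul k y (by omega),
          mul_smul_comm, Γ.P_mul_P_of_ne k (Nat.succ_pos _) (by have := e.len_right; omega),
          smul_zero]
        rw [hx]
        exact hs _ _ rfl (by rw [s_σ])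
      · rw [LinearMap.zero_apply, mul_zero]
    rw [Finset.sum_eq_zero hmid, zero_add]
    congr 1
    · rw [hΛ, Function.iterate_zero_apply]
      split_ifs with hx
      · subst hx
        rw [Function.iterate_succ_apply', Function.iterate_zero_apply, ← e.op_eq,
          Γ.leftDiv_P_op_mul k y (by omega), P_zero, e.tgt_eq, ← tgt_σ, mul_smul_comm,
          idem_tgt_mul_P]
        rfl
      · simp
    · rw [hΛ]
      have hn1 : n + 2 - 1 = n + 1 := rfl
      rw [hn1, Nat.sub_self]
      split_ifs with hx
      · rw [Function.iterate_succ_apply', hx, P_zero, ← e.op_eq, tgt_op, leftDiv_idem_tgt_mul,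
          Γ.P_mul_leftDiv k (Nat.succ_pos _)]
        · rw [hx]
          exact hs _ _ rfl (by rw [s_σ])
        · rw [hx, e.tgt_eq]
      · simp

/-- The paths ending at the target of `x` either begin with `x`, and are recovered by dividing by
`x` and multiplying back, or they belong to the family of `σ y`, and are recovered by multiplying by
`y` and dividing. -/
theorem opBim_pair_leftDiv {x y : H} (e : Γ.IsBigon x y) (u : Γ.Alg k) :
    Γ.idem k (Γ.tgt x) * Γ.leftDiv k y (Γ.arrow k y * u) +
      Γ.arrow k x * Γ.leftDiv k x (Γ.idem k (Γ.src y) * u) = Γ.idem k (Γ.tgt x) * u := by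
  rw [← e.tgt_eq, leftDiv_idem_tgt_mul, arrow_mul_leftDiv, leftDiv_arrow_mul]
  have h1 : Γ.tgt x = Γ.tgt (Γ.σ y) := by rw [tgt_σ, e.tgt_eq]
  have h2 : Γ.op (Γ.σ y) = x := by rw [op_σ, e.σ_ι_right]
  rw [h1, Γ.idem_mul_eq k (Γ.σ y) u, h2, len_σ, Finset.mul_sum]
  simp only [mul_smul_comm, idem_tgt_mul_P]

theorem idem_mul_ev_fullCyc_tail {x y : H} (e : Γ.IsBigon x y) :
    Γ.ev k (Γ.fullCyc x).tail = Γ.P k (Γ.σ x) (Γ.len x - 1) := by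
  obtain ⟨n, hn⟩ := Nat.exists_eq_add_of_le e.len_left
  rw [fullCyc_eq_iterate, hn, show 0 + 1 + 1 + n = n + 1 + 1 by omega, List.iterate, List.tail_cons,
    ← P_succ_eq_ev]
  rfl

theorem P_len_pred_mul {x : H} (hx : 1 < Γ.len x) (u : Γ.Alg k) :
    Γ.P k (Γ.σ x) (Γ.len x - 1) * u = Γ.coef k x 0 u • Γ.P k (Γ.σ x) (Γ.len x - 1) +
      Γ.coef k x 1 u • Γ.P k (Γ.σ x) (Γ.len x) := by
  rw [Γ.P_mul_eq k (by omega), σ_iterate_len_pred,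
    ← Finset.sum_subset (s₁ := Finset.range 2), Finset.sum_range_succ,
    Finset.sum_range_one, Nat.sub_add_cancel hx.le, add_zero]
  · intro j hj
    have := Finset.mem_range.1 hj
    rw [len_σ]
    exact Finset.mem_range.2 (by omega)
  · intro j _ hj
    have : ¬ j < 2 := fun h => hj (Finset.mem_range.2 h)
    rw [Γ.P_of_len_lt k (by rw [len_σ]; omega), smul_zero]

/-- Each arrow of the bigon is deformed by left division by the other one. On a commutativity
relation the first arrow of one full cycle belongs to the bigon exactly when the last arrow of the
other does, and these contributions cancel in pairs. -/
theorem stdD₁_mem (hbip : Γ.IsBipartition V₁) (r : k) {α β : H} (e : Γ.IsBigon α β)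
    (hβ : Γ.s β ∉ V₁) : (Γ.stdD₁ k r α β : Γ.Tip V₁ → Γ.Alg k) ∈ Γ.cocycle2 k V₁ := by
  have hα : Γ.s α ∈ V₁ := by rw [hbip, ← Γ.s_σ, e.σ_ι_left]; exact hβ
  have hαβ : α ≠ β := fun h => e.s_ne (by rw [h])
  have hα' : ∀ x y, Γ.s x ∈ V₁ → Γ.s y ∉ V₁ → x ≠ y := fun x y h₁ h₂ h => h₂ (h ▸ h₁)
  rw [stdD₁_smul]
  refine Submodule.smul_mem _ _ (Γ.mem_cocycle2_of_operators k V₁ (fun x => if x = α then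
    Γ.leftDiv k β else if x = β then Γ.leftDiv k α else 0) (fun t => ?_) fun t u => ?_)
  · cases t with
    | a => simp [stdD₁]
    | b h _ =>
      rw [stdD₁, Tip.target, Tip.source]
      split_ifs with hh
      · rw [hh, one_smul, Γ.idem_mul_ev_fullCyc_tail k e, idem_mul_P, if_pos, P_mul_idem,
          σ_iterate_len_pred, if_pos e.tgt_eq]
        rw [tgt_σ, e.symm.tgt_eq]
      · rw [mul_zero, zero_mul]
    | c x y =>
      rw [stdD₁, Tip.target, Tip.source]
      split_ifs with h₁ h₂
      · rw [h₁.1, h₁.2, e.tgt_eq, one_smul, idem_mul_self, idem_mul_self]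
      · rw [h₂.1, h₂.2, e.symm.tgt_eq, one_smul, idem_mul_self, idem_mul_self]
      · rw [mul_zero, zero_mul]
  · cases t with
    | a h hh _ =>
      have h1 : Γ.s (Γ.ι h) ∉ V₁ := (hbip h).1 hh
      rw [relBim, map_sub, LinearMap.sub_apply, Γ.opBim_nab_leftDiv k e,
        Γ.opBim_nab_leftDiv k e.symm, stdD₁, zero_mul, ← Γ.len_σ h, σ_iterate_len_pred, len_σ,
        σ_iterate_len_pred]
      rotate_left
      · intro hx
        rw [← Γ.len_σ, hx]
        exact e.len_right
      · intro j
        rw [if_neg]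
        refine (hα' _ _ hα ?_).symm
        rw [s_σ_iterate, s_σ]
        exact h1
      · intro hx
        rw [← Γ.len_σ, hx]
        exact e.len_left
      · intro j
        split_ifs with h₁ h₂
        · rfl
        · refine absurd h₂ (hα' _ _ ?_ hβ)
          rw [s_σ_iterate, s_σ]
          exact hh
        · rfl
      have h2 : Γ.σ (Γ.ι h) = β ↔ h = α := by
        rw [← e.σ_ι_left]
        exact ⟨fun h => Γ.ι_injective (Γ.σ_injective h), fun h => by rw [h]⟩
      have h3 : Γ.ι h = β ↔ Γ.σ h = α := by
        rw [← e.σ_ι_right]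
        exact ⟨fun h => by rw [← h, ι_ι], fun h => by rw [Γ.σ_injective h, ι_ι]⟩
      simp only [h2, h3]
      have h4 : ∀ x, Γ.τ k (Γ.P k (Γ.σ x) (Γ.len x - 1) * u) = Γ.coef k x 1 u := fun x => by
        rw [coef_apply, Function.iterate_one]
      rw [sub_eq_zero, add_comm]
      congr 1
      · split_ifs with hx
        · rw [hx, ← Γ.len_σ (Γ.ι α), e.σ_ι_left, h4]
        · rfl
      · split_ifs with hx
        · rw [← Γ.len_σ h, hx, h4, h3.2 hx]
        · rfl
    | b h hh =>
      have hp := Γ.len_pos h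
      rw [relBim, Γ.opBim_nab_leftDiv k e.symm (fun _ => by omega), stdD₁, Nat.add_sub_cancel,
        σ_iterate_len]
      · split_ifs with hx
        · subst hx
          rw [one_smul, Γ.idem_mul_ev_fullCyc_tail k e, Γ.P_len_pred_mul k e.len_left,
            e.symm.P_len k, e.P_len k, coef_zero]
        · rw [zero_mul, add_zero]
      · intro j
        rw [if_neg]
        refine (hα' _ _ hα ?_).symm
        rw [s_σ_iterate]
        exact hh
    | c x y hx hy hxy hσ =>
      obtain rfl : y = Γ.σ (Γ.ι x) := (Γ.src_eq_tgt_iff.1 hxy).resolve_left hσ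
      rw [relBim, map_add, LinearMap.add_apply, opBim_single, opBim_single, stdD₁]
      by_cases h1 : x = α
      · subst h1
        rw [e.σ_ι_left, if_pos rfl, if_neg hαβ.symm, if_pos rfl, if_pos ⟨rfl, rfl⟩,
          Γ.opBim_pair_leftDiv k e, one_smul, e.tgt_eq]
      by_cases h2 : x = β
      · subst h2
        rw [e.σ_ι_right, if_neg hαβ.symm, if_pos rfl, if_pos rfl, if_neg fun h => hαβ h.2,
          if_pos ⟨rfl, rfl⟩, Γ.opBim_pair_leftDiv k e.symm, one_smul]
      · have h3 : Γ.σ (Γ.ι x) ≠ α := fun h => h2 (Γ.ι_injective (Γ.σ_injective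
          (h.trans e.σ_ι_right.symm)))
        have h4 : Γ.σ (Γ.ι x) ≠ β := fun h => h1 (Γ.ι_injective (Γ.σ_injective
          (h.trans e.σ_ι_left.symm)))
        simp [h1, h2, h3, h4]

/-- If `y` is not the first arrow, the path in front kills the socle value. If it is, the functional
multiplies two nontrivial paths around different vertices; `hn` ensures that the second one is
nontrivial. -/
theorem opBim_nab_rankOne {x y h : H} (e : Γ.IsBigon x y) {n : ℕ} (hn : h = y → 2 ≤ n)
    {Λ : H → Γ.Alg k →ₗ[k] Γ.Alg k}
    (hΛ : ∀ j, Λ (Γ.σ^[j] h) = if Γ.σ^[j] h = y then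
      Γ.rankOne k (Γ.P k (Γ.σ x) (Γ.len x - 1)) (Γ.P k y (Γ.len y)) else 0) (u : Γ.Alg k) :
    Γ.opBim k Λ (Γ.nab k h n) u = 0 := by
  rw [opBim_nab]
  refine Finset.sum_eq_zero fun j hj => ?_
  have hj := Finset.mem_range.1 hj
  rw [hΛ]
  split_ifs with hy
  · rw [rankOne_apply, mul_smul_comm]
    obtain rfl | hj0 := Nat.eq_zero_or_pos j
    · have hy : h = y := hy
      have hn := hn hy
      rw [← mul_assoc, Γ.P_mul_P_of_ne k (by have := e.len_left; omega) (by omega), zero_mul,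
        map_zero, zero_smul]
      rw [σ_iterate_len_pred]
      intro hx
      apply e.s_ne
      rw [hx, s_σ_iterate, hy]
    · have := Γ.P_mul_P k h j (Γ.len y)
      rw [hy] at this
      rw [this, Γ.P_of_len_lt k (h := h), smul_zero]
      rw [← hy, len_σ_iterate]
      omega
  · rw [LinearMap.zero_apply, mul_zero]

theorem stdD₂_mem (hbip : Γ.IsBipartition V₁) (r : k) {α β : H} (e : Γ.IsBigon α β)
    (hβ : Γ.s β ∉ V₁) : (Γ.stdD₂ k r α β : Γ.Tip V₁ → Γ.Alg k) ∈ Γ.cocycle2 k V₁ := by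
  have hα : Γ.s α ∈ V₁ := by rw [hbip, ← Γ.s_σ, e.σ_ι_left]; exact hβ
  have hαβ : α ≠ β := fun h => e.s_ne (by rw [h])
  rw [stdD₂_smul]
  refine Submodule.smul_mem _ _ (Γ.mem_cocycle2_of_operators k V₁ (fun x => if x = β then
    Γ.rankOne k (Γ.P k (Γ.σ α) (Γ.len α - 1)) (Γ.P k β (Γ.len β)) else 0) (fun t => ?_)
    fun t u => ?_)
  · cases t with
    | a => simp [stdD₂]
    | b => simp [stdD₂]
    | c x y =>
      rw [stdD₂, Tip.target, Tip.source]
      split_ifs with h₁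
      · rw [h₁.1, h₁.2, one_smul, ev_fullCyc_eq, idem_mul_P, if_pos rfl, P_mul_idem,
          σ_iterate_len, if_pos e.symm.tgt_eq]
      · rw [mul_zero, zero_mul]
  · cases t with
    | a h hh _ =>
      rw [relBim, map_sub, LinearMap.sub_apply, Γ.opBim_nab_rankOne k e _ fun j => rfl,
        Γ.opBim_nab_rankOne k e _ fun j => rfl, stdD₂, zero_mul, sub_zero]
      · intro hx
        rw [← Γ.len_σ, hx]
        exact e.len_right
      · intro hx
        refine absurd ?_ hβ
        rw [← hx, s_σ]
        exact hh
    | b h hh =>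
      rw [relBim, Γ.opBim_nab_rankOne k e _ fun j => rfl, stdD₂, zero_mul]
      intro _
      have := Γ.len_pos h
      omega
    | c x y hx hy hxy hσ =>
      obtain rfl : y = Γ.σ (Γ.ι x) := (Γ.src_eq_tgt_iff.1 hxy).resolve_left hσ
      rw [relBim, map_add, LinearMap.add_apply, opBim_single, opBim_single, stdD₂]
      by_cases h1 : x = α
      · subst h1
        rw [e.σ_ι_left, if_pos rfl, if_neg hαβ, if_neg fun h => hαβ h.1, rankOne_apply,
          mul_smul_comm, ← Γ.P_one k x, Γ.P_mul_P_of_ne k one_pos (Γ.len_pos _)]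
        · simp
        · intro hx
          rw [Function.iterate_one] at hx
          apply e.s_ne
          rw [← hx, s_σ]
      by_cases h2 : x = β
      · subst h2
        have h3 := Γ.P_mul_arrow k (Γ.σ α) (Γ.len α - 1)
        rw [σ_iterate_len_pred, Nat.sub_add_cancel (Γ.len_pos α)] at h3
        rw [e.σ_ι_right, if_neg hαβ, if_pos rfl, if_pos ⟨rfl, rfl⟩, rankOne_apply, one_smul,
          ev_fullCyc_eq, ← mul_assoc, h3, e.P_len k, P_len_mul, coef_zero, mul_smul_comm,
          idem_tgt_mul_P]
        simp [τ_P]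
      · have h3 : Γ.σ (Γ.ι x) ≠ β := fun h => h1 (Γ.ι_injective (Γ.σ_injective
          (h.trans e.σ_ι_left.symm)))
        simp [h2, h3]

end Bigons

/-! ## Reduction of a cocycle to standard cocycles -/

section CocycleConditions

open scoped Classical

variable {V H : Type*} (Γ : BrauerGraph V H) (k : Type*) [Field k] [Finite H] {V₁ : Set V}

variable (V₁) in
/-- The value of a `2`-cochain on the tip `a h`. -/
noncomputable def aEval (h : H) : (Γ.Tip V₁ → Γ.Alg k) →ₗ[k] Γ.Alg k :=
  if hh : Γ.s h ∈ V₁ ∧ Γ.IsArrow' V₁ h then LinearMap.proj (.a h hh.1 hh.2) else 0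

variable (V₁) in
/-- The value of a `2`-cochain on the tip `b h`. -/
noncomputable def bEval (h : H) : (Γ.Tip V₁ → Γ.Alg k) →ₗ[k] Γ.Alg k :=
  if hh : Γ.s h ∉ V₁ then LinearMap.proj (.b h hh) else 0

variable (V₁) in
/-- The value of a `2`-cochain on the tip `c x (σ ι x)`. -/
noncomputable def cEval (x : H) : (Γ.Tip V₁ → Γ.Alg k) →ₗ[k] Γ.Alg k :=
  if hx : Γ.IsArrow' V₁ x ∧ Γ.IsArrow' V₁ (Γ.σ (Γ.ι x)) then
    LinearMap.proj (.c x (Γ.σ (Γ.ι x)) hx.1 hx.2 (Γ.src_eq_tgt_σ_ι x) (Γ.σ_ι_ne x)) else 0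

theorem aEval_apply {h : H} (h₁ : Γ.s h ∈ V₁) (h₂ : Γ.IsArrow' V₁ h) (φ : Γ.Tip V₁ → Γ.Alg k) :
    Γ.aEval k V₁ h φ = φ (.a h h₁ h₂) := by
  rw [aEval, dif_pos ⟨h₁, h₂⟩, LinearMap.proj_apply]

theorem bEval_apply {h : H} (h₁ : Γ.s h ∉ V₁) (φ : Γ.Tip V₁ → Γ.Alg k) :
    Γ.bEval k V₁ h φ = φ (.b h h₁) := by
  rw [bEval, dif_pos h₁, LinearMap.proj_apply]

theorem cEval_apply {x : H} (hx : Γ.IsArrow' V₁ x) (hy : Γ.IsArrow' V₁ (Γ.σ (Γ.ι x)))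
    (φ : Γ.Tip V₁ → Γ.Alg k) : Γ.cEval k V₁ x φ =
      φ (.c x (Γ.σ (Γ.ι x)) hx hy (Γ.src_eq_tgt_σ_ι x) (Γ.σ_ι_ne x)) := by
  rw [cEval, dif_pos ⟨hx, hy⟩, LinearMap.proj_apply]

theorem cEval_of_left {x : H} (hx : ¬ Γ.IsArrow' V₁ x) : Γ.cEval k V₁ x = 0 := by
  rw [cEval, dif_neg fun h => hx h.1]

theorem cEval_of_right {x : H} (hx : ¬ Γ.IsArrow' V₁ (Γ.σ (Γ.ι x))) : Γ.cEval k V₁ x = 0 := by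
  rw [cEval, dif_neg fun h => hx h.2]

theorem cochain_ext {φ φ' : Γ.Tip V₁ → Γ.Alg k}
    (ha : ∀ h, Γ.s h ∈ V₁ → Γ.IsArrow' V₁ h → Γ.aEval k V₁ h φ = Γ.aEval k V₁ h φ')
    (hb : ∀ h, Γ.s h ∉ V₁ → Γ.bEval k V₁ h φ = Γ.bEval k V₁ h φ')
    (hc : ∀ x, Γ.IsArrow' V₁ x → Γ.IsArrow' V₁ (Γ.σ (Γ.ι x)) →
      Γ.cEval k V₁ x φ = Γ.cEval k V₁ x φ') : φ = φ' := by
  funext t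
  cases t with
  | a h h₁ h₂ => simpa only [aEval_apply _ _ h₁ h₂] using ha h h₁ h₂
  | b h h₁ => simpa only [bEval_apply _ _ h₁] using hb h h₁
  | c x y hx hy hxy hσ =>
    obtain rfl : y = Γ.σ (Γ.ι x) := (Γ.src_eq_tgt_iff.1 hxy).resolve_left hσ
    simpa only [cEval_apply _ _ hx hy] using hc x hx hy

theorem idem_mul_aEval {φ : Γ.Tip V₁ → Γ.Alg k} (hφ : φ ∈ Γ.cochain2 k V₁) (h : H) :
    Γ.idem k (Γ.edge h) * Γ.aEval k V₁ h φ = Γ.aEval k V₁ h φ := by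
  by_cases hh : Γ.s h ∈ V₁ ∧ Γ.IsArrow' V₁ h
  · rw [Γ.aEval_apply k hh.1 hh.2, ← hφ (.a h hh.1 hh.2), ← mul_assoc, ← mul_assoc, Tip.target,
      idem_mul_self]
  · rw [aEval, dif_neg hh, LinearMap.zero_apply, mul_zero]

theorem idem_mul_bEval {φ : Γ.Tip V₁ → Γ.Alg k} (hφ : φ ∈ Γ.cochain2 k V₁) (h : H) :
    Γ.idem k (Γ.tgt h) * Γ.bEval k V₁ h φ = Γ.bEval k V₁ h φ := by
  by_cases hh : Γ.s h ∉ V₁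
  · rw [Γ.bEval_apply k hh, ← hφ (.b h hh), ← mul_assoc, ← mul_assoc, Tip.target, idem_mul_self]
  · rw [bEval, dif_neg hh, LinearMap.zero_apply, mul_zero]

theorem bEval_mul_idem {φ : Γ.Tip V₁ → Γ.Alg k} (hφ : φ ∈ Γ.cochain2 k V₁) (h : H) :
    Γ.bEval k V₁ h φ * Γ.idem k (Γ.src h) = Γ.bEval k V₁ h φ := by
  by_cases hh : Γ.s h ∉ V₁
  · rw [Γ.bEval_apply k hh, ← hφ (.b h hh), mul_assoc, Tip.source, idem_mul_self]
  · rw [bEval, dif_neg hh, LinearMap.zero_apply, zero_mul]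

theorem idem_mul_cEval {φ : Γ.Tip V₁ → Γ.Alg k} (hφ : φ ∈ Γ.cochain2 k V₁) (x : H) :
    Γ.idem k (Γ.tgt x) * Γ.cEval k V₁ x φ = Γ.cEval k V₁ x φ := by
  by_cases hx : Γ.IsArrow' V₁ x ∧ Γ.IsArrow' V₁ (Γ.σ (Γ.ι x))
  · rw [Γ.cEval_apply k hx.1 hx.2, ← hφ, ← mul_assoc, ← mul_assoc, Tip.target, idem_mul_self]
  · rw [cEval, dif_neg hx, LinearMap.zero_apply, mul_zero]

theorem cEval_mul_idem {φ : Γ.Tip V₁ → Γ.Alg k} (hφ : φ ∈ Γ.cochain2 k V₁) (x : H) :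
    Γ.cEval k V₁ x φ * Γ.idem k (Γ.src (Γ.σ (Γ.ι x))) = Γ.cEval k V₁ x φ := by
  by_cases hx : Γ.IsArrow' V₁ x ∧ Γ.IsArrow' V₁ (Γ.σ (Γ.ι x))
  · rw [Γ.cEval_apply k hx.1 hx.2, ← hφ, mul_assoc, Tip.source, idem_mul_self]
  · rw [cEval, dif_neg hx, LinearMap.zero_apply, zero_mul]

theorem ne_σ_ι (hbip : Γ.IsBipartition V₁) {x y : H} (h : Γ.s x ∈ V₁ ↔ Γ.s y ∈ V₁) :
    x ≠ Γ.σ (Γ.ι y) := by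
  rintro rfl
  rw [s_ι_σ_mem_iff _ hbip] at h
  exact iff_not_self h.symm

theorem src_eq_tgt_iff_of_mem (hbip : Γ.IsBipartition V₁) {x y : H}
    (h : Γ.s x ∈ V₁ ↔ Γ.s y ∈ V₁) : Γ.src x = Γ.tgt y ↔ y = Γ.σ x := by
  rw [src_eq_tgt_iff]
  exact or_iff_left (Γ.ne_σ_ι hbip h.symm)

theorem τ_eq_zero_of_idem {u : Γ.Alg k} {i j : Γ.Edge} (hi : Γ.idem k i * u = u)
    (hj : u * Γ.idem k j = u) (hij : i ≠ j) : Γ.τ k u = 0 := by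
  rw [← hj, τ_mul_comm, ← hi, ← mul_assoc, Γ.idem_mul_of_ne k hij.symm, zero_mul, map_zero]

/-- The conditions on a cocycle `φ` for the overlaps of two tips of type (c). -/
theorem arrow_mul_cEval_of_isArrow' {φ : Γ.Tip V₁ → Γ.Alg k} (hφ : φ ∈ Γ.cocycle2 k V₁) {x : H}
    (hx : Γ.IsArrow' V₁ x) (hy : Γ.IsArrow' V₁ (Γ.σ (Γ.ι x)))
    (hz : Γ.IsArrow' V₁ (Γ.σ (Γ.ι (Γ.σ (Γ.ι x))))) :
    Γ.arrow k x * Γ.cEval k V₁ (Γ.σ (Γ.ι x)) φ =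
      Γ.cEval k V₁ x φ * Γ.arrow k (Γ.σ (Γ.ι (Γ.σ (Γ.ι x)))) := by
  rw [Γ.cEval_apply k hx hy, Γ.cEval_apply k hy hz]
  set y := Γ.σ (Γ.ι x) with hy'
  set z := Γ.σ (Γ.ι y) with hz'
  have key := hφ.2 (Finsupp.single (.c y z hy hz (Γ.src_eq_tgt_σ_ι y) (Γ.σ_ι_ne y))
      (Γ.arrow k x ⊗ₜ 1) - Finsupp.single (.c x y hx hy (Γ.src_eq_tgt_σ_ι x) (Γ.σ_ι_ne x))
      (1 ⊗ₜ Γ.arrow k z)) (by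
    rw [map_sub, boundary2_single, boundary2_single, relBim, relBim, map_add, map_add, act_single,
      act_single, act_single, act_single, Γ.arrow_mul_arrow_of_ne k (Γ.σ_ι_ne x),
      Γ.arrow_mul_arrow_of_ne k (Γ.σ_ι_ne y), TensorProduct.zero_tmul, TensorProduct.tmul_zero,
      Finsupp.single_zero, Finsupp.single_zero, ← Γ.src_eq_tgt_σ_ι x, arrow_mul_idem_src, one_mul,
      mul_one, Γ.src_eq_tgt_σ_ι y, idem_tgt_mul_arrow, add_zero, zero_add, sub_self])
  rw [map_sub, bimoduleMap_single, bimoduleMap_single, mul_one, one_mul, sub_eq_zero] at key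
  exact key

/-- For a removed loop `x` the arrow is a socle element, so the left-hand side is governed by τ. It
vanishes because the value on the tip is not closed: otherwise the third arrow would be `x` itself,
contrary to `hz`. -/
theorem arrow_mul_cEval (hbip : Γ.IsBipartition V₁) {φ : Γ.Tip V₁ → Γ.Alg k}
    (hφ : φ ∈ Γ.cocycle2 k V₁) {x : H} (hy : Γ.IsArrow' V₁ (Γ.σ (Γ.ι x)))
    (hz : Γ.IsArrow' V₁ (Γ.σ (Γ.ι (Γ.σ (Γ.ι x))))) :
    Γ.arrow k x * Γ.cEval k V₁ (Γ.σ (Γ.ι x)) φ =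
      Γ.cEval k V₁ x φ * Γ.arrow k (Γ.σ (Γ.ι (Γ.σ (Γ.ι x)))) := by
  by_cases hx : Γ.IsArrow' V₁ x
  · exact Γ.arrow_mul_cEval_of_isArrow' k hφ hx hy hz
  rw [Γ.cEval_of_left k hx, LinearMap.zero_apply, zero_mul]
  have hV : Γ.s x ∈ V₁ := by
    by_contra h
    exact hx (Γ.isArrow'_of_not_mem h)
  have hlen : Γ.len x = 1 := by
    have h1 := Γ.len_pos x
    have h2 := mt (Γ.isArrow'_iff_of_mem hV).2 hx
    omega
  have hσ : Γ.σ x = x := Γ.σ_eq_self_iff.2 (Γ.len_eq_one_iff.1 hlen).2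
  rw [← P_one, ← hlen, P_len_mul, coef_zero]
  rw [Γ.τ_eq_zero_of_idem k (i := Γ.tgt x) (j := Γ.src (Γ.σ (Γ.ι (Γ.σ (Γ.ι x))))), zero_smul]
  · rw [← mul_assoc, idem_tgt_mul_P]
  · rw [mul_assoc, Γ.cEval_mul_idem k hφ.1]
  · intro e
    rw [eq_comm, Γ.src_eq_tgt_iff_of_mem hbip] at e
    · have := Γ.σ_injective (e.symm.trans hσ.symm)
      rw [this] at hz
      exact hx hz
    · rw [s_ι_σ_mem_iff _ hbip, s_ι_σ_mem_iff _ hbip, not_not]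

theorem arrow_mul_P_eq {x y : H} {n : ℕ} (h : n = 0 → (Γ.src y = Γ.tgt x ↔ x = Γ.σ y)) :
    Γ.arrow k y * Γ.P k x n = if Γ.σ y = x then Γ.P k y (n + 1) else 0 := by
  split_ifs with e
  · rw [← e, arrow_mul_P]
  · cases n with
    | zero =>
      rw [P_zero, arrow_mul_idem, if_neg]
      rw [h rfl]
      exact Ne.symm e
    | succ n => exact Γ.arrow_mul_P_of_ne k e n

theorem P_mul_arrow_eq {x y : H} {n : ℕ} (h : n = 0 → (Γ.tgt x = Γ.tgt y ↔ y = x)) :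
    Γ.P k x n * Γ.arrow k y = if Γ.σ^[n] x = y then Γ.P k x (n + 1) else 0 := by
  split_ifs with e
  · rw [← e, P_mul_arrow]
  · cases n with
    | zero =>
      rw [P_zero, idem_mul_arrow, if_neg]
      rw [h rfl]
      exact Ne.symm e
    | succ n => rw [← P_one, Γ.P_mul_P_of_ne k (Nat.succ_pos _) one_pos e]

theorem coef_succ_mul_arrow {x y : H} (h : Γ.src y = Γ.tgt x ↔ x = Γ.σ y) {l : ℕ}
    (hl : l < Γ.len x) (u : Γ.Alg k) : Γ.coef k x (l + 1) (u * Γ.arrow k y) =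
      if Γ.σ^[l] x = y then Γ.coef k x l u else 0 := by
  rw [coef_apply', mul_assoc, arrow_mul_P_eq, Function.iterate_succ_apply']
  · have : Γ.σ y = Γ.σ (Γ.σ^[l] x) ↔ Γ.σ^[l] x = y :=
      ⟨fun h => (Γ.σ_injective h).symm, fun h => by rw [h]⟩
    simp only [this]
    split_ifs with e
    · rw [coef_apply', e]
      congr 3
      omega
    · rw [mul_zero, map_zero]
  · intro h0
    have : l + 1 = Γ.len x := by omega
    rw [this, σ_iterate_len]
    exact h

/-- The two divisions are sums of the same terms `f l`, over `0 ≤ l < len x` and over `0 < l ≤ len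
x`. The corrections are the end terms `f (len x)` and `f 0`, which occur only for `x = y`. -/
theorem leftDiv_mul_arrow {x y : H} (h : Γ.src y = Γ.tgt x ↔ x = Γ.σ y)
    (h' : Γ.src x = Γ.tgt y ↔ y = Γ.σ x) (u : Γ.Alg k) :
    Γ.leftDiv k x (u * Γ.arrow k y) +
        (if x = y then Γ.τ k (Γ.idem k (Γ.tgt x) * u) • Γ.P k (Γ.σ x) (Γ.len x) else 0) =
      Γ.leftDiv k x u * Γ.arrow k y +
        (if x = y then Γ.coef k x 0 u • Γ.idem k (Γ.src x) else 0) := by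
  set f : ℕ → Γ.Alg k := fun l => if Γ.σ^[l] x = y then Γ.coef k x l u • Γ.P k (Γ.σ x) l else 0
    with hf
  have h1 : Γ.leftDiv k x (u * Γ.arrow k y) = ∑ l ∈ Finset.range (Γ.len x), f l := by
    rw [leftDiv_apply]
    refine Finset.sum_congr rfl fun l hl => ?_
    rw [Γ.coef_succ_mul_arrow k h (Finset.mem_range.1 hl), hf]
    simp only [ite_smul, zero_smul]
  have h2 : Γ.leftDiv k x u * Γ.arrow k y = ∑ l ∈ Finset.range (Γ.len x), f (l + 1) := by
    rw [leftDiv_apply, Finset.sum_mul]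
    refine Finset.sum_congr rfl fun l _ => ?_
    rw [smul_mul_assoc, P_mul_arrow_eq, hf, ← Function.iterate_succ_apply]
    · simp only [smul_ite, smul_zero]
    · intro _
      rw [tgt_σ, h']
  have h3 : f (Γ.len x) = if x = y then Γ.τ k (Γ.idem k (Γ.tgt x) * u) •
      Γ.P k (Γ.σ x) (Γ.len x) else 0 := by
    simp only [hf, σ_iterate_len, coef_len]
  have h4 : f 0 = if x = y then Γ.coef k x 0 u • Γ.idem k (Γ.src x) else 0 := by
    simp only [hf, Function.iterate_zero_apply, P_zero, tgt_σ]
  rw [h1, h2, ← h3, ← h4, ← Finset.sum_range_succ, ← Finset.sum_range_succ']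

theorem leftDiv_mul_idem (x : H) (u : Γ.Alg k) (i : Γ.Edge) :
    Γ.leftDiv k x (u * Γ.idem k i) = Γ.leftDiv k x u * Γ.idem k i := by
  rw [leftDiv_apply, leftDiv_apply, Finset.sum_mul]
  refine Finset.sum_congr rfl fun l _ => ?_
  rw [smul_mul_assoc, P_mul_idem, coef_apply', mul_assoc, idem_mul_P, coef_apply',
    ← Function.iterate_succ_apply]
  split_ifs with h₁ h₂ h₂
  · rfl
  · exact absurd h₁.symm h₂
  · exact absurd h₂.symm h₁
  · rw [mul_zero, map_zero, zero_smul, smul_zero]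

theorem leftDiv_add_arrow_mul_leftDiv (x : H) (u : Γ.Alg k) :
    Γ.leftDiv k x (Γ.arrow k x * u) +
      Γ.arrow k (Γ.σ (Γ.ι x)) * Γ.leftDiv k (Γ.σ (Γ.ι x)) u = Γ.idem k (Γ.src x) * u := by
  have := Γ.idem_mul_eq k (Γ.σ x) u
  rw [tgt_σ, op_σ, len_σ] at this
  rw [leftDiv_arrow_mul, arrow_mul_leftDiv, this]

end CocycleConditions

/-! ### Left division as a 1-cochain that simplifies the values on the tips (c) -/

section Reduction

open scoped Classical

variable {V H : Type*} (Γ : BrauerGraph V H) (k : Type*) [Field k] [Finite H] {V₁ : Set V}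

theorem idem_src_mul_leftDiv (x : H) (u : Γ.Alg k) :
    Γ.idem k (Γ.src x) * Γ.leftDiv k x u = Γ.leftDiv k x u := by
  rw [leftDiv_apply, Finset.mul_sum, ← tgt_σ]
  simp only [mul_smul_comm, idem_tgt_mul_P]

variable (V₁) in
/-- A `1`-cochain whose coboundary agrees with `φ` on the tips of type (c), up to multiples of
trivial paths and of socle elements. -/
noncomputable def divCochain (φ : Γ.Tip V₁ → Γ.Alg k) (y : H) : Γ.Alg k :=
  Γ.leftDiv k (Γ.ι (Γ.ρ y)) (Γ.cEval k V₁ (Γ.ι (Γ.ρ y)) φ) -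
    if Γ.s y ∈ V₁ then Γ.τ k (Γ.cEval k V₁ (Γ.ι (Γ.ρ y)) φ) •
      Γ.P k (Γ.σ (Γ.ι (Γ.ρ y))) (Γ.len (Γ.ι (Γ.ρ y)) - 1) else 0

theorem divCochain_σ_ι (φ : Γ.Tip V₁ → Γ.Alg k) (x : H) :
    Γ.divCochain k V₁ φ (Γ.σ (Γ.ι x)) = Γ.leftDiv k x (Γ.cEval k V₁ x φ) -
      if Γ.s (Γ.σ (Γ.ι x)) ∈ V₁ then
        Γ.τ k (Γ.cEval k V₁ x φ) • Γ.P k (Γ.σ x) (Γ.len x - 1) else 0 := by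
  rw [divCochain, ρ_σ, ι_ι]

theorem exists_σ_ι_eq (y : H) : ∃ x, Γ.σ (Γ.ι x) = y :=
  ⟨Γ.ι (Γ.ρ y), by rw [ι_ι, σ_ρ]⟩

theorem divCochain_mem {φ : Γ.Tip V₁ → Γ.Alg k} (hφ : φ ∈ Γ.cochain2 k V₁) :
    Γ.divCochain k V₁ φ ∈ Γ.cochain1 k V₁ := by
  constructor
  · intro y
    obtain ⟨x, rfl⟩ := Γ.exists_σ_ι_eq y
    have h1 : (Γ.τ k (Γ.cEval k V₁ x φ) • Γ.P k (Γ.σ x) (Γ.len x - 1)) *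
        Γ.idem k (Γ.src (Γ.σ (Γ.ι x))) =
        Γ.τ k (Γ.cEval k V₁ x φ) • Γ.P k (Γ.σ x) (Γ.len x - 1) := by
      rw [smul_mul_assoc, P_mul_idem, σ_iterate_len_pred]
      split_ifs with e
      · rfl
      · rw [Γ.τ_eq_zero_of_idem k (Γ.idem_mul_cEval k hφ x) (Γ.cEval_mul_idem k hφ x) e, zero_smul,
          zero_smul]
    rw [divCochain_σ_ι, ← src_eq_tgt_σ_ι, mul_sub, sub_mul, idem_src_mul_leftDiv,
      ← leftDiv_mul_idem, Γ.cEval_mul_idem k hφ]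
    split_ifs
    · rw [mul_smul_comm, ← tgt_σ, idem_tgt_mul_P, h1]
    · rw [mul_zero, zero_mul]
  · intro y hy
    obtain ⟨x, rfl⟩ := Γ.exists_σ_ι_eq y
    rw [divCochain_σ_ι, Γ.cEval_of_right k hy, LinearMap.zero_apply, map_zero, map_zero, zero_smul,
      ite_self, sub_zero]

theorem cEval_d1 {ψ : H → Γ.Alg k} (hψ : ψ ∈ Γ.cochain1 k V₁) {x : H} (hx : Γ.IsArrow' V₁ x)
    (hy : Γ.IsArrow' V₁ (Γ.σ (Γ.ι x))) : Γ.cEval k V₁ x (Γ.d1 k V₁ ψ) =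
      ψ x * Γ.arrow k (Γ.σ (Γ.ι x)) + Γ.arrow k x * ψ (Γ.σ (Γ.ι x)) := by
  rw [Γ.cEval_apply k hx hy, Γ.d1_eq k hψ, relBim, map_add, evalBim_single, evalBim_single,
    Γ.idem_mul_of_mem_cochain1 k hψ, mul_assoc, Γ.mul_idem_of_mem_cochain1 k hψ]

/-- Dividing by the two arrows starting points of the expansion splits an element into two parts
(`leftDiv_add_arrow_mul_leftDiv`), so the coboundary reproduces the value up to the end terms of
`leftDiv_mul_arrow`. These occur only at bigons. The τ-term of `divCochain` concentrates the socle
contribution on the order βα with β around V₂, where it becomes a difference of traces. -/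
theorem cEval_sub_d1_divCochain (hbip : Γ.IsBipartition V₁) {φ : Γ.Tip V₁ → Γ.Alg k}
    (hφ : φ ∈ Γ.cocycle2 k V₁) {w : H} (hx : Γ.IsArrow' V₁ (Γ.σ (Γ.ι w)))
    (hy : Γ.IsArrow' V₁ (Γ.σ (Γ.ι (Γ.σ (Γ.ι w))))) :
    Γ.cEval k V₁ (Γ.σ (Γ.ι w)) (φ - Γ.d1 k V₁ (Γ.divCochain k V₁ φ)) =
      if w = Γ.σ (Γ.ι (Γ.σ (Γ.ι w))) then
        Γ.coef k w 0 (Γ.cEval k V₁ w φ) • Γ.idem k (Γ.src w) +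
          if Γ.s w ∈ V₁ then (Γ.τ k (Γ.cEval k V₁ (Γ.σ (Γ.ι w)) φ) -
            Γ.τ k (Γ.cEval k V₁ w φ)) • Γ.P k (Γ.σ w) (Γ.len w) else 0
      else 0 := by
  have hs : Γ.s w ∈ V₁ ↔ Γ.s (Γ.σ (Γ.ι (Γ.σ (Γ.ι w)))) ∈ V₁ := by
    rw [s_ι_σ_mem_iff _ hbip, s_ι_σ_mem_iff _ hbip, not_not]
  have hsx : Γ.s (Γ.σ (Γ.ι w)) ∈ V₁ ↔ Γ.s w ∉ V₁ := Γ.s_ι_σ_mem_iff hbip w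
  rw [map_sub, Γ.cEval_d1 k (Γ.divCochain_mem k hφ.1) hx hy, divCochain_σ_ι, divCochain_σ_ι]
  have h1 := Γ.arrow_mul_cEval k hbip hφ hx hy
  have h2 := Γ.leftDiv_add_arrow_mul_leftDiv k w (Γ.cEval k V₁ (Γ.σ (Γ.ι w)) φ)
  have hL := Γ.leftDiv_mul_arrow k (Γ.src_eq_tgt_iff_of_mem hbip hs.symm)
    (Γ.src_eq_tgt_iff_of_mem hbip hs) (Γ.cEval k V₁ w φ)
  have hP : Γ.P k (Γ.σ w) (Γ.len w - 1) * Γ.arrow k (Γ.σ (Γ.ι (Γ.σ (Γ.ι w)))) =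
      if w = Γ.σ (Γ.ι (Γ.σ (Γ.ι w))) then Γ.P k (Γ.σ w) (Γ.len w) else 0 := by
    rw [P_mul_arrow_eq, σ_iterate_len_pred, Nat.sub_add_cancel (Γ.len_pos w)]
    intro _
    rw [tgt_σ, Γ.src_eq_tgt_iff_of_mem hbip hs]
  have hP' : Γ.arrow k (Γ.σ (Γ.ι w)) * Γ.P k (Γ.σ (Γ.σ (Γ.ι w))) (Γ.len (Γ.σ (Γ.ι w)) - 1) =
      Γ.P k (Γ.σ w) (Γ.len w) := by
    rw [arrow_mul_P, Nat.sub_add_cancel (Γ.len_pos _), len_σ, P_len_σ_ι]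
  -- Away from bigons the value is not closed, so its trace vanishes.
  have hτ : w ≠ Γ.σ (Γ.ι (Γ.σ (Γ.ι w))) → Γ.τ k (Γ.cEval k V₁ (Γ.σ (Γ.ι w)) φ) = 0 := by
    intro hne
    refine Γ.τ_eq_zero_of_idem k (Γ.idem_mul_cEval k hφ.1 _) (Γ.cEval_mul_idem k hφ.1 _) ?_
    intro e
    rw [← src_eq_tgt_σ_ι, eq_comm] at e
    obtain e | e := Γ.edge_eq_iff.1 e
    · exact hne e
    · rw [← Γ.ι_ι (Γ.σ (Γ.ι (Γ.σ (Γ.ι w)))), ← e] at hs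
      exact iff_not_self (hs.symm.trans (hbip w))
  rw [Γ.idem_mul_cEval k hφ.1] at hL
  rw [h1, Γ.src_eq_tgt_σ_ι, Γ.idem_mul_cEval k hφ.1] at h2
  generalize Γ.σ (Γ.ι (Γ.σ (Γ.ι w))) = y at *
  generalize Γ.leftDiv k (Γ.σ (Γ.ι w)) _ = A at *
  generalize Γ.leftDiv k w (Γ.cEval k V₁ w φ * Γ.arrow k y) = C at *
  generalize Γ.τ k (Γ.cEval k V₁ (Γ.σ (Γ.ι w)) φ) = t at *
  rw [← h2]
  simp only [hsx, ← hs]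
  by_cases hV : Γ.s w ∈ V₁
  · simp only [hV, not_true_eq_false, if_true, if_false, sub_zero]
    rw [mul_sub, mul_smul_comm, hP']
    split_ifs at hL ⊢ with e
    · rw [sub_smul, eq_sub_of_add_eq hL]
      abel
    · rw [hτ e, eq_sub_of_add_eq hL]
      simp
  · simp only [hV, not_false_eq_true, if_true, if_false, sub_zero, add_zero]
    rw [sub_mul, smul_mul_assoc, hP]
    split_ifs at hL ⊢ with e
    · rw [eq_sub_of_add_eq hL]
      abel
    · rw [eq_sub_of_add_eq hL]
      simp

end Reduction

/-! ### The span of the standard cocycles, and removal of the values on the tips (c) -/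

section Reduction

open scoped Classical

variable {V H : Type*} (Γ : BrauerGraph V H) (k : Type*) [Field k] [Finite H] {V₁ : Set V}

instance : Finite (Γ.Bigon V₁) := Subtype.finite

/-- The span of the coboundaries and of the standard cocycles. -/
noncomputable def stdSpan (T : Set Γ.Edge) : Submodule k (Γ.Tip V₁ → Γ.Alg k) :=
  Γ.coboundary2 k V₁ ⊔ Submodule.span k (Set.range fun x : Γ.StdIndex V₁ T => Γ.stdCocycle k 1 x)

theorem stdCocycle_mem_stdSpan {T : Set Γ.Edge} (x : Γ.StdIndex V₁ T) :
    Γ.stdCocycle k 1 x ∈ Γ.stdSpan k T :=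
  Submodule.mem_sup_right (Submodule.subset_span ⟨x, rfl⟩)

theorem d1_mem_stdSpan {T : Set Γ.Edge} {ψ : H → Γ.Alg k} (hψ : ψ ∈ Γ.cochain1 k V₁) :
    Γ.d1 k V₁ ψ ∈ Γ.stdSpan k T :=
  Submodule.mem_sup_left ((Γ.mem_coboundary2 k V₁).2 ⟨ψ, hψ, rfl⟩)

theorem stdCocycle_mem (hconn : Γ.IsConnected) (hbip : Γ.IsBipartition V₁)
    (hloc : ¬ Γ.IsLocalBrauerTree) {T : Set Γ.Edge} (r : k) (x : Γ.StdIndex V₁ T) :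
    Γ.stdCocycle k r x ∈ Γ.cocycle2 k V₁ := by
  cases x with
  | A => exact Γ.stdA_mem k hbip r
  | B v i h₁ h₂ =>
    rw [stdCocycle]
    split_ifs
    · exact Γ.stdB₁_mem k hbip r v h₁
    · exact Γ.stdB₂_mem k hbip r v h₁
  | C j hj => exact Γ.stdC_mem k hbip r j
  | D₁ x => exact Γ.stdD₁_mem k hbip r (Γ.isBigon_of_mem hconn hbip hloc x) x.2.1
  | D₂ x => exact Γ.stdD₂_mem k hbip r (Γ.isBigon_of_mem hconn hbip hloc x) x.2.1

theorem stdSpan_le (hconn : Γ.IsConnected) (hbip : Γ.IsBipartition V₁)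
    (hloc : ¬ Γ.IsLocalBrauerTree) (T : Set Γ.Edge) :
    Γ.stdSpan k T ≤ Γ.cocycle2 k V₁ := by
  refine sup_le (Γ.coboundary2_le_cocycle2 k V₁) (Submodule.span_le.2 ?_)
  rintro _ ⟨x, rfl⟩
  exact Γ.stdCocycle_mem k hconn hbip hloc 1 x

/-- Compare the coefficients of α in the overlap relation for αβα. This is why trivial paths at a
bigon contribute one parameter and not two. -/
theorem coef_zero_cEval_eq {φ : Γ.Tip V₁ → Γ.Alg k} (hbip : Γ.IsBipartition V₁)
    (hφ : φ ∈ Γ.cocycle2 k V₁) {α β : H} (e : Γ.IsBigon α β) :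
    Γ.coef k α 0 (Γ.cEval k V₁ α φ) = Γ.coef k β 0 (Γ.cEval k V₁ β φ) := by
  have h := Γ.arrow_mul_cEval k hbip hφ (x := α)
  rw [e.σ_ι_left, e.σ_ι_right] at h
  have h := congrArg (Γ.coef k α 1) (h (Γ.isArrow'_of_lt e.len_right) (Γ.isArrow'_of_lt e.len_left))
  rw [Γ.coef_succ_arrow_mul k (Γ.len_pos α), Γ.coef_succ_mul_arrow k
    (Γ.src_eq_tgt_iff_of_mem hbip Iff.rfl) (Γ.len_pos α), if_pos (Function.iterate_zero_apply _ _),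
    ← e.op_eq, coef_zero_op] at h
  exact h.symm

theorem exists_cEval_sub_eq_zero (hconn : Γ.IsConnected) (hbip : Γ.IsBipartition V₁)
    (hloc : ¬ Γ.IsLocalBrauerTree) (T : Set Γ.Edge) {φ : Γ.Tip V₁ → Γ.Alg k}
    (hφ : φ ∈ Γ.cocycle2 k V₁) : ∃ ω ∈ Γ.stdSpan k T, ∀ x, Γ.cEval k V₁ x (φ - ω) = 0 := by
  have := Fintype.ofFinite (Γ.Bigon V₁)
  -- The common coefficient of the trivial paths on αβ and βα goes with the first cocycle of type
  -- (D), the difference of the traces with the second.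
  set f : Γ.Bigon V₁ → Γ.Tip V₁ → Γ.Alg k := fun b =>
    Γ.coef k b.1 0 (Γ.cEval k V₁ b.1 φ) • Γ.stdD₁ k 1 (Γ.ι (Γ.ρ b.1)) b.1 +
      (Γ.τ k (Γ.cEval k V₁ b.1 φ) - Γ.τ k (Γ.cEval k V₁ (Γ.ι (Γ.ρ b.1)) φ)) •
        Γ.stdD₂ k 1 (Γ.ι (Γ.ρ b.1)) b.1 with hf
  refine ⟨Γ.d1 k V₁ (Γ.divCochain k V₁ φ) + ∑ b, f b, add_mem
    (Γ.d1_mem_stdSpan k (Γ.divCochain_mem k hφ.1)) (sum_mem fun b _ => add_mem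
      (Submodule.smul_mem _ _ (Γ.stdCocycle_mem_stdSpan k (.D₁ b)))
      (Submodule.smul_mem _ _ (Γ.stdCocycle_mem_stdSpan k (.D₂ b)))), fun x => ?_⟩
  by_cases hx : Γ.IsArrow' V₁ x
  swap
  · rw [Γ.cEval_of_left k hx, LinearMap.zero_apply]
  by_cases hy : Γ.IsArrow' V₁ (Γ.σ (Γ.ι x))
  swap
  · rw [Γ.cEval_of_right k hy, LinearMap.zero_apply]
  obtain ⟨w, rfl⟩ := Γ.exists_σ_ι_eq x
  have hb : ∀ b : Γ.Bigon V₁, Γ.IsBigon (Γ.ι (Γ.ρ b.1)) b.1 := Γ.isBigon_of_mem hconn hbip hloc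
  have hinj : ∀ a b, Γ.σ (Γ.ι a) = Γ.σ (Γ.ι b) → a = b := fun a b h =>
    Γ.ι_injective (Γ.σ_injective h)
  have hsx : Γ.s (Γ.σ (Γ.ι w)) ∈ V₁ ↔ Γ.s w ∉ V₁ := Γ.s_ι_σ_mem_iff hbip w
  have hα : ∀ b : Γ.Bigon V₁, Γ.s (Γ.ι (Γ.ρ b.1)) ∈ V₁ := fun b => by
    rw [hbip, ι_ι, s_ρ]
    exact b.2.1
  rw [← sub_sub, map_sub, Γ.cEval_sub_d1_divCochain k hbip hφ hx hy, map_sum, sub_eq_zero]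
  split_ifs with h₁ h₂
  · have e := Γ.isBigon_of_σ_ι hconn hbip hloc rfl h₁.symm
    have hρ : Γ.ι (Γ.ρ (Γ.σ (Γ.ι w))) = w := by rw [ρ_σ, ι_ι]
    rw [Finset.sum_eq_single ⟨Γ.σ (Γ.ι w), fun h => hsx.1 h h₂, by rw [hρ]; exact h₁.symm⟩]
    · simp only [hf, hρ, map_add, map_smul]
      rw [Γ.cEval_apply k hx hy (Γ.stdD₁ k 1 _ _), Γ.cEval_apply k hx hy (Γ.stdD₂ k 1 _ _), stdD₁,
        stdD₂, if_neg, if_pos ⟨rfl, h₁.symm⟩,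
        if_pos ⟨rfl, h₁.symm⟩, one_smul, one_smul, ev_fullCyc_eq, e.P_len k,
        Γ.coef_zero_cEval_eq k hbip hφ e, Γ.src_eq_tgt_σ_ι w]
      rintro ⟨h, -⟩
      rw [h] at hsx
      exact iff_not_self hsx
    · intro b _ hne
      have h3 : Γ.σ (Γ.ι w) ≠ Γ.ι (Γ.ρ b.1) := fun h => hsx.1 (h ▸ hα b) h₂
      have h4 : Γ.σ (Γ.ι w) ≠ b.1 := fun h => hne (Subtype.ext h.symm)
      simp only [hf, map_add, map_smul]
      rw [Γ.cEval_apply k hx hy (Γ.stdD₁ k 1 _ _), Γ.cEval_apply k hx hy (Γ.stdD₂ k 1 _ _), stdD₁,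
        stdD₂, if_neg fun h => h3 h.1,
        if_neg fun h => h4 h.1, if_neg fun h => h4 h.1, smul_zero, smul_zero, add_zero]
    · exact fun h => absurd (Finset.mem_univ _) h
  · have hρ : Γ.ι (Γ.ρ w) = Γ.σ (Γ.ι w) := by
      nth_rw 1 [h₁]
      rw [ρ_σ, ι_ι]
    have h5 : Γ.σ (Γ.ι w) ≠ w := fun h => by
      rw [h] at hsx
      exact iff_not_self hsx
    rw [Finset.sum_eq_single ⟨w, h₂, hρ.symm⟩]
    · simp only [hf, hρ, map_add, map_smul]
      rw [Γ.cEval_apply k hx hy (Γ.stdD₁ k 1 _ _), Γ.cEval_apply k hx hy (Γ.stdD₂ k 1 _ _), stdD₁,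
        stdD₂, if_pos ⟨rfl, h₁.symm⟩,
        if_neg fun h => h5 h.1, smul_zero, one_smul]
    · intro b _ hne
      have h3 : Γ.σ (Γ.ι w) ≠ b.1 := fun h => b.2.1 (h ▸ hsx.2 h₂)
      have h4 : Γ.σ (Γ.ι (Γ.σ (Γ.ι w))) ≠ b.1 := fun h => hne (Subtype.ext (h.symm.trans h₁.symm))
      simp only [hf, map_add, map_smul]
      rw [Γ.cEval_apply k hx hy (Γ.stdD₁ k 1 _ _), Γ.cEval_apply k hx hy (Γ.stdD₂ k 1 _ _), stdD₁,
        stdD₂, if_neg fun h => h4 h.2,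
        if_neg fun h => h3 h.1, if_neg fun h => h3 h.1, smul_zero, smul_zero, add_zero]
    · exact fun h => absurd (Finset.mem_univ _) h
  · refine (Finset.sum_eq_zero fun b _ => ?_).symm
    have h3 : ¬ (Γ.σ (Γ.ι w) = Γ.ι (Γ.ρ b.1) ∧ Γ.σ (Γ.ι (Γ.σ (Γ.ι w))) = b.1) := by
      rintro ⟨h, h'⟩
      refine h₁ (hinj _ _ ?_)
      rw [h', (hb b).σ_ι_right, h]
    have h4 : ¬ (Γ.σ (Γ.ι w) = b.1 ∧ Γ.σ (Γ.ι (Γ.σ (Γ.ι w))) = Γ.ι (Γ.ρ b.1)) := by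
      rintro ⟨h, h'⟩
      refine h₁ (hinj _ _ ?_)
      rw [h', (hb b).σ_ι_left, h]
    simp only [hf, map_add, map_smul]
    rw [Γ.cEval_apply k hx hy (Γ.stdD₁ k 1 _ _), Γ.cEval_apply k hx hy (Γ.stdD₂ k 1 _ _), stdD₁,
      stdD₂, if_neg h3, if_neg h4, if_neg h4,
      smul_zero, smul_zero, add_zero]

end Reduction

/-! ### Overlap relations for cocycles vanishing on the tips (c) -/

section Overlaps

open scoped Classical

variable {V H : Type*} (Γ : BrauerGraph V H) (k : Type*) [Field k] [Finite H] {V₁ : Set V}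

theorem isArrow'_congr {h h' : H} (e : Γ.s h = Γ.s h') (hh : Γ.IsArrow' V₁ h) :
    Γ.IsArrow' V₁ h' := by
  rw [IsArrow', ← e]
  exact hh

/-- In the derivative of the full cycle followed by `x`, every term except the one for the last
arrow `w` is annihilated, because `α_w α_x = 0`. -/
theorem act_P_relBim_c {w x : H} (hw : Γ.IsArrow' V₁ w) (hx : Γ.IsArrow' V₁ x)
    (hwx : Γ.src w = Γ.tgt x) (hσ : x ≠ Γ.σ w) :
    Γ.act k (Γ.P k (Γ.σ w) (Γ.len w - 1)) 1 (Γ.relBim k (.c w x hw hx hwx hσ)) =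
      Γ.act k 1 (Γ.arrow k x) (Γ.nab k (Γ.σ w) (Γ.len w)) +
        Finsupp.single x (Γ.P k (Γ.σ w) (Γ.len w) ⊗ₜ[k] Γ.idem k (Γ.src x)) := by
  obtain ⟨n, hn⟩ := Nat.exists_eq_succ_of_ne_zero (Γ.len_pos w).ne'
  have h1 := Γ.σ_iterate_len_pred w
  have h2 := Γ.P_mul_arrow k (Γ.σ w) n
  have h3 := Γ.P_mul_idem_tgt k (Γ.σ w) n
  rw [hn] at h1
  rw [show n.succ - 1 = n from rfl] at h1
  rw [h1] at h2 h3
  rw [hn, Nat.succ_eq_add_one, nab_succ', h1, Nat.add_sub_cancel, map_add, act_act, relBim, map_add,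
    act_single, act_single, act_single, Γ.arrow_mul_arrow_of_ne k hσ, act_zero_right, zero_add, hwx,
    idem_tgt_mul_arrow, h2, h3, one_mul, mul_one, mul_one]

/-- The overlap of a tip of type (c) with a tip of type (a), ending at the `V₂`-end. -/
theorem bEval_eq_neg_arrow_mul (hbip : Γ.IsBipartition V₁) {φ : Γ.Tip V₁ → Γ.Alg k}
    (hφ : φ ∈ Γ.cocycle2 k V₁) (hχ : ∀ x, Γ.cEval k V₁ x φ = 0) {x : H} (hx : Γ.s x ∉ V₁)
    (hx' : Γ.IsArrow' V₁ (Γ.ι x)) :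
    Γ.bEval k V₁ x φ = -(Γ.arrow k x * Γ.aEval k V₁ (Γ.ι x) φ) := by
  have hι : Γ.s (Γ.ι x) ∈ V₁ := by rwa [hbip, ι_ι]
  have hA := Γ.isArrow'_of_not_mem hx
  have hA' : Γ.IsArrow' V₁ (Γ.σ (Γ.ι x)) := Γ.isArrow'_congr (Γ.s_σ _).symm hx'
  obtain ⟨n, hn⟩ := Nat.exists_eq_succ_of_ne_zero (Γ.len_pos (Γ.ι x)).ne'
  -- The path `α_x` times the full V₁-cycle contains a tip (c) on the left and a tip (a) on the
  -- right. Reducing the latter produces `α_x` times the full V₂-cycle, which is the tip (b). The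
  -- two reductions give this element of the kernel of ∂₂.
  have key := hφ.2 (Finsupp.single (.b x hx) (1 ⊗ₜ 1) +
      Finsupp.single (.a (Γ.ι x) hι hx') (Γ.arrow k x ⊗ₜ 1) -
      Finsupp.single (.c x (Γ.σ (Γ.ι x)) hA hA' (Γ.src_eq_tgt_σ_ι x) (Γ.σ_ι_ne x))
        (1 ⊗ₜ Γ.P k (Γ.σ (Γ.σ (Γ.ι x))) n)) (by
    rw [map_sub, map_add, boundary2_single, boundary2_single, boundary2_single, ← act_relBim_c,
      act_one_one, relBim, relBim, ι_ι, nab_succ, map_sub, ← Nat.succ_eq_add_one, ← hn,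
      P_len_σ_ι]
    abel)
  rw [map_sub, map_add, bimoduleMap_single, bimoduleMap_single, bimoduleMap_single,
    ← Γ.cEval_apply k hA hA' φ, hχ, ← Γ.bEval_apply k hx φ, ← Γ.aEval_apply k hι hx' φ, mul_one,
    mul_one, mul_zero,
    zero_mul, sub_zero, one_mul] at key
  exact eq_neg_of_add_eq_zero_left key

/-- The overlap of a tip of type (a) with a tip of type (c), starting at the `V₂`-end. -/
theorem bEval_eq_neg_mul_arrow (hbip : Γ.IsBipartition V₁) {φ : Γ.Tip V₁ → Γ.Alg k}
    (hφ : φ ∈ Γ.cocycle2 k V₁) (hχ : ∀ x, Γ.cEval k V₁ x φ = 0) {h : H} (hh : Γ.s h ∈ V₁)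
    (hh' : Γ.IsArrow' V₁ h) : Γ.bEval k V₁ (Γ.σ (Γ.ι h)) φ =
      -(Γ.aEval k V₁ h φ * Γ.arrow k (Γ.σ (Γ.ι h))) := by
  have hy : Γ.s (Γ.σ (Γ.ι h)) ∉ V₁ := by rw [s_ι_σ_mem_iff _ hbip, not_not]; exact hh
  have hA' := Γ.isArrow'_of_not_mem hy
  have key := hφ.2 (Finsupp.single (.a h hh hh') (1 ⊗ₜ Γ.arrow k (Γ.σ (Γ.ι h))) +
      Finsupp.single (.b (Γ.σ (Γ.ι h)) hy) (1 ⊗ₜ 1) -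
      Finsupp.single (.c h (Γ.σ (Γ.ι h)) hh' hA' (Γ.src_eq_tgt_σ_ι h) (Γ.σ_ι_ne h))
        (Γ.P k (Γ.σ h) (Γ.len h - 1) ⊗ₜ 1)) (by
    rw [map_sub, map_add, boundary2_single, boundary2_single, boundary2_single, act_P_relBim_c,
      act_one_one, relBim, relBim, nab_succ', map_sub, σ_iterate_len, len_σ, P_len_σ_ι]
    abel)
  rw [map_sub, map_add, bimoduleMap_single, bimoduleMap_single, bimoduleMap_single,
    ← Γ.cEval_apply k hh' hA' φ, hχ, ← Γ.bEval_apply k hy φ, ← Γ.aEval_apply k hh hh' φ, mul_one,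
    mul_one, mul_zero,
    sub_zero, one_mul, one_mul] at key
  exact eq_neg_of_add_eq_zero_right key

/-- The overlap is the path of `len x + 1` arrows, which begins and ends with a tip of type (a).
Both reductions yield a full V₂-cycle next to `α_x`, on which tips of type (c) apply. -/
theorem aEval_mul_arrow (hbip : Γ.IsBipartition V₁) {φ : Γ.Tip V₁ → Γ.Alg k}
    (hφ : φ ∈ Γ.cocycle2 k V₁) (hχ : ∀ x, Γ.cEval k V₁ x φ = 0) {x : H} (hx : Γ.s x ∈ V₁)
    (hx' : Γ.IsArrow' V₁ x) :
    Γ.aEval k V₁ (Γ.ρ x) φ * Γ.arrow k x = Γ.arrow k x * Γ.aEval k V₁ x φ := by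
  have hρ : Γ.s (Γ.ρ x) ∈ V₁ := by rwa [s_ρ]
  have hρ' : Γ.IsArrow' V₁ (Γ.ρ x) := Γ.isArrow'_congr (Γ.s_ρ _).symm hx'
  have hw : Γ.IsArrow' V₁ (Γ.ι (Γ.ρ x)) := Γ.isArrow'_of_not_mem ((hbip _).1 hρ)
  have hy : Γ.IsArrow' V₁ (Γ.σ (Γ.ι x)) := Γ.isArrow'_of_not_mem (by
    rw [s_ι_σ_mem_iff _ hbip, not_not]; exact hx)
  have hwx : Γ.σ (Γ.ι (Γ.ι (Γ.ρ x))) = x := by rw [ι_ι, σ_ρ]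
  obtain ⟨n, hn⟩ := Nat.exists_eq_succ_of_ne_zero (Γ.len_pos (Γ.ι x)).ne'
  have hx'' : Γ.IsArrow' V₁ (Γ.σ (Γ.ι (Γ.ι (Γ.ρ x)))) := by rwa [hwx]
  have h1 := Γ.σ_ι_ne (Γ.ι (Γ.ρ x))
  have h2 := Γ.src_eq_tgt_σ_ι (Γ.ι (Γ.ρ x))
  have h3 := Γ.cEval_apply k hw hx'' φ
  simp only [hwx] at h1 h2 h3
  rw [hχ] at h3
  have h4 := Γ.P_len_σ_ι k (Γ.ρ x)
  rw [σ_ρ, ← Γ.len_σ (Γ.ρ x), σ_ρ] at h4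
  have h5 := Γ.nab_succ' k x (Γ.len x)
  rw [nab_succ, σ_iterate_len, ← P_len_σ_ι] at h5
  have key := hφ.2 (Finsupp.single (.a (Γ.ρ x) hρ hρ') (1 ⊗ₜ Γ.arrow k x) -
      Finsupp.single (.a x hx hx') (Γ.arrow k x ⊗ₜ 1) +
      Finsupp.single (.c (Γ.ι (Γ.ρ x)) x hw hx' h2 h1)
        (Γ.P k (Γ.σ (Γ.ι (Γ.ρ x))) (Γ.len (Γ.ι (Γ.ρ x)) - 1) ⊗ₜ 1) -
      Finsupp.single (.c x (Γ.σ (Γ.ι x)) hx' hy (Γ.src_eq_tgt_σ_ι x) (Γ.σ_ι_ne x))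
        (1 ⊗ₜ Γ.P k (Γ.σ (Γ.σ (Γ.ι x))) n)) (by
    rw [map_sub, map_add, map_sub, boundary2_single, boundary2_single, boundary2_single,
      boundary2_single, act_P_relBim_c, ← act_relBim_c, ← Nat.succ_eq_add_one, ← hn, h4,
      relBim, relBim, map_sub, map_sub, σ_ρ, ← Γ.len_σ (Γ.ρ x), σ_ρ, eq_sub_of_add_eq h5]
    abel)
  rw [map_sub, map_add, map_sub, bimoduleMap_single, bimoduleMap_single, bimoduleMap_single,
    bimoduleMap_single, ← Γ.cEval_apply k hx' hy φ, hχ, ← h3, ← Γ.aEval_apply k hx hx' φ,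
    ← Γ.aEval_apply k hρ hρ' φ, mul_one,
    mul_zero, mul_zero, zero_mul, zero_mul, sub_zero, add_zero, one_mul] at key
  exact sub_eq_zero.1 key

/-- The overlap of two tips of type (b) in the path of `len h + 2` arrows; the remaining terms of
the derivatives vanish since they contain a path longer than the full cycle. -/
theorem bEval_mul_arrow {φ : Γ.Tip V₁ → Γ.Alg k} (hφ : φ ∈ Γ.cocycle2 k V₁) {h : H}
    (hh : Γ.s h ∉ V₁) : Γ.bEval k V₁ h φ * Γ.arrow k (Γ.σ h) =
      Γ.arrow k h * Γ.bEval k V₁ (Γ.σ h) φ := by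
  have hσ : Γ.s (Γ.σ h) ∉ V₁ := by rwa [s_σ]
  have h1 := Γ.nab_succ' k h (Γ.len h + 1)
  have h2 := Γ.P_len_succ k (Γ.σ h)
  rw [len_σ] at h2
  rw [nab_succ, P_len_succ, h2, TensorProduct.tmul_zero, TensorProduct.zero_tmul,
    Finsupp.single_zero, Finsupp.single_zero, zero_add, add_zero, Function.iterate_succ_apply',
    σ_iterate_len] at h1
  have key := hφ.2 (Finsupp.single (.b h hh) (1 ⊗ₜ Γ.arrow k (Γ.σ h)) -
      Finsupp.single (.b (Γ.σ h) hσ) (Γ.arrow k h ⊗ₜ 1)) (by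
    rw [map_sub, boundary2_single, boundary2_single, relBim, relBim, len_σ, h1, sub_self])
  rw [map_sub, bimoduleMap_single, bimoduleMap_single, ← Γ.bEval_apply k hh φ,
    ← Γ.bEval_apply k hσ φ, mul_one, one_mul] at key
  exact sub_eq_zero.1 key

end Overlaps

/-! ### Coefficients of a cocycle around a vertex -/

section Coefficients

open scoped Classical

variable {V H : Type*} (Γ : BrauerGraph V H) (k : Type*) [Field k] [Finite H] {V₁ : Set V}

theorem eq_of_forall_σ {α : Type*} {F : H → α} {h h' : H} (e : Γ.s h = Γ.s h')
    (hF : ∀ x, Γ.s x = Γ.s h → F (Γ.σ x) = F x) : F h' = F h := by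
  obtain ⟨n, rfl⟩ := Γ.exists_σ_iterate_eq e
  clear e
  induction n with
  | zero => rfl
  | succ n ih => rw [Function.iterate_succ_apply', hF _ (Γ.s_σ_iterate n h), ih]

theorem len_congr {h h' : H} (e : Γ.s h = Γ.s h') : Γ.len h = Γ.len h' := by
  rw [len, len, e]

/-- Compare coefficients in `aEval_mul_arrow`. A path of `j + 1` arrows that ends with `x` as well
as beginning with it forces `j` to be a multiple of the valency, so only powers of the cycle survive
and their coefficients are constant around the vertex. -/
theorem coef_σ_aEval (hbip : Γ.IsBipartition V₁) {φ : Γ.Tip V₁ → Γ.Alg k}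
    (hφ : φ ∈ Γ.cocycle2 k V₁) (hχ : ∀ x, Γ.cEval k V₁ x φ = 0) {x : H} (hx : Γ.s x ∈ V₁)
    (hx' : Γ.IsArrow' V₁ x) {j : ℕ} (hj : j < Γ.len x) :
    Γ.coef k (Γ.σ x) j (Γ.aEval k V₁ x φ) =
      if Γ.σ^[j] x = x then Γ.coef k x j (Γ.aEval k V₁ (Γ.ρ x) φ) else 0 := by
  rw [← Γ.coef_succ_arrow_mul k hj, ← Γ.aEval_mul_arrow k hbip hφ hχ hx hx',
    Γ.coef_succ_mul_arrow k (Γ.src_eq_tgt_iff_of_mem hbip Iff.rfl) hj]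

theorem coef_σ_aEval_eq_zero (hbip : Γ.IsBipartition V₁) {φ : Γ.Tip V₁ → Γ.Alg k}
    (hφ : φ ∈ Γ.cocycle2 k V₁) (hχ : ∀ x, Γ.cEval k V₁ x φ = 0) {x : H} (hx : Γ.s x ∈ V₁)
    (hx' : Γ.IsArrow' V₁ x) {j : ℕ} (hj : j < Γ.len x) (hv : ¬ Γ.val (Γ.s x) ∣ j) :
    Γ.coef k (Γ.σ x) j (Γ.aEval k V₁ x φ) = 0 := by
  rw [Γ.coef_σ_aEval k hbip hφ hχ hx hx' hj, if_neg]
  rwa [σ_iterate_eq_self_iff]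

theorem coef_σ_aEval_congr (hbip : Γ.IsBipartition V₁) {φ : Γ.Tip V₁ → Γ.Alg k}
    (hφ : φ ∈ Γ.cocycle2 k V₁) (hχ : ∀ x, Γ.cEval k V₁ x φ = 0) {h h' : H} (hh : Γ.s h ∈ V₁)
    (hh' : Γ.IsArrow' V₁ h) (e : Γ.s h = Γ.s h') {j : ℕ} (hj : j < Γ.len h) :
    Γ.coef k (Γ.σ h') j (Γ.aEval k V₁ h' φ) = Γ.coef k (Γ.σ h) j (Γ.aEval k V₁ h φ) := by
  by_cases hv : Γ.val (Γ.s h) ∣ j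
  · refine Γ.eq_of_forall_σ (F := fun h => Γ.coef k (Γ.σ h) j (Γ.aEval k V₁ h φ)) e fun x hx => ?_
    have hx₁ : Γ.s (Γ.σ x) = Γ.s h := by rw [s_σ, hx]
    have := Γ.coef_σ_aEval k hbip hφ hχ (x := Γ.σ x) (hx₁ ▸ hh) (Γ.isArrow'_congr hx₁.symm hh')
      (Γ.len_congr hx₁ ▸ hj)
    rwa [if_pos (by rw [σ_iterate_eq_self_iff, hx₁]; exact hv), ρ_σ] at this
  · rw [Γ.coef_σ_aEval_eq_zero k hbip hφ hχ hh hh' hj hv,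
      Γ.coef_σ_aEval_eq_zero k hbip hφ hχ (e ▸ hh) (Γ.isArrow'_congr e hh') (Γ.len_congr e ▸ hj)
        (e ▸ hv)]

theorem coef_bEval_σ (hbip : Γ.IsBipartition V₁) {φ : Γ.Tip V₁ → Γ.Alg k}
    (hφ : φ ∈ Γ.cocycle2 k V₁) {h : H} (hh : Γ.s h ∉ V₁) {i : ℕ} (hi : i < Γ.len h) :
    Γ.coef k (Γ.σ h) (i + 1) (Γ.bEval k V₁ (Γ.σ h) φ) =
      if Γ.σ^[i] h = h then Γ.coef k h (i + 1) (Γ.bEval k V₁ h φ) else 0 := by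
  obtain hi' | hi' : i + 1 < Γ.len h ∨ i + 1 = Γ.len h := by omega
  · have hiff : Γ.σ^[i + 1] h = Γ.σ h ↔ Γ.σ^[i] h = h := by
      rw [Function.iterate_succ_apply']
      exact ⟨fun h => Γ.σ_injective h, fun h => by rw [h]⟩
    rw [← Γ.coef_succ_arrow_mul k hi', ← Γ.bEval_mul_arrow k hφ hh,
      Γ.coef_succ_mul_arrow k (Γ.src_eq_tgt_iff_of_mem hbip (by rw [s_σ])) hi']
    simp only [hiff]
  -- In the top degree the overlap relation gives no information. The coefficient is a trace, which
  -- vanishes unless the arrow is a loop, and for a loop there is nothing to compare.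
  · have hσ : Γ.s (Γ.σ h) = Γ.s h := Γ.s_σ h
    have key : ∀ x, Γ.s x = Γ.s h → Γ.σ x ≠ x → Γ.coef k x (i + 1) (Γ.bEval k V₁ x φ) = 0 := by
      intro x hx hne
      rw [hi', ← Γ.len_congr hx, coef_len, Γ.idem_mul_bEval k hφ.1,
        Γ.τ_eq_zero_of_idem k (Γ.idem_mul_bEval k hφ.1 x) (Γ.bEval_mul_idem k hφ.1 x)]
      intro e
      exact hne ((Γ.src_eq_tgt_iff_of_mem hbip Iff.rfl).1 e.symm).symm
    by_cases h1 : Γ.σ h = h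
    · rw [h1, if_pos (Function.iterate_fixed h1 i)]
    · rw [key _ hσ fun h => h1 (Γ.σ_injective h), key _ rfl h1, ite_self]

theorem coef_bEval_eq_zero (hbip : Γ.IsBipartition V₁) {φ : Γ.Tip V₁ → Γ.Alg k}
    (hφ : φ ∈ Γ.cocycle2 k V₁) {h : H} (hh : Γ.s h ∉ V₁) {i : ℕ} (hi : i < Γ.len h)
    (hv : ¬ Γ.val (Γ.s h) ∣ i) : Γ.coef k h (i + 1) (Γ.bEval k V₁ h φ) = 0 := by
  have hρ : Γ.s (Γ.ρ h) = Γ.s h := Γ.s_ρ h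
  have := Γ.coef_bEval_σ k hbip hφ (h := Γ.ρ h) (hρ ▸ hh) (Γ.len_congr hρ ▸ hi)
  rwa [σ_ρ, if_neg] at this
  rwa [σ_iterate_eq_self_iff, hρ]

theorem coef_bEval_congr (hbip : Γ.IsBipartition V₁) {φ : Γ.Tip V₁ → Γ.Alg k}
    (hφ : φ ∈ Γ.cocycle2 k V₁) {h h' : H} (hh : Γ.s h ∉ V₁) (e : Γ.s h = Γ.s h') {i : ℕ}
    (hi : i < Γ.len h) : Γ.coef k h' (i + 1) (Γ.bEval k V₁ h' φ) =
      Γ.coef k h (i + 1) (Γ.bEval k V₁ h φ) := by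
  by_cases hv : Γ.val (Γ.s h) ∣ i
  · refine Γ.eq_of_forall_σ (F := fun h => Γ.coef k h (i + 1) (Γ.bEval k V₁ h φ)) e fun x hx => ?_
    rw [Γ.coef_bEval_σ k hbip hφ (hx ▸ hh) (Γ.len_congr hx ▸ hi), if_pos]
    rw [σ_iterate_eq_self_iff, hx]
    exact hv
  · rw [Γ.coef_bEval_eq_zero k hbip hφ hh hi hv,
      Γ.coef_bEval_eq_zero k hbip hφ (e ▸ hh) (Γ.len_congr e ▸ hi) (e ▸ hv)]

theorem len_eq_one_of_not_isArrow' {x : H} (hx : ¬ Γ.IsArrow' V₁ x) :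
    Γ.len x = 1 ∧ Γ.σ x = x := by
  have hV : Γ.s x ∈ V₁ := by
    by_contra h
    exact hx (Γ.isArrow'_of_not_mem h)
  have hlen : Γ.len x = 1 := by
    have h1 := Γ.len_pos x
    have h2 := mt (Γ.isArrow'_iff_of_mem hV).2 hx
    omega
  exact ⟨hlen, Γ.σ_eq_self_iff.2 (Γ.len_eq_one_iff.1 hlen).2⟩

/-- The value is minus a product with the last factor an arrow around V₂, so no path around the
V₁-end can occur in it. If the V₁-end is truncated there is no such formula; the single coefficient
in question is then a trace, which vanishes because the graph does not consist of one edge. -/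
theorem bEval_eq_sum (hconn : Γ.IsConnected) (hbip : Γ.IsBipartition V₁)
    (hloc : ¬ Γ.IsLocalBrauerTree) {φ : Γ.Tip V₁ → Γ.Alg k} (hφ : φ ∈ Γ.cocycle2 k V₁)
    (hχ : ∀ x, Γ.cEval k V₁ x φ = 0) {h : H} (hh : Γ.s h ∉ V₁) :
    Γ.bEval k V₁ h φ = ∑ i ∈ Finset.range (Γ.len h),
      Γ.coef k h (i + 1) (Γ.bEval k V₁ h φ) • Γ.P k h (i + 1) := by
  obtain ⟨x, rfl⟩ := Γ.exists_σ_ι_eq h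
  have hx : Γ.s x ∈ V₁ := by rwa [s_ι_σ_mem_iff _ hbip, not_not] at hh
  have h1 := Γ.idem_mul_eq k (Γ.σ x) (Γ.bEval k V₁ (Γ.σ (Γ.ι x)) φ)
  rw [tgt_σ, src_eq_tgt_σ_ι, Γ.idem_mul_bEval k hφ.1, op_σ, Finset.sum_eq_zero, zero_add] at h1
  · exact h1
  intro j hj
  have hj := Finset.mem_range.1 hj
  suffices Γ.coef k (Γ.σ x) j (Γ.bEval k V₁ (Γ.σ (Γ.ι x)) φ) = 0 by rw [this, zero_smul]
  by_cases hx' : Γ.IsArrow' V₁ x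
  · rw [Γ.bEval_eq_neg_mul_arrow k hbip hφ hχ hx hx', map_neg, coef_apply', mul_assoc,
      Γ.arrow_mul_P_eq, if_neg, mul_zero, map_zero, neg_zero]
    · intro e
      have := congrArg Γ.s e
      rw [s_σ, s_σ_iterate, s_σ, s_σ] at this
      rw [s_σ, this] at hh
      exact hh hx
    · intro h0
      omega
  · obtain ⟨h2, h3⟩ := Γ.len_eq_one_of_not_isArrow' hx'
    obtain rfl : j = 0 := by rw [len_σ] at hj; omega
    rw [h3, coef_zero, Γ.τ_eq_zero_of_idem k (i := Γ.tgt x) (j := Γ.src (Γ.σ (Γ.ι x)))]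
    · rw [← mul_assoc, idem_tgt_mul_P]
    · rw [mul_assoc, Γ.bEval_mul_idem k hφ.1]
    · intro e
      rw [eq_comm, src_eq_tgt_iff] at e
      obtain e | e := e
      · have := congrArg Γ.s e
        rw [s_σ] at this
        rw [← this] at hh
        exact hh hx
      · have h4 : Γ.ι (Γ.σ (Γ.ι x)) = x := Γ.σ_injective (e.symm.trans h3.symm)
        have h5 : Γ.σ (Γ.ι x) = Γ.ι x := by rw [← Γ.ι_ι (Γ.σ (Γ.ι x)), h4]
        have := Γ.one_lt_len_of_leaves hconn hbip hloc h3 h5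
        omega

theorem coef_σ_ι_aEval (hbip : Γ.IsBipartition V₁) {φ : Γ.Tip V₁ → Γ.Alg k}
    (hφ : φ ∈ Γ.cocycle2 k V₁) (hχ : ∀ x, Γ.cEval k V₁ x φ = 0) {h : H} (hh : Γ.s h ∈ V₁)
    (hh' : Γ.IsArrow' V₁ h) {i : ℕ} (hi : i < Γ.len (Γ.ι h)) :
    Γ.coef k (Γ.σ (Γ.ι h)) i (Γ.aEval k V₁ h φ) =
      -Γ.coef k (Γ.ι h) (i + 1) (Γ.bEval k V₁ (Γ.ι h) φ) := by
  rw [Γ.bEval_eq_neg_arrow_mul k hbip hφ hχ ((hbip h).1 hh) (by rwa [ι_ι]), map_neg, neg_neg,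
    Γ.coef_succ_arrow_mul k hi, ι_ι]

/-- This coefficient is constant around a vertex of V₂. It is also minus the coefficient of the
trivial path in the value on a tip (a), which is constant around a vertex of V₁; a truncated vertex
of V₁ has only one half-edge. Connectedness does the rest. -/
theorem exists_coef_bEval_eq (hconn : Γ.IsConnected) (hbip : Γ.IsBipartition V₁)
    {φ : Γ.Tip V₁ → Γ.Alg k} (hφ : φ ∈ Γ.cocycle2 k V₁) (hχ : ∀ x, Γ.cEval k V₁ x φ = 0) :
    ∃ r : k, ∀ h, Γ.s h ∉ V₁ → Γ.coef k h 1 (Γ.bEval k V₁ h φ) = r := by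
  by_cases hex : ∃ h, Γ.s h ∉ V₁
  swap
  · exact ⟨0, fun h hh => absurd ⟨h, hh⟩ hex⟩
  obtain ⟨h₀, hh₀⟩ := hex
  refine ⟨Γ.coef k h₀ 1 (Γ.bEval k V₁ h₀ φ), fun h hh => ?_⟩
  refine Γ.vertex_induction hconn (v₀ := Γ.s h₀) (p := fun v => ∀ h, Γ.s h = v →
    ∀ y, Γ.s y ∉ V₁ → (y = h ∨ y = Γ.ι h) → Γ.coef k y 1 (Γ.bEval k V₁ y φ) =
      Γ.coef k h₀ 1 (Γ.bEval k V₁ h₀ φ)) ?_ ?_ (Γ.s h) h rfl h hh (Or.inl rfl)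
  · rintro h hs y hy (rfl | rfl)
    · exact Γ.coef_bEval_congr k hbip hφ hh₀ hs.symm (Γ.len_pos _)
    · rw [← hbip, hs] at hy
      exact absurd hy hh₀
  · intro h ih h' hs y hy hyh
    by_cases hh : Γ.s h ∈ V₁
    · have hι := (hbip h).1 hh
      obtain rfl | rfl := hyh
      · rw [Γ.coef_bEval_congr k hbip hφ hι hs.symm (Γ.len_pos _)]
        exact ih h rfl _ hι (Or.inr rfl)
      · rw [← hbip, hs] at hy
        exact absurd hy hι
    · have hι : Γ.s (Γ.ι h) ∈ V₁ := by rwa [hbip, ι_ι]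
      obtain rfl | rfl := hyh
      · rw [hs] at hy
        exact absurd hι hy
      rw [← ih h rfl h hh (Or.inl rfl)]
      by_cases hA : Γ.IsArrow' V₁ (Γ.ι h)
      · have h1 := Γ.coef_σ_ι_aEval k hbip hφ hχ (hs ▸ hι) (Γ.isArrow'_congr hs.symm hA)
          (Γ.len_pos _)
        have h2 := Γ.coef_σ_ι_aEval k hbip hφ hχ hι hA (Γ.len_pos _)
        rw [← op_σ, coef_zero_op, Γ.coef_σ_aEval_congr k hbip hφ hχ hι hA hs.symm (Γ.len_pos _),
          ← coef_zero_op, op_σ, h2, neg_inj, ι_ι] at h1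
        exact h1.symm
      · obtain ⟨-, h2⟩ := Γ.len_eq_one_of_not_isArrow' hA
        rw [Γ.eq_of_σ_eq_self h2 hs.symm, ι_ι]

end Coefficients

/-! ### Subtracting the cocycles of types (A) and (B) -/

section VertexCoefficients

open scoped Classical

variable {V H : Type*} (Γ : BrauerGraph V H) (k : Type*) [Field k] [Finite H] {V₁ : Set V}

theorem sum_range_mul_eq {M : Type*} [AddCommMonoid M] {m c : ℕ} (hc : 0 < c) {f : ℕ → M}
    (hf : ∀ j < m * c, ¬ c ∣ j → f j = 0) :
    ∑ j ∈ Finset.range (m * c), f j = ∑ i ∈ Finset.range m, f (i * c) := by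
  refine (Finset.sum_of_injOn (fun i => i * c) (fun i _ j _ h => Nat.eq_of_mul_eq_mul_right hc h)
    (fun i hi => ?_) (fun j hj hj' => ?_) fun i _ => rfl).symm
  · have hi : i < m := by simpa using hi
    simpa using Nat.mul_lt_mul_of_pos_right hi hc
  · have hj := Finset.mem_range.1 hj
    refine hf j hj ?_
    rintro ⟨i, rfl⟩
    refine hj' ⟨i, ?_, mul_comm _ _⟩
    rw [mul_comm c] at hj
    simpa using lt_of_mul_lt_mul_right hj (Nat.zero_le c)

variable (V₁) in
/-- The coefficients, in a cocycle `φ`, of the powers of the cycles around a vertex. -/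
noncomputable def vertexCoef (φ : Γ.Tip V₁ → Γ.Alg k) (v : V) (i : ℕ) : k :=
  let h := Function.surjInv Γ.s_surjective v
  if v ∈ V₁ then Γ.coef k (Γ.σ h) (i * Γ.val v) (Γ.aEval k V₁ h φ)
  else -Γ.coef k h (i * Γ.val v + 1) (Γ.bEval k V₁ h φ)

theorem mul_val_lt_len {h : H} {i : ℕ} (hi : i < Γ.m (Γ.s h)) :
    i * Γ.val (Γ.s h) < Γ.len h :=
  Nat.mul_lt_mul_of_pos_right hi (Γ.val_pos h)

theorem vertexCoef_of_mem (hbip : Γ.IsBipartition V₁) {φ : Γ.Tip V₁ → Γ.Alg k}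
    (hφ : φ ∈ Γ.cocycle2 k V₁) (hχ : ∀ x, Γ.cEval k V₁ x φ = 0) {h : H} (hh : Γ.s h ∈ V₁)
    (hh' : Γ.IsArrow' V₁ h) {i : ℕ} (hi : i < Γ.m (Γ.s h)) :
    Γ.coef k (Γ.σ h) (i * Γ.val (Γ.s h)) (Γ.aEval k V₁ h φ) =
      Γ.vertexCoef k V₁ φ (Γ.s h) i := by
  rw [vertexCoef, if_pos hh]
  exact (Γ.coef_σ_aEval_congr k hbip hφ hχ hh hh' (Function.surjInv_eq _ _).symm
    (Γ.mul_val_lt_len hi)).symm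

theorem vertexCoef_of_not_mem (hbip : Γ.IsBipartition V₁) {φ : Γ.Tip V₁ → Γ.Alg k}
    (hφ : φ ∈ Γ.cocycle2 k V₁) {h : H} (hh : Γ.s h ∉ V₁) {i : ℕ} (hi : i < Γ.m (Γ.s h)) :
    -Γ.coef k h (i * Γ.val (Γ.s h) + 1) (Γ.bEval k V₁ h φ) =
      Γ.vertexCoef k V₁ φ (Γ.s h) i := by
  rw [vertexCoef, if_neg hh, neg_inj]
  exact (Γ.coef_bEval_congr k hbip hφ hh (Function.surjInv_eq _ _).symm
    (Γ.mul_val_lt_len hi)).symm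

theorem bEval_eq_sum_vertexCoef (hconn : Γ.IsConnected) (hbip : Γ.IsBipartition V₁)
    (hloc : ¬ Γ.IsLocalBrauerTree) {φ : Γ.Tip V₁ → Γ.Alg k} (hφ : φ ∈ Γ.cocycle2 k V₁)
    (hχ : ∀ x, Γ.cEval k V₁ x φ = 0) {h : H} (hh : Γ.s h ∉ V₁) :
    Γ.bEval k V₁ h φ = -∑ i ∈ Finset.range (Γ.m (Γ.s h)),
      Γ.vertexCoef k V₁ φ (Γ.s h) i • Γ.P k h (i * Γ.val (Γ.s h) + 1) := by
  conv_lhs => rw [Γ.bEval_eq_sum k hconn hbip hloc hφ hχ hh, len]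
  rw [sum_range_mul_eq (Γ.val_pos h), ← Finset.sum_neg_distrib]
  · refine Finset.sum_congr rfl fun i hi => ?_
    rw [← Γ.vertexCoef_of_not_mem k hbip hφ hh (Finset.mem_range.1 hi), neg_smul, neg_neg]
  · intro j hj hv
    rw [Γ.coef_bEval_eq_zero k hbip hφ hh hj hv, zero_smul]

/-- The trivial path is the zeroth power of both cycles and is counted twice on the right, which the
extra summand on the left compensates. The coefficients on the V₂-side come from the tips (b). -/
theorem aEval_eq_sum_vertexCoef (hbip : Γ.IsBipartition V₁) {φ : Γ.Tip V₁ → Γ.Alg k}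
    (hφ : φ ∈ Γ.cocycle2 k V₁) (hχ : ∀ x, Γ.cEval k V₁ x φ = 0) {h : H} (hh : Γ.s h ∈ V₁)
    (hh' : Γ.IsArrow' V₁ h) :
    Γ.aEval k V₁ h φ + Γ.vertexCoef k V₁ φ (Γ.s (Γ.ι h)) 0 • Γ.idem k (Γ.edge h) =
      ∑ i ∈ Finset.range (Γ.m (Γ.s h)),
        Γ.vertexCoef k V₁ φ (Γ.s h) i • Γ.P k (Γ.σ h) (i * Γ.val (Γ.s h)) +
      (∑ i ∈ Finset.range (Γ.m (Γ.s (Γ.ι h))), Γ.vertexCoef k V₁ φ (Γ.s (Γ.ι h)) i •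
        Γ.P k (Γ.σ (Γ.ι h)) (i * Γ.val (Γ.s (Γ.ι h))) +
      Γ.τ k (Γ.aEval k V₁ h φ) • Γ.P k (Γ.σ h) (Γ.len h)) := by
  have hι := (hbip h).1 hh
  have h1 := Γ.idem_mul_eq k (Γ.σ h) (Γ.aEval k V₁ h φ)
  rw [tgt_σ, src, Γ.idem_mul_aEval k hφ.1, op_σ, len_σ, len_σ] at h1
  have h0 : Γ.coef k (Γ.σ (Γ.ι h)) 0 (Γ.aEval k V₁ h φ) =
      Γ.vertexCoef k V₁ φ (Γ.s (Γ.ι h)) 0 := by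
    rw [Γ.coef_σ_ι_aEval k hbip hφ hχ hh hh' (Γ.len_pos _),
      ← Γ.vertexCoef_of_not_mem k hbip hφ hι (Γ.m_pos _), zero_mul]
  have hP0 : Γ.P k (Γ.σ (Γ.ι h)) 0 = Γ.idem k (Γ.edge h) := by
    rw [P_zero, tgt_σ, src, edge_ι]
  conv_lhs => rw [h1]
  rw [add_assoc, ← h0, ← hP0, ← Finset.sum_range_succ' (fun j =>
    Γ.coef k (Γ.σ (Γ.ι h)) j (Γ.aEval k V₁ h φ) • Γ.P k (Γ.σ (Γ.ι h)) j), Finset.sum_range_succ]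
  congr 1
  · conv_lhs => rw [len]
    rw [sum_range_mul_eq (Γ.val_pos h)]
    · refine Finset.sum_congr rfl fun i hi => ?_
      rw [Γ.vertexCoef_of_mem k hbip hφ hχ hh hh' (Finset.mem_range.1 hi)]
    · intro j hj hv
      rw [Γ.coef_σ_aEval_eq_zero k hbip hφ hχ hh hh' hj hv, zero_smul]
  · congr 1
    · conv_lhs => rw [len]
      rw [sum_range_mul_eq (Γ.val_pos (Γ.ι h))]
      · refine Finset.sum_congr rfl fun i hi => ?_
        rw [Γ.coef_σ_ι_aEval k hbip hφ hχ hh hh' (Γ.mul_val_lt_len (Finset.mem_range.1 hi)),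
          Γ.vertexCoef_of_not_mem k hbip hφ hι (Finset.mem_range.1 hi)]
      · intro j hj hv
        rw [Γ.coef_σ_ι_aEval k hbip hφ hχ hh hh' hj, Γ.coef_bEval_eq_zero k hbip hφ hι hj hv,
          neg_zero, zero_smul]
    · rw [P_len_σ_ι, ← Γ.len_σ (Γ.ι h), coef_len, tgt_σ, src, edge_ι, Γ.idem_mul_aEval k hφ.1]

/-- The combination of the standard cocycles of types (A) and (B) with given coefficients. -/
noncomputable def vertexCocycle [Fintype V] (r : k) (c : V → ℕ → k) : Γ.Tip V₁ → Γ.Alg k :=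
  r • Γ.stdA k 1 + ∑ v, ∑ i ∈ Finset.Ico 1 (Γ.m v),
    c v i • if v ∈ V₁ then Γ.stdB₁ k 1 v i else Γ.stdB₂ k 1 v i

theorem vertexCocycle_mem [Fintype V] (r : k) (c : V → ℕ → k) (T : Set Γ.Edge) :
    Γ.vertexCocycle k r c ∈ Γ.stdSpan (V₁ := V₁) k T := by
  refine add_mem (Submodule.smul_mem _ _ (Γ.stdCocycle_mem_stdSpan k .A)) (sum_mem fun v _ =>
    sum_mem fun i hi => Submodule.smul_mem _ _ ?_)
  have hi := Finset.mem_Ico.1 hi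
  exact Γ.stdCocycle_mem_stdSpan k (.B v i hi.1 (by omega))

theorem aEval_vertexCocycle [Fintype V] (hbip : Γ.IsBipartition V₁) (r : k) (c : V → ℕ → k) {h : H}
    (hh : Γ.s h ∈ V₁) (hh' : Γ.IsArrow' V₁ h) :
    Γ.aEval k V₁ h (Γ.vertexCocycle k r c) = r • Γ.idem k (Γ.edge h) +
      (∑ i ∈ Finset.Ico 1 (Γ.m (Γ.s h)), c (Γ.s h) i • Γ.P k (Γ.σ h) (i * Γ.val (Γ.s h)) +
      ∑ i ∈ Finset.Ico 1 (Γ.m (Γ.s (Γ.ι h))), c (Γ.s (Γ.ι h)) i •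
        Γ.P k (Γ.σ (Γ.ι h)) (i * Γ.val (Γ.s (Γ.ι h)))) := by
  have hι := (hbip h).1 hh
  rw [vertexCocycle, map_add, map_smul, map_sum]
  congr 1
  · rw [Γ.aEval_apply k hh hh', stdA, one_smul]
  have key : ∀ v, Γ.aEval k V₁ h (∑ i ∈ Finset.Ico 1 (Γ.m v),
      c v i • if v ∈ V₁ then Γ.stdB₁ k 1 v i else Γ.stdB₂ k 1 v i) =
      (if Γ.s h = v then ∑ i ∈ Finset.Ico 1 (Γ.m v), c v i • Γ.P k (Γ.σ h) (i * Γ.val v) else 0) +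
      (if Γ.s (Γ.ι h) = v then ∑ i ∈ Finset.Ico 1 (Γ.m v),
        c v i • Γ.P k (Γ.σ (Γ.ι h)) (i * Γ.val v) else 0) := by
    intro v
    rw [map_sum]
    simp only [Γ.aEval_apply k hh hh', Pi.smul_apply]
    by_cases hv : v ∈ V₁
    · rw [if_neg (fun e : Γ.s (Γ.ι h) = v => hι (e ▸ hv)), add_zero]
      simp only [if_pos hv, stdB₁]
      split_ifs with e
      · refine Finset.sum_congr rfl fun i hi => ?_
        rw [one_smul, Γ.ev_cyc k (Finset.mem_Ico.1 hi).1, s_σ, e]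
      · simp
    · rw [if_neg (fun e : Γ.s h = v => hv (e ▸ hh)), zero_add]
      simp only [if_neg hv, stdB₂]
      split_ifs with e
      · refine Finset.sum_congr rfl fun i hi => ?_
        rw [one_smul, Γ.ev_cyc k (Finset.mem_Ico.1 hi).1, s_σ, e]
      · simp
  simp only [key]
  rw [Finset.sum_add_distrib, Finset.sum_ite_eq, Finset.sum_ite_eq, if_pos (Finset.mem_univ _),
    if_pos (Finset.mem_univ _)]

theorem bEval_vertexCocycle [Fintype V] (r : k) (c : V → ℕ → k) {h : H}
    (hh : Γ.s h ∉ V₁) : Γ.bEval k V₁ h (Γ.vertexCocycle k r c) = -(r • Γ.arrow k h +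
      ∑ i ∈ Finset.Ico 1 (Γ.m (Γ.s h)), c (Γ.s h) i • Γ.P k h (i * Γ.val (Γ.s h) + 1)) := by
  rw [vertexCocycle, map_add, map_smul, map_sum, neg_add]
  congr 1
  · rw [Γ.bEval_apply k hh, stdA, one_smul, smul_neg]
  have key : ∀ v, Γ.bEval k V₁ h (∑ i ∈ Finset.Ico 1 (Γ.m v),
      c v i • if v ∈ V₁ then Γ.stdB₁ k 1 v i else Γ.stdB₂ k 1 v i) =
      if Γ.s h = v then -∑ i ∈ Finset.Ico 1 (Γ.m v), c v i • Γ.P k h (i * Γ.val v + 1) else 0 := by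
    intro v
    rw [map_sum]
    simp only [Γ.bEval_apply k hh, Pi.smul_apply]
    by_cases hv : v ∈ V₁
    · rw [if_neg (fun e : Γ.s h = v => hh (e ▸ hv))]
      simp only [if_pos hv, stdB₁, smul_zero, Finset.sum_const_zero]
    · simp only [if_neg hv, stdB₂]
      split_ifs with e
      · rw [← Finset.sum_neg_distrib]
        refine Finset.sum_congr rfl fun i hi => ?_
        rw [one_smul, ev_cyc_append, e, smul_neg]
      · simp
  simp only [key]
  rw [Finset.sum_ite_eq, if_pos (Finset.mem_univ _)]

theorem cEval_vertexCocycle [Fintype V] (r : k) (c : V → ℕ → k) (x : H) :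
    Γ.cEval k V₁ x (Γ.vertexCocycle k r c) = 0 := by
  by_cases hx : Γ.IsArrow' V₁ x ∧ Γ.IsArrow' V₁ (Γ.σ (Γ.ι x))
  · rw [Γ.cEval_apply k hx.1 hx.2, vertexCocycle]
    simp only [Pi.add_apply, Pi.smul_apply, Finset.sum_apply, stdA, smul_zero, zero_add]
    refine Finset.sum_eq_zero fun v _ => Finset.sum_eq_zero fun i _ => ?_
    split_ifs
    · rw [stdB₁, smul_zero]
    · rw [stdB₂, smul_zero]
  · rw [cEval, dif_neg hx, LinearMap.zero_apply]

/-- All zeroth coefficients equal `-r`, and this is the coefficient of type (A); the exponents from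
1 to `m - 1` are those of type (B). Only the trace on the tips (a) is left. -/
theorem exists_sub_eq_socle [Finite V] (hconn : Γ.IsConnected) (hbip : Γ.IsBipartition V₁)
    (hloc : ¬ Γ.IsLocalBrauerTree) (T : Set Γ.Edge) {φ : Γ.Tip V₁ → Γ.Alg k}
    (hφ : φ ∈ Γ.cocycle2 k V₁) (hχ : ∀ x, Γ.cEval k V₁ x φ = 0) :
    ∃ ω ∈ Γ.stdSpan k T, (∀ x, Γ.cEval k V₁ x (φ - ω) = 0) ∧
      (∀ h, Γ.s h ∉ V₁ → Γ.bEval k V₁ h (φ - ω) = 0) ∧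
      ∃ κ : H → k, ∀ h, Γ.s h ∈ V₁ → Γ.IsArrow' V₁ h →
        Γ.aEval k V₁ h (φ - ω) = κ h • Γ.P k (Γ.σ h) (Γ.len h) := by
  have := Fintype.ofFinite V
  obtain ⟨r, hr⟩ := Γ.exists_coef_bEval_eq k hconn hbip hφ hχ
  set c := Γ.vertexCoef k V₁ φ with hc
  have hr₂ : ∀ h, Γ.s h ∉ V₁ → c (Γ.s h) 0 = -r := fun h hh => by
    rw [← hr h hh, hc, ← Γ.vertexCoef_of_not_mem k hbip hφ hh (Γ.m_pos _), zero_mul]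
  have hr₁ : ∀ h, Γ.s h ∈ V₁ → Γ.IsArrow' V₁ h → c (Γ.s h) 0 = -r := fun h hh hh' => by
    rw [hc, ← Γ.vertexCoef_of_mem k hbip hφ hχ hh hh' (Γ.m_pos _), zero_mul, ← coef_zero_op, op_σ,
      Γ.coef_σ_ι_aEval k hbip hφ hχ hh hh' (Γ.len_pos _), hr _ ((hbip h).1 hh)]
  have hsum : ∀ (h : H) (f : ℕ → Γ.Alg k), ∑ i ∈ Finset.range (Γ.m (Γ.s h)), f i =
      f 0 + ∑ i ∈ Finset.Ico 1 (Γ.m (Γ.s h)), f i := fun h f => by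
    rw [Finset.range_eq_Ico, Finset.sum_eq_sum_Ico_succ_bot (Γ.m_pos _)]
  refine ⟨Γ.vertexCocycle k (-r) c, Γ.vertexCocycle_mem k _ _ T, fun x => ?_, fun h hh => ?_,
    fun h => Γ.τ k (Γ.aEval k V₁ h φ), fun h hh hh' => ?_⟩
  · rw [map_sub, hχ, cEval_vertexCocycle, sub_zero]
  · rw [map_sub, Γ.bEval_vertexCocycle k _ _ hh,
      Γ.bEval_eq_sum_vertexCoef k hconn hbip hloc hφ hχ hh, hsum, ← hc, hr₂ h hh, zero_mul,
      zero_add, P_one, sub_self]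
  · have h1 := Γ.aEval_eq_sum_vertexCoef k hbip hφ hχ hh hh'
    rw [hsum, hsum, ← hc, hr₁ h hh hh', hr₂ _ ((hbip h).1 hh), zero_mul, zero_mul, P_zero, P_zero,
      tgt_σ, tgt_σ, src, src, edge_ι] at h1
    rw [map_sub, Γ.aEval_vertexCocycle k hbip _ _ hh hh', eq_sub_of_add_eq h1]
    abel

end VertexCoefficients

/-! ### Socle values, spanning trees and rescaling of arrows -/

section SpanningTree

open scoped Classical

variable {V H : Type*} (Γ : BrauerGraph V H) (k : Type*) [Field k] [Finite H] {V₁ : Set V}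

theorem card_add_one_of_isSpanningTree [Finite V] {T : Set Γ.Edge} (hT : Γ.IsSpanningTree T) :
    Nat.card T + 1 = Nat.card V := by
  have := Fintype.ofFinite V
  have h1 := hT.2.2.card_edgeFinset
  have h2 : (SimpleGraph.fromEdgeSet (Γ.ends '' T)).edgeSet = Γ.ends '' T := by
    rw [SimpleGraph.edgeSet_fromEdgeSet, sdiff_eq_left, Set.disjoint_left]
    rintro _ ⟨i, hi, rfl⟩
    exact hT.1 i hi
  rw [← SimpleGraph.coe_edgeFinset] at h2
  rw [Nat.card_eq_fintype_card (α := V), ← h1, ← Set.ncard_coe_finset, h2, hT.2.1.ncard_image]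
  rfl

theorem card_compl_add_card_of_isSpanningTree [Finite V] {T : Set Γ.Edge}
    (hT : Γ.IsSpanningTree T) :
    Nat.card {j : Γ.Edge // j ∉ T} + Nat.card V = Nat.card Γ.Edge + 1 := by
  have h1 := T.ncard_add_ncard_compl
  rw [← Γ.card_add_one_of_isSpanningTree hT, ← h1]
  change Tᶜ.ncard + (T.ncard + 1) = _
  omega

theorem eq_of_isSpanningTree {T : Set Γ.Edge} (hT : Γ.IsSpanningTree T) {α : Type*} {X : V → α}
    (hX : ∀ h, Γ.edge h ∈ T → X (Γ.s h) = X (Γ.s (Γ.ι h))) (v w : V) : X v = X w := by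
  obtain ⟨p⟩ := hT.2.2.connected.preconnected v w
  induction p with
  | nil => rfl
  | cons e _ ih =>
    refine Eq.trans ?_ ih
    rw [SimpleGraph.fromEdgeSet_adj] at e
    obtain ⟨⟨i, hiT, hi⟩, -⟩ := e
    obtain ⟨h, rfl⟩ := Γ.edge_surjective i
    have hi : s(Γ.s h, Γ.s (Γ.ι h)) = s(_, _) := hi
    rw [Sym2.eq_iff] at hi
    obtain ⟨rfl, rfl⟩ | ⟨rfl, rfl⟩ := hi
    · exact hX h hiT
    · exact (hX h hiT).symm

theorem exists_edge_eq_of_mem (hbip : Γ.IsBipartition V₁) (j : Γ.Edge) :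
    ∃ h, Γ.edge h = j ∧ Γ.s h ∈ V₁ := by
  obtain ⟨h, rfl⟩ := Γ.edge_surjective j
  by_cases hh : Γ.s h ∈ V₁
  · exact ⟨h, rfl, hh⟩
  · exact ⟨Γ.ι h, Γ.edge_ι h, by rwa [hbip, ι_ι]⟩

theorem eq_of_edge_eq (hbip : Γ.IsBipartition V₁) {h h' : H} (e : Γ.edge h = Γ.edge h')
    (hh : Γ.s h ∈ V₁) (hh' : Γ.s h' ∈ V₁) : h' = h := by
  obtain e | rfl := Γ.edge_eq_iff.1 e
  · exact e
  · exact absurd hh' ((hbip h).1 hh)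

/-- The difference map from functions on V to functions on T has only constants in its kernel, since
T is connected, and T has one element fewer than V. Hence it is surjective. -/
theorem exists_potential [Finite V] (hbip : Γ.IsBipartition V₁) {T : Set Γ.Edge}
    (hT : Γ.IsSpanningTree T) (κ : H → k) : ∃ X : V → k, ∀ h, Γ.s h ∈ V₁ → Γ.edge h ∈ T →
      X (Γ.s h) - X (Γ.s (Γ.ι h)) = κ h := by
  have := Fintype.ofFinite V
  have := Fintype.ofFinite T
  choose rep hrep hrep' using Γ.exists_edge_eq_of_mem hbip
  have hrep'' : ∀ h, Γ.s h ∈ V₁ → rep (Γ.edge h) = h := fun h hh =>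
    Γ.eq_of_edge_eq hbip (hrep _).symm hh (hrep' _)
  let L : (V → k) →ₗ[k] (T → k) := LinearMap.pi fun j =>
    LinearMap.proj (R := k) (φ := fun _ => k) (Γ.s (rep j.1)) -
      LinearMap.proj (R := k) (φ := fun _ => k) (Γ.s (Γ.ι (rep j.1)))
  have hL : ∀ X j, L X j = X (Γ.s (rep j.1)) - X (Γ.s (Γ.ι (rep j.1))) := fun X j => rfl
  obtain ⟨v₀⟩ := hT.2.2.connected.nonempty
  have hker : LinearMap.ker L ≤ Submodule.span k {fun _ => (1 : k)} := by
    intro X hX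
    have h1 : ∀ h, Γ.s h ∈ V₁ → Γ.edge h ∈ T → X (Γ.s h) = X (Γ.s (Γ.ι h)) := by
      intro h hh hT
      have := congrFun (LinearMap.mem_ker.1 hX) ⟨_, hT⟩
      rwa [hL, hrep'' h hh, Pi.zero_apply, sub_eq_zero] at this
    refine Submodule.mem_span_singleton.2 ⟨X v₀, ?_⟩
    funext v
    rw [Pi.smul_apply, smul_eq_mul, mul_one]
    refine Γ.eq_of_isSpanningTree hT (fun h hh => ?_) _ _
    by_cases hV : Γ.s h ∈ V₁
    · exact h1 h hV hh
    · have := h1 (Γ.ι h) (by rwa [hbip, ι_ι]) (by rwa [edge_ι])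
      rw [ι_ι] at this
      exact this.symm
  have hdim := L.finrank_range_add_finrank_ker
  have hker' : Module.finrank k (LinearMap.ker L) ≤ 1 :=
    (Submodule.finrank_mono hker).trans
      (finrank_span_singleton fun h => one_ne_zero (congrFun h v₀)).le
  have hcard := Γ.card_add_one_of_isSpanningTree hT
  rw [Module.finrank_pi, ← Nat.card_eq_fintype_card, ← hcard] at hdim
  have hle := Submodule.finrank_le (LinearMap.range L)
  rw [Module.finrank_pi, ← Nat.card_eq_fintype_card] at hle
  have hsurj : LinearMap.range L = ⊤ := Submodule.eq_top_of_finrank_eq (by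
    rw [Module.finrank_pi, ← Nat.card_eq_fintype_card]
    omega)
  obtain ⟨X, hX⟩ := LinearMap.range_eq_top.1 hsurj fun j => κ (rep j.1)
  refine ⟨X, fun h hh hh' => ?_⟩
  have := congrFun hX ⟨_, hh'⟩
  rwa [hL, hrep'' h hh] at this

variable (V₁) in
/-- The `1`-cochain that rescales the arrows around each vertex. -/
noncomputable def scaleCochain (X : V → k) (h : H) : Γ.Alg k :=
  if Γ.IsArrow' V₁ h then (X (Γ.s h) / Γ.len h) • Γ.arrow k h else 0

theorem scaleCochain_mem (X : V → k) : Γ.scaleCochain k V₁ X ∈ Γ.cochain1 k V₁ := by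
  refine ⟨fun h => ?_, fun h hh => if_neg hh⟩
  rw [scaleCochain]
  split_ifs
  · rw [mul_smul_comm, smul_mul_assoc, idem_tgt_mul_arrow, arrow_mul_idem_src]
  · rw [mul_zero, zero_mul]

theorem evalBim_scaleCochain (X : V → k) {h : H} (hh : Γ.IsArrow' V₁ h) (n : ℕ) :
    Γ.evalBim k (Γ.scaleCochain k V₁ X) (Γ.nab k h n) =
      (n * (X (Γ.s h) / Γ.len h)) • Γ.P k h n := by
  rw [evalBim_nab, Finset.sum_congr rfl (g := fun _ => (X (Γ.s h) / Γ.len h) • Γ.P k h n)]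
  · rw [Finset.sum_const, Finset.card_range, mul_smul, Nat.cast_smul_eq_nsmul]
  · intro j hj
    have hj := Finset.mem_range.1 hj
    rw [scaleCochain, if_pos (Γ.isArrow'_congr (Γ.s_σ_iterate j h).symm hh), s_σ_iterate,
      len_σ_iterate, mul_smul_comm, P_mul_arrow, smul_mul_assoc, P_mul_P]
    congr 2
    omega

/-- Each of the `len` arrows of the full cycle contributes the same multiple of it, which explains
the division by `len` in the cochain and the use of characteristic zero. -/
theorem aEval_d1_scaleCochain [CharZero k] (hbip : Γ.IsBipartition V₁) (X : V → k) {h : H}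
    (hh : Γ.s h ∈ V₁) (hh' : Γ.IsArrow' V₁ h) :
    Γ.aEval k V₁ h (Γ.d1 k V₁ (Γ.scaleCochain k V₁ X)) =
      (X (Γ.s h) - X (Γ.s (Γ.ι h))) • Γ.P k (Γ.σ h) (Γ.len h) := by
  have h1 : ∀ h, (Γ.len h : k) ≠ 0 := fun h => Nat.cast_ne_zero.2 (Γ.len_pos h).ne'
  have hι := Γ.isArrow'_of_not_mem ((hbip h).1 hh)
  rw [Γ.aEval_apply k hh hh', Γ.d1_eq k (Γ.scaleCochain_mem k X), relBim, map_sub,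
    Γ.evalBim_scaleCochain k X (Γ.isArrow'_congr (Γ.s_σ h).symm hh'),
    Γ.evalBim_scaleCochain k X (Γ.isArrow'_congr (Γ.s_σ _).symm hι), len_σ, len_σ, s_σ, s_σ,
    mul_div_cancel₀ _ (h1 _), mul_div_cancel₀ _ (h1 _), P_len_σ_ι, sub_smul]

theorem bEval_d1_scaleCochain (X : V → k) {h : H} (hh : Γ.s h ∉ V₁) :
    Γ.bEval k V₁ h (Γ.d1 k V₁ (Γ.scaleCochain k V₁ X)) = 0 := by
  rw [Γ.bEval_apply k hh, Γ.d1_eq k (Γ.scaleCochain_mem k X), relBim,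
    Γ.evalBim_scaleCochain k X (Γ.isArrow'_of_not_mem hh), P_len_succ, smul_zero]

theorem cEval_d1_scaleCochain (X : V → k) {x : H} (hx : Γ.IsArrow' V₁ x)
    (hy : Γ.IsArrow' V₁ (Γ.σ (Γ.ι x))) :
    Γ.cEval k V₁ x (Γ.d1 k V₁ (Γ.scaleCochain k V₁ X)) = 0 := by
  rw [Γ.cEval_d1 k (Γ.scaleCochain_mem k X) hx hy, scaleCochain, scaleCochain, if_pos hx, if_pos hy,
    smul_mul_assoc, mul_smul_comm, Γ.arrow_mul_arrow_of_ne k (Γ.σ_ι_ne x), smul_zero, smul_zero,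
    add_zero]

theorem mem_stdSpan_of_socle [Finite V] [CharZero k] (hbip : Γ.IsBipartition V₁) {T : Set Γ.Edge}
    (hT : Γ.IsSpanningTree T) {φ : Γ.Tip V₁ → Γ.Alg k} (hc : ∀ x, Γ.cEval k V₁ x φ = 0)
    (hb : ∀ h, Γ.s h ∉ V₁ → Γ.bEval k V₁ h φ = 0) {κ : H → k}
    (ha : ∀ h, Γ.s h ∈ V₁ → Γ.IsArrow' V₁ h →
      Γ.aEval k V₁ h φ = κ h • Γ.P k (Γ.σ h) (Γ.len h)) : φ ∈ Γ.stdSpan k T := by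
  have := Fintype.ofFinite {j : Γ.Edge // j ∉ T}
  obtain ⟨X, hX⟩ := Γ.exists_potential k hbip hT κ
  choose rep hrep hrep' using Γ.exists_edge_eq_of_mem hbip
  have hrep'' : ∀ h, Γ.s h ∈ V₁ → rep (Γ.edge h) = h := fun h hh =>
    Γ.eq_of_edge_eq hbip (hrep _).symm hh (hrep' _)
  -- What the potential does not account for; on the edges of T this is zero, elsewhere it is the
  -- coefficient of type (C).
  let c : Γ.Edge → k := fun j => κ (rep j) - (X (Γ.s (rep j)) - X (Γ.s (Γ.ι (rep j))))
  have key : φ = Γ.d1 k V₁ (Γ.scaleCochain k V₁ X) +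
      ∑ j : {j : Γ.Edge // j ∉ T}, c j.1 • Γ.stdC k 1 j.1 := by
    refine Γ.cochain_ext k (fun h hh hh' => ?_) (fun h hh => ?_) fun x hx hy => ?_
    · rw [map_add, Γ.aEval_d1_scaleCochain k hbip X hh hh', ha h hh hh', map_sum,
        ← sub_eq_iff_eq_add', ← sub_smul]
      have h1 : ∀ j, Γ.aEval k V₁ h (c j • Γ.stdC k 1 j) =
          if Γ.edge h = j then c j • Γ.P k (Γ.σ h) (Γ.len h) else 0 := by
        intro j
        rw [map_smul, Γ.aEval_apply k hh hh', stdC]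
        split_ifs
        · rw [one_smul, ev_fullCyc_eq, len_σ, P_len_σ_ι]
        · rw [smul_zero]
      simp only [h1]
      by_cases hjT : Γ.edge h ∈ T
      · rw [hX h hh hjT, sub_self, zero_smul, Finset.sum_eq_zero]
        rintro ⟨j, hj⟩ _
        exact if_neg (by rintro rfl; exact hj hjT)
      · rw [Finset.sum_eq_single ⟨_, hjT⟩, if_pos rfl]
        · simp only [c, hrep'' h hh]
        · rintro ⟨j, hj⟩ _ hne
          exact if_neg (by rintro rfl; exact hne rfl)
        · exact fun h => absurd (Finset.mem_univ _) h
    · rw [map_add, Γ.bEval_d1_scaleCochain k X hh, hb h hh, map_sum, zero_add, Finset.sum_eq_zero]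
      rintro j -
      rw [map_smul, Γ.bEval_apply k hh, stdC, smul_zero]
    · rw [map_add, Γ.cEval_d1_scaleCochain k X hx hy, hc, map_sum, zero_add, Finset.sum_eq_zero]
      rintro j -
      rw [map_smul, Γ.cEval_apply k hx hy, stdC, smul_zero]
  rw [key]
  exact add_mem (Γ.d1_mem_stdSpan k (Γ.scaleCochain_mem k X)) (sum_mem fun j _ =>
    Submodule.smul_mem _ _ (Γ.stdCocycle_mem_stdSpan k (.C j.1 j.2)))

theorem cocycle2_eq_stdSpan [Finite V] [CharZero k] (hconn : Γ.IsConnected)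
    (hbip : Γ.IsBipartition V₁) (hloc : ¬ Γ.IsLocalBrauerTree) {T : Set Γ.Edge}
    (hT : Γ.IsSpanningTree T) : Γ.cocycle2 k V₁ = Γ.stdSpan k T := by
  refine le_antisymm (fun φ hφ => ?_) (Γ.stdSpan_le k hconn hbip hloc T)
  obtain ⟨ω, hω, hχ⟩ := Γ.exists_cEval_sub_eq_zero k hconn hbip hloc T hφ
  obtain ⟨ω', hω', hc, hb, κ, hκ⟩ := Γ.exists_sub_eq_socle k hconn hbip hloc T
    (sub_mem hφ (Γ.stdSpan_le k hconn hbip hloc T hω)) hχ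
  have := add_mem (add_mem (Γ.mem_stdSpan_of_socle k hbip hT hc hb hκ) hω') hω
  rwa [sub_add_cancel, sub_add_cancel] at this

end SpanningTree

/-! ## Functionals vanishing on coboundaries -/

section Functionals

open scoped Classical

variable {V H : Type*} (Γ : BrauerGraph V H) (k : Type*) [Field k] [Finite H] {V₁ : Set V}

theorem P_mul_P' {a b : H} {m : ℕ} (n : ℕ) (e : Γ.σ^[m] a = b) :
    Γ.P k a m * Γ.P k b n = Γ.P k a (m + n) := by
  rw [← e, P_mul_P]

theorem τ_evalBim_nab_mul (ψ : H → Γ.Alg k) (h : H) (n : ℕ) (u : Γ.Alg k) :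
    Γ.τ k (Γ.evalBim k ψ (Γ.nab k h n) * u) = ∑ j ∈ Finset.range n,
      Γ.τ k (ψ (Γ.σ^[j] h) * (Γ.P k (Γ.σ^[j + 1] h) (n - 1 - j) * u * Γ.P k h j)) := by
  rw [evalBim_nab, Finset.sum_mul, map_sum]
  refine Finset.sum_congr rfl fun j _ => ?_
  rw [mul_assoc, mul_assoc, τ_mul_comm]
  simp only [mul_assoc]

theorem P_mul_P_mul_P {h : H} {n l j : ℕ} (hj : j + 1 ≤ n) (e : Γ.σ^[n] h = h)
    (e' : Γ.σ^[l] h = h) :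
    Γ.P k (Γ.σ^[j + 1] h) (n - 1 - j) * Γ.P k h l * Γ.P k h j =
      Γ.P k (Γ.σ^[j + 1] h) (n - 1 + l) := by
  have e₁ : Γ.σ^[n - 1 - j] (Γ.σ^[j + 1] h) = h := by
    rw [← Function.iterate_add_apply, show n - 1 - j + (j + 1) = n by omega, e]
  rw [mul_assoc, Γ.P_mul_P' k _ e', Γ.P_mul_P' k _ e₁]
  congr 1
  omega

/-- Pairing with a multiple of the full cycles. -/
theorem τ_evalBim_nab_mul_P (ψ : H → Γ.Alg k) {h : H} {n l : ℕ} (e : Γ.σ^[n] h = h)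
    (e' : Γ.σ^[l] h = h) : Γ.τ k (Γ.evalBim k ψ (Γ.nab k h n) * Γ.P k h l) =
      ∑ j ∈ Finset.range n,
        Γ.τ k (ψ (Γ.σ^[j] h) * Γ.P k (Γ.σ^[j + 1] h) (n - 1 + l)) := by
  rw [τ_evalBim_nab_mul]
  refine Finset.sum_congr rfl fun j hj => ?_
  rw [Γ.P_mul_P_mul_P k (Finset.mem_range.1 hj) e e']

/-- After rotating under τ, every value of ψ is multiplied by a path of `len h - 1 + l` arrows,
which is too long. -/
theorem τ_evalBim_nab_len_mul_P (ψ : H → Γ.Alg k) {h : H} {l : ℕ} (e : Γ.σ^[l] h = h)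
    (hl : 1 < l) : Γ.τ k (Γ.evalBim k ψ (Γ.nab k h (Γ.len h)) * Γ.P k h l) = 0 := by
  rw [Γ.τ_evalBim_nab_mul_P k ψ (Γ.σ_iterate_len h) e]
  refine Finset.sum_eq_zero fun j hj => ?_
  have := Finset.mem_range.1 hj
  rw [Γ.P_of_len_lt k (by rw [len_σ_iterate]; omega), mul_zero, map_zero]

theorem τ_evalBim_nab_mul_P_of_fixed (ψ : H → Γ.Alg k) {h : H} (e : Γ.σ h = h) (n l : ℕ) :
    Γ.τ k (Γ.evalBim k ψ (Γ.nab k h n) * Γ.P k h l) =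
      n * Γ.τ k (ψ h * Γ.P k h (n - 1 + l)) := by
  rw [Γ.τ_evalBim_nab_mul_P k ψ (Function.iterate_fixed e n) (Function.iterate_fixed e l)]
  simp only [Function.iterate_fixed e]
  rw [Finset.sum_const, Finset.card_range, nsmul_eq_mul]

theorem τ_evalBim_nab_mul_P_of_ne (ψ : H → Γ.Alg k) {h x : H} {n l : ℕ} (hn : 1 < n) (hl : 0 < l)
    (e : Γ.σ^[n] h = h) (e' : Γ.σ^[l] x = x) (hne : h ≠ x) :
    Γ.τ k (Γ.evalBim k ψ (Γ.nab k h n) * Γ.P k x l) = 0 := by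
  rw [τ_evalBim_nab_mul]
  refine Finset.sum_eq_zero fun j hj => ?_
  have hj := Finset.mem_range.1 hj
  obtain rfl | hj0 := Nat.eq_zero_or_pos j
  · rw [Γ.P_mul_P_of_ne k (by omega) hl, zero_mul, mul_zero, map_zero]
    rw [← Function.iterate_add_apply, show n - 1 - 0 + (0 + 1) = n by omega, e]
    exact hne
  · rw [mul_assoc, Γ.P_mul_P_of_ne k hl hj0, mul_zero, mul_zero, map_zero]
    rw [e']
    exact hne.symm

theorem evalBim_nab_one {ψ : H → Γ.Alg k} (hψ : ψ ∈ Γ.cochain1 k V₁) (h : H) :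
    Γ.evalBim k ψ (Γ.nab k h 1) = ψ h := by
  rw [nab_one, evalBim_single, hψ.1]

theorem aEval_d1 {ψ : H → Γ.Alg k} (hψ : ψ ∈ Γ.cochain1 k V₁) {h : H} (hh : Γ.s h ∈ V₁)
    (hh' : Γ.IsArrow' V₁ h) : Γ.aEval k V₁ h (Γ.d1 k V₁ ψ) =
      Γ.evalBim k ψ (Γ.nab k (Γ.σ h) (Γ.len h)) -
        Γ.evalBim k ψ (Γ.nab k (Γ.σ (Γ.ι h)) (Γ.len (Γ.ι h))) := by
  rw [Γ.aEval_apply k hh hh', Γ.d1_eq k hψ, relBim, map_sub]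

theorem bEval_d1 {ψ : H → Γ.Alg k} (hψ : ψ ∈ Γ.cochain1 k V₁) {h : H} (hh : Γ.s h ∉ V₁) :
    Γ.bEval k V₁ h (Γ.d1 k V₁ ψ) = Γ.evalBim k ψ (Γ.nab k h (Γ.len h + 1)) := by
  rw [Γ.bEval_apply k hh, Γ.d1_eq k hψ, relBim]

/-- After rotating under τ, every value of ψ is multiplied by a path of `2 len h - 1 - l` arrows,
which exceeds `len h` by `hl'`. -/
theorem τ_bEval_d1_mul_P {ψ : H → Γ.Alg k} (hψ : ψ ∈ Γ.cochain1 k V₁) {h : H} (hh : Γ.s h ∉ V₁)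
    {l : ℕ} (hl : Γ.σ^[l] h = h) (hl' : l + 1 < Γ.len h) :
    Γ.τ k (Γ.bEval k V₁ h (Γ.d1 k V₁ ψ) * Γ.P k (Γ.σ h) (Γ.len h - 1 - l)) = 0 := by
  rw [Γ.bEval_d1 k hψ hh, τ_evalBim_nab_mul]
  refine Finset.sum_eq_zero fun j hj => ?_
  have hj := Finset.mem_range.1 hj
  have h1 : Γ.σ^[Γ.len h - 1 - l] (Γ.σ h) = h := by
    have := Γ.σ_iterate_len h
    rw [show Γ.len h = Γ.len h - 1 - l + 1 + l by omega, Function.iterate_add_apply, hl,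
      Function.iterate_succ_apply] at this
    exact this
  have h2 : Γ.σ^[Γ.len h - j] (Γ.σ^[j + 1] h) = Γ.σ h := by
    rw [← Function.iterate_add_apply, show Γ.len h - j + (j + 1) = Γ.len h + 1 by omega,
      Function.iterate_succ_apply', σ_iterate_len]
  rw [Nat.add_sub_cancel, Γ.P_mul_P' k _ h2, Γ.P_mul_P' k, Γ.P_of_len_lt k, mul_zero, map_zero]
  · rw [len_σ_iterate]
    omega
  · rw [add_comm, Function.iterate_add_apply, h2, h1]

theorem τ_bEval_d1_of_fixed {ψ : H → Γ.Alg k} (hψ : ψ ∈ Γ.cochain1 k V₁) {h : H}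
    (hh : Γ.s h ∉ V₁) (e : Γ.σ h = h) : Γ.τ k (Γ.bEval k V₁ h (Γ.d1 k V₁ ψ)) =
      (Γ.len h + 1) * Γ.τ k (ψ h * Γ.P k h (Γ.len h)) := by
  have hd : Γ.d1 k V₁ ψ ∈ Γ.cochain2 k V₁ :=
    (Γ.coboundary2_le_cocycle2 k V₁ ((Γ.mem_coboundary2 k V₁).2 ⟨ψ, hψ, rfl⟩)).1
  have h1 := Γ.bEval_mul_idem k hd h
  rw [← tgt_σ, e, ← P_zero] at h1
  rw [← h1, Γ.bEval_d1 k hψ hh, Γ.τ_evalBim_nab_mul_P_of_fixed k ψ e, Nat.add_sub_cancel, add_zero,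
    Nat.cast_add, Nat.cast_one]

/-- These functionals detect a single value of ψ. They serve to correct, at leaves, functionals on
the tips (a) and (b) that do not vanish on coboundaries. -/
theorem τ_cEval_d1_mul_P (hbip : Γ.IsBipartition V₁) {ψ : H → Γ.Alg k} (hψ : ψ ∈ Γ.cochain1 k V₁)
    {x : H} (hx : Γ.IsArrow' V₁ x) (hy : Γ.IsArrow' V₁ (Γ.σ (Γ.ι x))) {n : ℕ} (hn : 0 < n) :
    Γ.τ k (Γ.cEval k V₁ x (Γ.d1 k V₁ ψ) * Γ.P k (Γ.σ (Γ.σ (Γ.ι x))) n) =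
      Γ.τ k (ψ x * Γ.P k (Γ.σ (Γ.ι x)) (n + 1)) := by
  rw [Γ.cEval_d1 k hψ hx hy, add_mul, map_add, mul_assoc, arrow_mul_P, mul_assoc, τ_mul_comm,
    Γ.τ_mul_comm k (Γ.arrow k x), mul_assoc, ← Γ.P_one k x, Γ.P_mul_P_of_ne k hn one_pos, mul_zero,
    map_zero, add_zero, τ_mul_comm]
  intro e
  have h1 := congrArg Γ.s e
  rw [s_σ_iterate, s_σ, s_σ] at h1
  have := hbip x
  rw [h1] at this
  exact iff_not_self this

theorem one_lt_len_ι (hconn : Γ.IsConnected) (hbip : Γ.IsBipartition V₁)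
    (hloc : ¬ Γ.IsLocalBrauerTree) {h : H} (e : Γ.σ h = h) : 1 < Γ.len (Γ.ι h) := by
  by_contra hlt
  have hlen : Γ.len (Γ.ι h) = 1 := by have := Γ.len_pos (Γ.ι h); omega
  exact hlt (Γ.one_lt_len_of_leaves hconn hbip hloc
    (Γ.σ_eq_self_iff.2 (Γ.len_eq_one_iff.1 hlen).2) (by rwa [ι_ι]))

/-- The sum of the coefficients that determines the socle part of a coboundary. -/
theorem τ_evalBim_nab_len_σ (ψ : H → Γ.Alg k) (h : H) :
    Γ.τ k (Γ.evalBim k ψ (Γ.nab k (Γ.σ h) (Γ.len h))) =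
      Γ.τ k (Γ.evalBim k ψ (Γ.nab k h (Γ.len h))) := by
  have key : ∀ x, Γ.len x = Γ.len h → Γ.τ k (Γ.evalBim k ψ (Γ.nab k x (Γ.len h))) =
      ∑ j ∈ Finset.range (Γ.len h),
        Γ.τ k (ψ (Γ.σ^[j] x) * Γ.P k (Γ.σ^[j + 1] x) (Γ.len h - 1)) := by
    intro x hx
    have h1 := Γ.τ_evalBim_nab_mul k ψ x (Γ.len h) 1
    rw [mul_one] at h1
    rw [h1]
    refine Finset.sum_congr rfl fun j hj => ?_
    have hj := Finset.mem_range.1 hj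
    rw [mul_one, Γ.P_mul_P' k]
    · congr 3
      omega
    · rw [← Function.iterate_add_apply, show Γ.len h - 1 - j + (j + 1) = Γ.len h by omega, ← hx,
        σ_iterate_len]
  rw [key _ (Γ.len_σ h), key _ rfl]
  set t : ℕ → k := fun j => Γ.τ k (ψ (Γ.σ^[j] h) * Γ.P k (Γ.σ^[j + 1] h) (Γ.len h - 1)) with ht
  have h3 : t (Γ.len h) = t 0 := by
    simp only [ht]
    rw [Function.iterate_succ_apply', σ_iterate_len]
    rfl
  have h2 := Finset.sum_range_succ t (Γ.len h)
  rw [Finset.sum_range_succ', h3] at h2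
  exact add_right_cancel h2

end Functionals

/-! ### Linear independence: types (D) and (A) -/

section Independence

open scoped Classical

variable {V H : Type*} (Γ : BrauerGraph V H) (k : Type*) [Field k] [Finite H] {V₁ : Set V}

/-- The functional `φ ↦ τ(E(φ) u)`. -/
noncomputable def pairing (E : (Γ.Tip V₁ → Γ.Alg k) →ₗ[k] Γ.Alg k) (u : Γ.Alg k) :
    (Γ.Tip V₁ → Γ.Alg k) →ₗ[k] k :=
  (Γ.τ k).comp ((LinearMap.mulRight k u).comp E)

theorem pairing_apply (E : (Γ.Tip V₁ → Γ.Alg k) →ₗ[k] Γ.Alg k) (u : Γ.Alg k)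
    (φ : Γ.Tip V₁ → Γ.Alg k) : Γ.pairing k E u φ = Γ.τ k (E φ * u) := rfl

variable {T : Set Γ.Edge} {l : Γ.StdIndex V₁ T →₀ k}

theorem sum_eq_of_mem_coboundary2
    (hl : Finsupp.linearCombination k (Γ.stdCocycle k 1) l ∈ Γ.coboundary2 k V₁)
    {f : (Γ.Tip V₁ → Γ.Alg k) →ₗ[k] k} (hf : ∀ ψ ∈ Γ.cochain1 k V₁, f (Γ.d1 k V₁ ψ) = 0)
    (x : Γ.StdIndex V₁ T) (h : ∀ y, y ≠ x → l y = 0 ∨ f (Γ.stdCocycle k 1 y) = 0) :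
    l x * f (Γ.stdCocycle k 1 x) = 0 := by
  obtain ⟨ψ, hψ, e⟩ := (Γ.mem_coboundary2 k V₁).1 hl
  have h1 := hf ψ hψ
  rw [e, Finsupp.linearCombination_apply, map_finsuppSum, Finsupp.sum_eq_single x] at h1
  · rwa [map_smul, smul_eq_mul] at h1
  · intro y _ hy
    rw [map_smul, smul_eq_mul]
    exact mul_eq_zero.2 (h y hy)
  · rw [zero_smul, map_zero]
    exact fun _ => rfl

/-- This permits a triangular elimination: a functional need not vanish on the other standard
cocycles whose coefficients are already known to be zero. -/
theorem coef_eq_zero_of_mem_coboundary2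
    (hl : Finsupp.linearCombination k (Γ.stdCocycle k 1) l ∈ Γ.coboundary2 k V₁)
    {f : (Γ.Tip V₁ → Γ.Alg k) →ₗ[k] k} (hf : ∀ ψ ∈ Γ.cochain1 k V₁, f (Γ.d1 k V₁ ψ) = 0)
    (x : Γ.StdIndex V₁ T) (hx : f (Γ.stdCocycle k 1 x) ≠ 0)
    (h : ∀ y, y ≠ x → l y = 0 ∨ f (Γ.stdCocycle k 1 y) = 0) : l x = 0 :=
  (mul_eq_zero.1 (Γ.sum_eq_of_mem_coboundary2 k hl hf x h)).resolve_right hx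

theorem cEval_stdB (v : V) (i : ℕ) (h₁ : 1 ≤ i) (h₂ : i ≤ Γ.m v - 1) (x : H) :
    Γ.cEval k V₁ x (Γ.stdCocycle (T := T) k 1 (.B v i h₁ h₂)) = 0 := by
  by_cases hx : Γ.IsArrow' V₁ x ∧ Γ.IsArrow' V₁ (Γ.σ (Γ.ι x))
  · rw [Γ.cEval_apply k hx.1 hx.2, stdCocycle]
    split_ifs <;> rfl
  · rw [cEval, dif_neg hx, LinearMap.zero_apply]

theorem cEval_stdA (x : H) : Γ.cEval k V₁ x (Γ.stdCocycle (T := T) k 1 .A) = 0 := by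
  by_cases hx : Γ.IsArrow' V₁ x ∧ Γ.IsArrow' V₁ (Γ.σ (Γ.ι x))
  · rw [Γ.cEval_apply k hx.1 hx.2, stdCocycle, stdA]
  · rw [cEval, dif_neg hx, LinearMap.zero_apply]

theorem cEval_stdC (j : Γ.Edge) (hj : j ∉ T) (x : H) :
    Γ.cEval k V₁ x (Γ.stdCocycle k 1 (.C j hj)) = 0 := by
  by_cases hx : Γ.IsArrow' V₁ x ∧ Γ.IsArrow' V₁ (Γ.σ (Γ.ι x))
  · rw [Γ.cEval_apply k hx.1 hx.2, stdCocycle, stdC]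
  · rw [cEval, dif_neg hx, LinearMap.zero_apply]

theorem bEval_stdC (j : Γ.Edge) (hj : j ∉ T) {h : H} (hh : Γ.s h ∉ V₁) :
    Γ.bEval k V₁ h (Γ.stdCocycle k 1 (.C j hj)) = 0 := by
  rw [Γ.bEval_apply k hh, stdCocycle, stdC]

theorem bEval_stdA {h : H} (hh : Γ.s h ∉ V₁) :
    Γ.bEval k V₁ h (Γ.stdCocycle (T := T) k 1 .A) = -Γ.P k h 1 := by
  rw [Γ.bEval_apply k hh, stdCocycle, stdA, one_smul, P_one]

theorem bEval_stdB (v : V) (i : ℕ) (h₁ : 1 ≤ i) (h₂ : i ≤ Γ.m v - 1) {h : H} (hh : Γ.s h ∉ V₁) :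
    Γ.bEval k V₁ h (Γ.stdCocycle (T := T) k 1 (.B v i h₁ h₂)) =
      if Γ.s h = v then -Γ.P k h (i * Γ.val v + 1) else 0 := by
  rw [Γ.bEval_apply k hh, stdCocycle]
  split_ifs with hv e e
  · exact absurd (e ▸ hv) hh
  · rw [stdB₁]
  · rw [stdB₂, if_pos e, one_smul, ev_cyc_append, e]
  · rw [stdB₂, if_neg e]

theorem aEval_stdA {h : H} (hh : Γ.s h ∈ V₁) (hh' : Γ.IsArrow' V₁ h) :
    Γ.aEval k V₁ h (Γ.stdCocycle (T := T) k 1 .A) = Γ.idem k (Γ.edge h) := by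
  rw [Γ.aEval_apply k hh hh', stdCocycle, stdA, one_smul]

theorem aEval_stdB (hbip : Γ.IsBipartition V₁) (v : V) (i : ℕ) (h₁ : 1 ≤ i) (h₂ : i ≤ Γ.m v - 1)
    {h : H} (hh : Γ.s h ∈ V₁) (hh' : Γ.IsArrow' V₁ h) :
    Γ.aEval k V₁ h (Γ.stdCocycle (T := T) k 1 (.B v i h₁ h₂)) =
      if Γ.s h = v then Γ.P k (Γ.σ h) (i * Γ.val v) else
        if Γ.s (Γ.ι h) = v then Γ.P k (Γ.σ (Γ.ι h)) (i * Γ.val v) else 0 := by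
  rw [Γ.aEval_apply k hh hh', stdCocycle]
  split_ifs with hv e e' e e'
  · rw [stdB₁, if_pos e, one_smul, Γ.ev_cyc k h₁, s_σ, e]
  · exact absurd (e' ▸ hv) ((hbip h).1 hh)
  · rw [stdB₁, if_neg e]
  · exact absurd (e ▸ hh) hv
  · rw [stdB₂, if_pos e', one_smul, Γ.ev_cyc k h₁, s_σ, e']
  · rw [stdB₂, if_neg e']

theorem aEval_stdC (j : Γ.Edge) (hj : j ∉ T) {h : H} (hh : Γ.s h ∈ V₁) (hh' : Γ.IsArrow' V₁ h) :
    Γ.aEval k V₁ h (Γ.stdCocycle k 1 (.C j hj)) =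
      if Γ.edge h = j then Γ.P k (Γ.σ h) (Γ.len h) else 0 := by
  rw [Γ.aEval_apply k hh hh', stdCocycle, stdC]
  split_ifs
  · rw [one_smul, ev_fullCyc_eq, len_σ, P_len_σ_ι]
  · rfl

/-- Pairing the value on αβ with the socle extracts the coefficient of the trivial path. A
coboundary takes the value `ψ(α)β + αψ(β)` there, and the socle is annihilated by arrows on both
sides. -/
theorem coef_D₁_eq_zero (hconn : Γ.IsConnected) (hbip : Γ.IsBipartition V₁)
    (hloc : ¬ Γ.IsLocalBrauerTree)
    (hl : Finsupp.linearCombination k (Γ.stdCocycle k 1) l ∈ Γ.coboundary2 k V₁)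
    (b : Γ.Bigon V₁) : l (.D₁ b) = 0 := by
  have e := Γ.isBigon_of_mem hconn hbip hloc b
  have hα : ∀ b : Γ.Bigon V₁, Γ.s (Γ.ι (Γ.ρ b.1)) ∈ V₁ := fun b => by
    rw [hbip, ι_ι, s_ρ]
    exact b.2.1
  have hx := Γ.isArrow'_of_lt (V₁ := V₁) e.len_left
  have hy : Γ.IsArrow' V₁ (Γ.σ (Γ.ι (Γ.ι (Γ.ρ b.1)))) := by
    rw [e.σ_ι_left]
    exact Γ.isArrow'_of_lt e.len_right
  refine Γ.coef_eq_zero_of_mem_coboundary2 k hl (f := Γ.pairing k (Γ.cEval k V₁ (Γ.ι (Γ.ρ b.1)))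
    (Γ.P k (Γ.ι (Γ.ρ b.1)) (Γ.len (Γ.ι (Γ.ρ b.1))))) (fun ψ hψ => ?_) _ ?_ fun y hne => ?_
  · have h1 := Γ.P_mul_arrow k (Γ.ι (Γ.ρ b.1)) (Γ.len (Γ.ι (Γ.ρ b.1)))
    rw [σ_iterate_len, P_len_succ] at h1
    rw [pairing_apply, Γ.cEval_d1 k hψ hx hy, e.σ_ι_left, add_mul, map_add, mul_assoc,
      ← Γ.P_one k b.1, Γ.P_mul_P_of_ne k one_pos (Γ.len_pos _), mul_zero, map_zero, zero_add,
      mul_assoc, τ_mul_comm, mul_assoc, h1, mul_zero, map_zero]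
    intro h
    apply e.s_ne
    rw [← h, Function.iterate_one, s_σ]
  · rw [pairing_apply, Γ.cEval_apply k hx hy, stdCocycle, stdD₁, if_pos ⟨rfl, e.σ_ι_left⟩, one_smul,
      ← e.tgt_eq, idem_tgt_mul_P, τ_P, if_pos rfl]
    exact one_ne_zero
  · right
    rw [pairing_apply]
    cases y with
    | A => rw [cEval_stdA, zero_mul, map_zero]
    | B => rw [cEval_stdB, zero_mul, map_zero]
    | C => rw [cEval_stdC, zero_mul, map_zero]
    | D₁ b' =>
      rw [Γ.cEval_apply k hx hy, stdCocycle, stdD₁, if_neg, if_neg, zero_mul, map_zero]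
      · exact fun h => b'.2.1 (h.1 ▸ hα b)
      · rintro ⟨-, h⟩
        rw [e.σ_ι_left] at h
        exact hne (congrArg _ (Subtype.ext h.symm))
    | D₂ b' =>
      rw [Γ.cEval_apply k hx hy, stdCocycle, stdD₂, if_neg, zero_mul, map_zero]
      exact fun h => b'.2.1 (h.1 ▸ hα b)

/-- For a coboundary the values on αβ and on βα have the same trace, so the difference of the traces
is a suitable functional. -/
theorem coef_D₂_eq_zero (hconn : Γ.IsConnected) (hbip : Γ.IsBipartition V₁)
    (hloc : ¬ Γ.IsLocalBrauerTree)
    (hl : Finsupp.linearCombination k (Γ.stdCocycle k 1) l ∈ Γ.coboundary2 k V₁)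
    (b : Γ.Bigon V₁) : l (.D₂ b) = 0 := by
  have e := Γ.isBigon_of_mem hconn hbip hloc b
  have hα : ∀ b : Γ.Bigon V₁, Γ.s (Γ.ι (Γ.ρ b.1)) ∈ V₁ := fun b => by
    rw [hbip, ι_ι, s_ρ]
    exact b.2.1
  have hx := Γ.isArrow'_of_lt (V₁ := V₁) e.len_left
  have hy := Γ.isArrow'_of_lt (V₁ := V₁) e.len_right
  have hx' : Γ.IsArrow' V₁ (Γ.σ (Γ.ι b.1)) := by rwa [e.σ_ι_right]
  have hy' : Γ.IsArrow' V₁ (Γ.σ (Γ.ι (Γ.ι (Γ.ρ b.1)))) := by rwa [e.σ_ι_left]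
  have hf : ∀ φ, (Γ.pairing k (Γ.cEval k V₁ b.1) 1 -
      Γ.pairing k (Γ.cEval k V₁ (Γ.ι (Γ.ρ b.1))) 1) φ =
      Γ.τ k (Γ.cEval k V₁ b.1 φ) - Γ.τ k (Γ.cEval k V₁ (Γ.ι (Γ.ρ b.1)) φ) := fun φ => by
    rw [LinearMap.sub_apply, pairing_apply, pairing_apply, mul_one, mul_one]
  have h0 : ∀ b', Γ.cEval k V₁ (Γ.ι (Γ.ρ b.1)) (Γ.stdCocycle (T := T) k 1 (.D₂ b')) = 0 := by
    intro b'
    rw [Γ.cEval_apply k hx hy', stdCocycle, stdD₂, if_neg]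
    exact fun h => b'.2.1 (h.1 ▸ hα b)
  refine Γ.coef_eq_zero_of_mem_coboundary2 k hl (f := Γ.pairing k (Γ.cEval k V₁ b.1) 1 -
    Γ.pairing k (Γ.cEval k V₁ (Γ.ι (Γ.ρ b.1))) 1) (fun ψ hψ => ?_) _ ?_ fun y hne => ?_
  · rw [hf, Γ.cEval_d1 k hψ hx hy', Γ.cEval_d1 k hψ hy hx', e.σ_ι_left, e.σ_ι_right, map_add,
      map_add, τ_mul_comm, Γ.τ_mul_comm k (Γ.arrow k b.1), sub_eq_zero, add_comm]
  · rw [hf, h0, map_zero, sub_zero, Γ.cEval_apply k hy hx', stdCocycle, stdD₂,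
      if_pos ⟨rfl, e.σ_ι_right⟩, one_smul, ev_fullCyc_eq, τ_P, if_pos rfl]
    exact one_ne_zero
  · rw [hf]
    cases y with
    | A => simp only [cEval_stdA, map_zero, sub_zero, or_true]
    | B => simp only [cEval_stdB, map_zero, sub_zero, or_true]
    | C => simp only [cEval_stdC, map_zero, sub_zero, or_true]
    | D₁ b' => exact Or.inl (Γ.coef_D₁_eq_zero k hconn hbip hloc hl b')
    | D₂ b' =>
      right
      rw [h0, map_zero, sub_zero, Γ.cEval_apply k hy hx', stdCocycle, stdD₂, if_neg, map_zero]
      rintro ⟨h, -⟩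
      exact hne (congrArg _ (Subtype.ext h.symm))

/-- Usually it suffices to extract the coefficient of the arrow in the value on one tip (b). If the
V₂-end is truncated, that arrow lies in the socle and coboundaries contribute, so the coefficient of
the trivial path on the tip (a) of the same edge is used as well. -/
theorem coef_A_eq_zero (hconn : Γ.IsConnected) (hbip : Γ.IsBipartition V₁)
    (hloc : ¬ Γ.IsLocalBrauerTree)
    (hl : Finsupp.linearCombination k (Γ.stdCocycle k 1) l ∈ Γ.coboundary2 k V₁) : l .A = 0 := by
  obtain ⟨v⟩ := hconn.nonempty
  obtain ⟨h₀, -⟩ := Γ.s_surjective v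
  obtain ⟨h, -, hh⟩ := Γ.exists_edge_eq_of_mem hbip (Γ.edge h₀)
  have hι := (hbip h).1 hh
  have hD₁ := Γ.coef_D₁_eq_zero k hconn hbip hloc hl
  have hD₂ := Γ.coef_D₂_eq_zero k hconn hbip hloc hl
  obtain h1 | h1 : Γ.len (Γ.ι h) = 1 ∨ 1 < Γ.len (Γ.ι h) := by
    have := Γ.len_pos (Γ.ι h)
    omega
  · have hσ : Γ.σ (Γ.ι h) = Γ.ι h := Γ.σ_eq_self_iff.2 (Γ.len_eq_one_iff.1 h1).2
    have hlen := Γ.one_lt_len_ι hconn hbip hloc hσ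
    rw [ι_ι] at hlen
    have hh' : Γ.IsArrow' V₁ h := Γ.isArrow'_of_lt hlen
    have hσh : Γ.σ^[Γ.len h] (Γ.σ h) = Γ.σ h := by rw [← Γ.len_σ h, σ_iterate_len]
    have hP := Γ.P_len_σ_ι k h
    rw [h1, hσ] at hP
    -- The tip (b) is the square of a loop, whose derivative contributes twice; the weight 2 cancels
    -- this against the tip (a). On the cocycle (A) the functional is `-1 + 2 = 1`.
    have hf : ∀ φ, (Γ.pairing k (Γ.bEval k V₁ (Γ.ι h)) 1 + (2 : k) •
        Γ.pairing k (Γ.aEval k V₁ h) (Γ.P k (Γ.σ h) (Γ.len h))) φ =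
        Γ.τ k (Γ.bEval k V₁ (Γ.ι h) φ) +
          2 * Γ.τ k (Γ.aEval k V₁ h φ * Γ.P k (Γ.σ h) (Γ.len h)) := fun φ => by
      rw [LinearMap.add_apply, LinearMap.smul_apply, pairing_apply, pairing_apply, mul_one,
        smul_eq_mul]
    refine Γ.coef_eq_zero_of_mem_coboundary2 k hl (f := Γ.pairing k (Γ.bEval k V₁ (Γ.ι h)) 1 +
      (2 : k) • Γ.pairing k (Γ.aEval k V₁ h) (Γ.P k (Γ.σ h) (Γ.len h))) (fun ψ hψ => ?_) _ ?_
      fun y hne => ?_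
    · have h2 := Γ.τ_evalBim_nab_len_mul_P k ψ hσh hlen
      rw [len_σ] at h2
      rw [hf, Γ.τ_bEval_d1_of_fixed k hψ hι hσ, Γ.aEval_d1 k hψ hh hh', sub_mul, map_sub, h2, h1,
        hσ, Γ.evalBim_nab_one k hψ, hP, Nat.cast_one]
      ring
    · have h3 := Γ.idem_tgt_mul_P k (Γ.σ h) (Γ.len h)
      rw [tgt_σ, src] at h3
      rw [hf, Γ.bEval_stdA k hι, Γ.aEval_stdA k hh hh', h3, map_neg, τ_P, τ_P, len_σ, h1,
        if_pos rfl, if_pos rfl]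
      norm_num
    · rw [hf]
      cases y with
      | A => exact absurd rfl hne
      | B v i h₁ h₂ =>
        right
        rw [Γ.bEval_stdB k v i h₁ h₂ hι, Γ.aEval_stdB k hbip v i h₁ h₂ hh hh']
        have h4 : Γ.s (Γ.ι h) ≠ v := by
          rintro rfl
          rw [(Γ.len_eq_one_iff.1 h1).1] at h₂
          omega
        rw [if_neg h4, if_neg h4, map_zero, zero_add]
        split_ifs with h5
        · subst h5
          have h6 : 0 < i * Γ.val (Γ.s h) := Nat.mul_pos h₁ (Γ.val_pos h)
          have h7 := Γ.σ_iterate_mul_val (Γ.σ h) i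
          rw [s_σ] at h7
          rw [Γ.P_mul_P' k _ h7, Γ.P_of_len_lt k (by rw [len_σ]; omega), map_zero, mul_zero]
        · rw [zero_mul, map_zero, mul_zero]
      | C j hj =>
        right
        rw [Γ.bEval_stdC k j hj hι, Γ.aEval_stdC k j hj hh hh', map_zero, zero_add]
        split_ifs
        · rw [Γ.P_mul_P' k _ hσh, Γ.P_of_len_lt k (by rw [len_σ]; omega), map_zero, mul_zero]
        · rw [zero_mul, map_zero, mul_zero]
      | D₁ b => exact Or.inl (hD₁ b)
      | D₂ b => exact Or.inl (hD₂ b)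
  · refine Γ.coef_eq_zero_of_mem_coboundary2 k hl (f := Γ.pairing k (Γ.bEval k V₁ (Γ.ι h))
      (Γ.P k (Γ.σ (Γ.ι h)) (Γ.len (Γ.ι h) - 1 - 0))) (fun ψ hψ => ?_) _ ?_ fun y hne => ?_
    · exact Γ.τ_bEval_d1_mul_P k hψ hι rfl (by omega)
    · rw [pairing_apply, Γ.bEval_stdA k hι, neg_mul, map_neg,
        Γ.P_mul_P' k (a := Γ.ι h) (b := Γ.σ (Γ.ι h)) (m := 1) _ rfl, τ_P, if_pos]
      · exact neg_ne_zero.2 one_ne_zero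
      · omega
    · rw [pairing_apply]
      cases y with
      | A => exact absurd rfl hne
      | B v i h₁ h₂ =>
        right
        rw [Γ.bEval_stdB k v i h₁ h₂ hι]
        split_ifs with h5
        · subst h5
          have h6 : 0 < i * Γ.val (Γ.s (Γ.ι h)) := Nat.mul_pos h₁ (Γ.val_pos _)
          rw [neg_mul, Γ.P_mul_P' k, Γ.P_of_len_lt k (by omega), neg_zero, map_zero]
          rw [Function.iterate_succ_apply', σ_iterate_mul_val]
        · rw [zero_mul, map_zero]
      | C j hj => rw [Γ.bEval_stdC k j hj hι, zero_mul, map_zero]; exact Or.inr rfl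
      | D₁ b => exact Or.inl (hD₁ b)
      | D₂ b => exact Or.inl (hD₂ b)

end Independence

/-! ### Linear independence: types (B) and (C), and the basis -/

section Basis

open scoped Classical

variable {V H : Type*} (Γ : BrauerGraph V H) (k : Type*) [Field k] [Finite H] {V₁ : Set V}
  {T : Set Γ.Edge} {l : Γ.StdIndex V₁ T →₀ k}

theorem τ_aEval_stdB_mul_P (hbip : Γ.IsBipartition V₁) (v : V) (i : ℕ) (h₁ : 1 ≤ i)
    (h₂ : i ≤ Γ.m v - 1) {h : H} (hh : Γ.s h ∈ V₁) (hh' : Γ.IsArrow' V₁ h) {n : ℕ} (hn : 0 < n) :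
    Γ.τ k (Γ.aEval k V₁ h (Γ.stdCocycle (T := T) k 1 (.B v i h₁ h₂)) * Γ.P k (Γ.σ h) n) =
      if Γ.s h = v ∧ i * Γ.val v + n = Γ.len h then 1 else 0 := by
  rw [Γ.aEval_stdB k hbip v i h₁ h₂ hh hh']
  by_cases e : Γ.s h = v
  · subst e
    have h7 := Γ.σ_iterate_mul_val (Γ.σ h) i
    rw [s_σ] at h7
    rw [if_pos rfl, Γ.P_mul_P' k _ h7, τ_P, len_σ]
    simp only [true_and]
  · rw [if_neg e, if_neg (c := Γ.s h = v ∧ _) (fun h => e h.1)]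
    split_ifs with e'
    · subst e'
      have h7 := Γ.σ_iterate_mul_val (Γ.σ (Γ.ι h)) i
      rw [s_σ] at h7
      rw [Γ.P_mul_P_of_ne k (Nat.mul_pos h₁ (Γ.val_pos _)) hn, map_zero]
      rw [h7]
      exact Γ.σ_ι_ne h
    · rw [zero_mul, map_zero]

theorem τ_aEval_stdC_mul_P (j : Γ.Edge) (hj : j ∉ T) {h : H} (hh : Γ.s h ∈ V₁)
    (hh' : Γ.IsArrow' V₁ h) {n : ℕ} (hn : 0 < n) :
    Γ.τ k (Γ.aEval k V₁ h (Γ.stdCocycle k 1 (.C j hj)) * Γ.P k (Γ.σ h) n) = 0 := by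
  rw [Γ.aEval_stdC k j hj hh hh']
  split_ifs
  · have hσh : Γ.σ^[Γ.len h] (Γ.σ h) = Γ.σ h := by rw [← Γ.len_σ h, σ_iterate_len]
    rw [Γ.P_mul_P' k _ hσh, Γ.P_of_len_lt k (by rw [len_σ]; omega), map_zero]
  · rw [zero_mul, map_zero]

theorem τ_bEval_stdB_mul_P (v : V) (i : ℕ) (h₁ : 1 ≤ i) (h₂ : i ≤ Γ.m v - 1) {h : H}
    (hh : Γ.s h ∉ V₁) (n : ℕ) :
    Γ.τ k (Γ.bEval k V₁ h (Γ.stdCocycle (T := T) k 1 (.B v i h₁ h₂)) * Γ.P k (Γ.σ h) n) =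
      if Γ.s h = v ∧ i * Γ.val v + 1 + n = Γ.len h then -1 else 0 := by
  rw [Γ.bEval_stdB k v i h₁ h₂ hh]
  by_cases e : Γ.s h = v
  · subst e
    have h7 : Γ.σ^[i * Γ.val (Γ.s h) + 1] h = Γ.σ h := by
      rw [Function.iterate_succ_apply', σ_iterate_mul_val]
    rw [if_pos rfl, neg_mul, Γ.P_mul_P' k _ h7, map_neg, τ_P]
    simp only [true_and]
    split_ifs
    · rfl
    · exact neg_zero
  · rw [if_neg e, if_neg (fun h => e h.1), zero_mul, map_zero]

theorem coef_B_eq_zero_of_functional (hconn : Γ.IsConnected) (hbip : Γ.IsBipartition V₁)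
    (hloc : ¬ Γ.IsLocalBrauerTree)
    (hl : Finsupp.linearCombination k (Γ.stdCocycle k 1) l ∈ Γ.coboundary2 k V₁)
    {h : H} {i : ℕ} (h₁ : 1 ≤ i) (h₂ : i ≤ Γ.m (Γ.s h) - 1)
    {f : (Γ.Tip V₁ → Γ.Alg k) →ₗ[k] k} (hf : ∀ ψ ∈ Γ.cochain1 k V₁, f (Γ.d1 k V₁ ψ) = 0)
    (hC : ∀ j hj, f (Γ.stdCocycle (T := T) k 1 (.C j hj)) = 0) {ε : k} (hε : ε ≠ 0)
    (hB : ∀ v i' h₁ h₂, f (Γ.stdCocycle (T := T) k 1 (.B v i' h₁ h₂)) =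
      if Γ.s h = v ∧ i' * Γ.val v = i * Γ.val (Γ.s h) then ε else 0) :
    l (.B (Γ.s h) i h₁ h₂) = 0 := by
  refine Γ.coef_eq_zero_of_mem_coboundary2 k hl hf _ ?_ fun y hne => ?_
  · rw [hB, if_pos ⟨rfl, rfl⟩]
    exact hε
  · cases y with
    | A => exact Or.inl (Γ.coef_A_eq_zero k hconn hbip hloc hl)
    | B v i' h₁' h₂' =>
      right
      rw [hB, if_neg]
      rintro ⟨rfl, e⟩
      obtain rfl := Nat.eq_of_mul_eq_mul_right (Γ.val_pos h) e
      exact hne rfl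
    | C j hj => exact Or.inr (hC j hj)
    | D₁ b => exact Or.inl (Γ.coef_D₁_eq_zero k hconn hbip hloc hl b)
    | D₂ b => exact Or.inl (Γ.coef_D₂_eq_zero k hconn hbip hloc hl b)

/-- The coefficient of the `i`-th power of the cycle is extracted from one tip (a) by pairing with
the complement, of `n + 1` arrows. Coboundaries are killed unless the complement is a single loop or
the V₂-end is truncated; a tip (c) then provides the correction. -/
theorem coef_B_eq_zero_of_mem (hconn : Γ.IsConnected) (hbip : Γ.IsBipartition V₁)
    (hloc : ¬ Γ.IsLocalBrauerTree)
    (hl : Finsupp.linearCombination k (Γ.stdCocycle k 1) l ∈ Γ.coboundary2 k V₁)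
    {h : H} (hh : Γ.s h ∈ V₁) {i : ℕ} (h₁ : 1 ≤ i)
    (h₂ : i ≤ Γ.m (Γ.s h) - 1) : l (.B (Γ.s h) i h₁ h₂) = 0 := by
  have hi : i < Γ.m (Γ.s h) := by omega
  have hlt := Γ.mul_val_lt_len hi
  have hh' : Γ.IsArrow' V₁ h := fun e => by
    have := e.2.1
    omega
  have hh'' : Γ.IsArrow' V₁ (Γ.ι h) := fun e => (hbip h).1 hh e.1
  have hι := Γ.len_pos (Γ.ι h)
  have h7 := Γ.σ_iterate_mul_val (Γ.σ h) i
  rw [s_σ] at h7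
  obtain ⟨n, hn⟩ := Nat.exists_eq_add_of_lt hlt
  have hn' : Γ.σ^[n + 1] (Γ.σ h) = Γ.σ h := by
    have h8 := Γ.σ_iterate_len_sub (Γ.σ h) (j := i * Γ.val (Γ.s h)) (by rw [len_σ]; omega)
    rwa [h7, len_σ, hn, show i * Γ.val (Γ.s h) + n + 1 - i * Γ.val (Γ.s h) = n + 1 by omega] at h8
  have hι' : Γ.σ^[Γ.len (Γ.ι h)] (Γ.σ (Γ.ι h)) = Γ.σ (Γ.ι h) := by
    rw [← Γ.len_σ (Γ.ι h), σ_iterate_len]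
  have hB : ∀ v i' h₁ h₂, Γ.pairing k (Γ.aEval k V₁ h) (Γ.P k (Γ.σ h) (n + 1))
      (Γ.stdCocycle (T := T) k 1 (.B v i' h₁ h₂)) =
      if Γ.s h = v ∧ i' * Γ.val v = i * Γ.val (Γ.s h) then 1 else 0 := by
    intro v i' h₁ h₂
    rw [pairing_apply, Γ.τ_aEval_stdB_mul_P k hbip v i' h₁ h₂ hh hh' n.succ_pos]
    congr 2
    rw [hn, eq_iff_iff]
    omega
  have hC : ∀ j hj, Γ.pairing k (Γ.aEval k V₁ h) (Γ.P k (Γ.σ h) (n + 1))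
      (Γ.stdCocycle (T := T) k 1 (.C j hj)) = 0 := fun j hj => by
    rw [pairing_apply, Γ.τ_aEval_stdC_mul_P k j hj hh hh' n.succ_pos]
  have hd : ∀ ψ ∈ Γ.cochain1 k V₁, Γ.pairing k (Γ.aEval k V₁ h) (Γ.P k (Γ.σ h) (n + 1))
      (Γ.d1 k V₁ ψ) = Γ.τ k (Γ.evalBim k ψ (Γ.nab k (Γ.σ h) (Γ.len h)) * Γ.P k (Γ.σ h) (n + 1)) -
        Γ.τ k (Γ.evalBim k ψ (Γ.nab k (Γ.σ (Γ.ι h)) (Γ.len (Γ.ι h))) *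
          Γ.P k (Γ.σ h) (n + 1)) := fun ψ hψ => by
    rw [pairing_apply, Γ.aEval_d1 k hψ hh hh', sub_mul, map_sub]
  have hd₁ : 1 < n + 1 → ∀ ψ : H → Γ.Alg k,
      Γ.τ k (Γ.evalBim k ψ (Γ.nab k (Γ.σ h) (Γ.len h)) * Γ.P k (Γ.σ h) (n + 1)) = 0 := by
    intro h1 ψ
    have := Γ.τ_evalBim_nab_len_mul_P k ψ hn' h1
    rwa [len_σ] at this
  have hd₂ : 1 < Γ.len (Γ.ι h) → ∀ ψ : H → Γ.Alg k,
      Γ.τ k (Γ.evalBim k ψ (Γ.nab k (Γ.σ (Γ.ι h)) (Γ.len (Γ.ι h))) * Γ.P k (Γ.σ h) (n + 1)) = 0 :=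
    fun h1 ψ => Γ.τ_evalBim_nab_mul_P_of_ne k ψ h1 n.succ_pos hι' hn' (Γ.σ_ι_ne h)
  -- For `n = 0` the cycle is a loop, and each of the `len h` arrows of its power contributes the
  -- same trace; hence the factor of the correction.
  obtain rfl | hn0 := n.eq_zero_or_pos
  · have hσ : Γ.σ h = h := Γ.σ_injective hn'
    have hlen := Γ.one_lt_len_ι hconn hbip hloc hσ
    have hy : Γ.IsArrow' V₁ (Γ.σ (Γ.ι h)) := Γ.isArrow'_congr (Γ.s_σ _).symm hh''
    refine Γ.coef_B_eq_zero_of_functional k hconn hbip hloc hl (ε := 1) h₁ h₂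
      (f := Γ.pairing k (Γ.aEval k V₁ h) (Γ.P k (Γ.σ h) (0 + 1)) - (Γ.len h : k) •
        Γ.pairing k (Γ.cEval k V₁ h) (Γ.P k (Γ.σ (Γ.σ (Γ.ι h))) (Γ.len (Γ.ι h) - 1)))
      (fun ψ hψ => ?_) (fun j hj => ?_) one_ne_zero fun v i' h₁ h₂ => ?_
    · have h9 := Γ.τ_evalBim_nab_mul_P_of_fixed k ψ hσ (Γ.len h) (0 + 1)
      rw [show Γ.len h - 1 + (0 + 1) = Γ.len h by omega] at h9
      rw [LinearMap.sub_apply, hd ψ hψ, hd₂ hlen, LinearMap.smul_apply, pairing_apply,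
        Γ.τ_cEval_d1_mul_P k hbip hψ hh' hy (by omega), Nat.sub_add_cancel hι, P_len_σ_ι, hσ, h9,
        smul_eq_mul, sub_zero, sub_self]
    · rw [LinearMap.sub_apply, hC, LinearMap.smul_apply, pairing_apply, cEval_stdC, zero_mul,
        map_zero, smul_zero, sub_zero]
    · rw [LinearMap.sub_apply, hB, LinearMap.smul_apply, pairing_apply, cEval_stdB, zero_mul,
        map_zero, smul_zero, sub_zero]
  -- If the full V₂-cycle is a single arrow, its derivative is the value of ψ there, which pairs
  -- with the complement around V₁ in a possibly nonzero way.
  · obtain h1 | h1 : Γ.len (Γ.ι h) = 1 ∨ 1 < Γ.len (Γ.ι h) := by omega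
    · have hσ : Γ.σ (Γ.ι h) = Γ.ι h := Γ.σ_eq_self_iff.2 (Γ.len_eq_one_iff.1 h1).2
      have hy : Γ.IsArrow' V₁ (Γ.σ (Γ.ι (Γ.ι h))) := by
        rw [ι_ι]
        exact Γ.isArrow'_congr (Γ.s_σ _).symm hh'
      refine Γ.coef_B_eq_zero_of_functional k hconn hbip hloc hl (ε := 1) h₁ h₂
        (f := Γ.pairing k (Γ.aEval k V₁ h) (Γ.P k (Γ.σ h) (n + 1)) +
          Γ.pairing k (Γ.cEval k V₁ (Γ.ι h)) (Γ.P k (Γ.σ (Γ.σ (Γ.ι (Γ.ι h)))) n))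
        (fun ψ hψ => ?_) (fun j hj => ?_) one_ne_zero fun v i' h₁ h₂ => ?_
      · rw [LinearMap.add_apply, hd ψ hψ, hd₁ (by omega), pairing_apply,
          Γ.τ_cEval_d1_mul_P k hbip hψ hh'' hy hn0, h1, hσ, Γ.evalBim_nab_one k hψ, ι_ι, zero_sub,
          neg_add_cancel]
      · rw [LinearMap.add_apply, hC, pairing_apply, cEval_stdC, zero_mul, map_zero, add_zero]
      · rw [LinearMap.add_apply, hB, pairing_apply, cEval_stdB, zero_mul, map_zero, add_zero]
    · exact Γ.coef_B_eq_zero_of_functional k hconn hbip hloc hl h₁ h₂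
        (fun ψ hψ => by rw [hd ψ hψ, hd₁ (by omega), hd₂ h1, sub_zero]) hC one_ne_zero hB

/-- The coefficient is extracted from one tip (b). The exceptional case is a loop with `i = m - 1`:
there the path in question is the socle element, and the `len h + 1` equal contributions of a
coboundary are cancelled by means of a tip (c). -/
theorem coef_B_eq_zero_of_not_mem [CharZero k] (hconn : Γ.IsConnected) (hbip : Γ.IsBipartition V₁)
    (hloc : ¬ Γ.IsLocalBrauerTree)
    (hl : Finsupp.linearCombination k (Γ.stdCocycle k 1) l ∈ Γ.coboundary2 k V₁)
    {h : H} (hh : Γ.s h ∉ V₁) {i : ℕ} (h₁ : 1 ≤ i)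
    (h₂ : i ≤ Γ.m (Γ.s h) - 1) : l (.B (Γ.s h) i h₁ h₂) = 0 := by
  have hi : i < Γ.m (Γ.s h) := by omega
  have hlt := Γ.mul_val_lt_len hi
  obtain h1 | h1 : i * Γ.val (Γ.s h) + 1 = Γ.len h ∨ i * Γ.val (Γ.s h) + 1 < Γ.len h := by omega
  · have hσ : Γ.σ h = h := by
      have h2 := Γ.σ_iterate_len h
      rwa [← h1, Function.iterate_succ_apply', σ_iterate_mul_val] at h2
    have hlen := Γ.one_lt_len_ι hconn hbip hloc hσ
    have hx : Γ.IsArrow' V₁ h := fun e => hh e.1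
    have hy : Γ.IsArrow' V₁ (Γ.σ (Γ.ι h)) :=
      Γ.isArrow'_of_lt (by rwa [len_σ])
    refine Γ.coef_B_eq_zero_of_functional k hconn hbip hloc hl (ε := -1) h₁ h₂
      (f := Γ.pairing k (Γ.bEval k V₁ h) 1 - (Γ.len h + 1 : k) •
        Γ.pairing k (Γ.cEval k V₁ h) (Γ.P k (Γ.σ (Γ.σ (Γ.ι h))) (Γ.len (Γ.ι h) - 1)))
      (fun ψ hψ => ?_) (fun j hj => ?_) (neg_ne_zero.2 one_ne_zero) fun v i' h₁ h₂ => ?_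
    · rw [LinearMap.sub_apply, LinearMap.smul_apply, pairing_apply, pairing_apply, mul_one,
        Γ.τ_bEval_d1_of_fixed k hψ hh hσ, Γ.τ_cEval_d1_mul_P k hbip hψ hx hy (by omega),
        Nat.sub_add_cancel hlen.le, P_len_σ_ι, hσ, smul_eq_mul, sub_self]
    · rw [LinearMap.sub_apply, LinearMap.smul_apply, pairing_apply, pairing_apply, cEval_stdC,
        Γ.bEval_stdC k j hj hh, zero_mul, zero_mul, map_zero, smul_zero, sub_zero]
    · rw [LinearMap.sub_apply, LinearMap.smul_apply, pairing_apply, pairing_apply, cEval_stdB,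
        zero_mul, map_zero, smul_zero, sub_zero, mul_one, Γ.bEval_stdB k v i' h₁ h₂ hh]
      by_cases e : Γ.s h = v
      · subst e
        rw [if_pos rfl, map_neg, τ_P, ← h1]
        simp only [true_and, Nat.add_right_cancel_iff]
        split_ifs
        · rfl
        · exact neg_zero
      · rw [if_neg e, if_neg (fun h => e h.1), map_zero]
  · refine Γ.coef_B_eq_zero_of_functional k hconn hbip hloc hl (ε := -1) h₁ h₂
      (f := Γ.pairing k (Γ.bEval k V₁ h) (Γ.P k (Γ.σ h) (Γ.len h - 1 - i * Γ.val (Γ.s h))))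
      (fun ψ hψ => Γ.τ_bEval_d1_mul_P k hψ hh (Γ.σ_iterate_mul_val h i) h1) (fun j hj => ?_)
      (neg_ne_zero.2 one_ne_zero) fun v i' h₁ h₂ => ?_
    · rw [pairing_apply, Γ.bEval_stdC k j hj hh, zero_mul, map_zero]
    · rw [pairing_apply, Γ.τ_bEval_stdB_mul_P k v i' h₁ h₂ hh]
      congr 2
      rw [eq_iff_iff]
      omega

theorem coef_B_eq_zero [CharZero k] (hconn : Γ.IsConnected) (hbip : Γ.IsBipartition V₁)
    (hloc : ¬ Γ.IsLocalBrauerTree)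
    (hl : Finsupp.linearCombination k (Γ.stdCocycle k 1) l ∈ Γ.coboundary2 k V₁)
    (v : V) (i : ℕ) (h₁ : 1 ≤ i) (h₂ : i ≤ Γ.m v - 1) :
    l (.B v i h₁ h₂) = 0 := by
  obtain ⟨h, rfl⟩ := Γ.s_surjective v
  by_cases hh : Γ.s h ∈ V₁
  · exact Γ.coef_B_eq_zero_of_mem k hconn hbip hloc hl hh h₁ h₂
  · exact Γ.coef_B_eq_zero_of_not_mem k hconn hbip hloc hl hh h₁ h₂

theorem τ_aEval_linearCombination [CharZero k] (hconn : Γ.IsConnected) (hbip : Γ.IsBipartition V₁)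
    (hloc : ¬ Γ.IsLocalBrauerTree)
    (hl : Finsupp.linearCombination k (Γ.stdCocycle k 1) l ∈ Γ.coboundary2 k V₁)
    {h : H} (hh : Γ.s h ∈ V₁)
    (hh' : Γ.IsArrow' V₁ h) :
    Γ.τ k (Γ.aEval k V₁ h (Finsupp.linearCombination k (Γ.stdCocycle k 1) l)) =
      if hj : Γ.edge h ∈ T then 0 else l (.C (Γ.edge h) hj) := by
  have h0 : ∀ y, (∀ hj, y ≠ .C (Γ.edge h) hj) →
      l y • Γ.τ k (Γ.aEval k V₁ h (Γ.stdCocycle k 1 y)) = 0 := by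
    intro y hy
    cases y with
    | A => rw [Γ.coef_A_eq_zero k hconn hbip hloc hl, zero_smul]
    | B => rw [Γ.coef_B_eq_zero k hconn hbip hloc hl, zero_smul]
    | C j hj =>
      rw [Γ.aEval_stdC k j hj hh hh', if_neg, map_zero, smul_zero]
      rintro rfl
      exact hy hj rfl
    | D₁ => rw [Γ.coef_D₁_eq_zero k hconn hbip hloc hl, zero_smul]
    | D₂ => rw [Γ.coef_D₂_eq_zero k hconn hbip hloc hl, zero_smul]
  rw [Finsupp.linearCombination_apply, map_finsuppSum, map_finsuppSum]
  simp only [map_smul]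
  split_ifs with hj
  · exact Finset.sum_eq_zero fun y _ => h0 y fun hj' => absurd hj hj'
  · rw [Finsupp.sum_eq_single (.C (Γ.edge h) hj)]
    · rw [Γ.aEval_stdC k _ hj hh hh', if_pos rfl, τ_P, len_σ, if_pos rfl, smul_eq_mul, mul_one]
    · exact fun y _ hy => h0 y fun _ => hy
    · exact fun _ => zero_smul _ _

/-- The other coefficients being zero, the traces on the tips (a) are the coefficients of type (C),
and zero on T. For a coboundary they are differences of a function of the vertices, which is
therefore constant along the tree. -/
theorem coef_C_eq_zero [CharZero k] (hconn : Γ.IsConnected) (hbip : Γ.IsBipartition V₁)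
    (hloc : ¬ Γ.IsLocalBrauerTree)
    (hl : Finsupp.linearCombination k (Γ.stdCocycle k 1) l ∈ Γ.coboundary2 k V₁)
    (hT : Γ.IsSpanningTree T) (j : Γ.Edge) (hj : j ∉ T) :
    l (.C j hj) = 0 := by
  obtain ⟨ψ, hψ, e⟩ := (Γ.mem_coboundary2 k V₁).1 hl
  let X (h : H) : k := Γ.τ k (Γ.evalBim k ψ (Γ.nab k (Γ.σ h) (Γ.len h)))
  have hX : ∀ {h h'}, Γ.s h = Γ.s h' → X h' = X h := fun e => Γ.eq_of_forall_σ e fun x _ => by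
    have h1 := Γ.τ_evalBim_nab_len_σ k ψ (Γ.σ x)
    simp only [X]
    rw [len_σ] at h1 ⊢
    exact h1
  have hd : ∀ h, Γ.s h ∈ V₁ → Γ.IsArrow' V₁ h → X h - X (Γ.ι h) =
      if hj : Γ.edge h ∈ T then 0 else l (.C (Γ.edge h) hj) := fun h hh hh' => by
    rw [← Γ.τ_aEval_linearCombination k hconn hbip hloc hl hh hh', ← e, Γ.aEval_d1 k hψ hh hh',
      map_sub]
  have hfix : ∀ {h h'}, ¬ Γ.IsArrow' V₁ h → Γ.s h = Γ.s h' → h' = h := fun hh e => by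
    obtain ⟨n, rfl⟩ := Γ.exists_σ_iterate_eq e
    exact Function.iterate_fixed (Γ.len_eq_one_of_not_isArrow' hh).2 n
  choose g hg using Γ.s_surjective
  -- A truncated vertex of V₁ carries no tip (a) and hence no equation; it is given the value of its
  -- only neighbour, so that constancy along that edge is automatic.
  let Y (v : V) : k := if Γ.IsArrow' V₁ (g v) then X (g v) else X (Γ.ι (g v))
  have hY : ∀ h, Y (Γ.s h) = if Γ.IsArrow' V₁ h then X h else X (Γ.ι h) := fun h => by
    by_cases hh : Γ.IsArrow' V₁ h
    · rw [if_pos hh]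
      simp only [Y]
      rw [if_pos (Γ.isArrow'_congr (hg _).symm hh)]
      exact hX (hg _).symm
    · simp only [Y]
      rw [hfix hh (hg _).symm]
  have hY₂ : ∀ h, Γ.s h ∈ V₁ → Y (Γ.s (Γ.ι h)) = X (Γ.ι h) := fun h hh => by
    rw [hY, if_pos]
    exact fun e => (hbip h).1 hh e.1
  have hYT : ∀ h, Γ.s h ∈ V₁ → Γ.edge h ∈ T → Y (Γ.s h) = Y (Γ.s (Γ.ι h)) := fun h hh hT' => by
    rw [hY₂ h hh, hY]
    split_ifs with hh'
    · have h1 := hd h hh hh'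
      rwa [dif_pos hT', sub_eq_zero] at h1
    · rfl
  have hconst := Γ.eq_of_isSpanningTree hT (X := Y) fun h hT' => by
    by_cases hh : Γ.s h ∈ V₁
    · exact hYT h hh hT'
    · have hh' : Γ.s (Γ.ι h) ∈ V₁ := by
        rw [hbip, ι_ι]
        exact hh
      have h1 := hYT (Γ.ι h) hh' (by rwa [edge_ι])
      rw [ι_ι] at h1
      exact h1.symm
  obtain ⟨h, rfl, hh⟩ := Γ.exists_edge_eq_of_mem hbip j
  have hh' : Γ.IsArrow' V₁ h := by
    -- The only edge at a truncated vertex belongs to T: otherwise the indicator of this vertex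
    -- would be constant along the edges of T without being constant.
    by_contra hh'
    have h1 := Γ.eq_of_isSpanningTree hT (X := fun v => v = Γ.s h) (fun h' hT' => by
      have h2 : ∀ h', Γ.edge h' ∈ T → Γ.s h' ≠ Γ.s h := by
        rintro h' hT' e'
        rw [hfix hh' e'.symm] at hT'
        exact hj hT'
      exact (eq_false (h2 h' hT')).trans
        (eq_false (h2 (Γ.ι h') (by rwa [edge_ι]))).symm) (Γ.s h) (Γ.s (Γ.ι h))
    exact (hbip h).1 hh ((h1.mp rfl).symm ▸ hh)
  have h1 := hd h hh hh'
  rw [dif_neg hj] at h1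
  have h2 := hconst (Γ.s h) (Γ.s (Γ.ι h))
  rw [hY₂ h hh, hY, if_pos hh'] at h2
  rw [← h1, h2, sub_self]

theorem eq_zero_of_linearCombination_mem_coboundary2 [CharZero k] (hconn : Γ.IsConnected)
    (hbip : Γ.IsBipartition V₁) (hloc : ¬ Γ.IsLocalBrauerTree)
    (hl : Finsupp.linearCombination k (Γ.stdCocycle k 1) l ∈ Γ.coboundary2 k V₁)
    (hT : Γ.IsSpanningTree T) :
    l = 0 := by
  ext y
  cases y with
  | A => exact Γ.coef_A_eq_zero k hconn hbip hloc hl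
  | B => exact Γ.coef_B_eq_zero k hconn hbip hloc hl _ _ _ _
  | C => exact Γ.coef_C_eq_zero k hconn hbip hloc hl hT _ _
  | D₁ => exact Γ.coef_D₁_eq_zero k hconn hbip hloc hl _
  | D₂ => exact Γ.coef_D₂_eq_zero k hconn hbip hloc hl _

theorem stdCocycle_smul (r : k) (x : Γ.StdIndex V₁ T) :
    Γ.stdCocycle k r x = r • Γ.stdCocycle k 1 x := by
  cases x with
  | A => exact Γ.stdA_smul k r
  | B v i =>
    simp only [stdCocycle]
    split_ifs
    · exact Γ.stdB₁_smul k r v i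
    · exact Γ.stdB₂_smul k r v i
  | C j => exact Γ.stdC_smul k r j
  | D₁ b => exact Γ.stdD₁_smul k r _ _
  | D₂ b => exact Γ.stdD₂_smul k r _ _

theorem exists_basis_H2 [Finite V] [CharZero k] (hconn : Γ.IsConnected)
    (hbip : Γ.IsBipartition V₁) (hloc : ¬ Γ.IsLocalBrauerTree) (hT : Γ.IsSpanningTree T)
    (r : Γ.StdIndex V₁ T → k) (hr : ∀ x, r x ≠ 0) :
    ∃ b : Module.Basis (Γ.StdIndex V₁ T) k (Γ.H2 k V₁),
      ∀ x, ∃ hx : Γ.stdCocycle k (r x) x ∈ Γ.cocycle2 k V₁,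
        b x = Submodule.Quotient.mk ⟨Γ.stdCocycle k (r x) x, hx⟩ := by
  have hmem := fun (r : k) (x : Γ.StdIndex V₁ T) => Γ.stdCocycle_mem k hconn hbip hloc r x
  let c (x : Γ.StdIndex V₁ T) : Γ.cocycle2 k V₁ := ⟨Γ.stdCocycle k 1 x, hmem 1 x⟩
  let W := (Γ.coboundary2 k V₁).submoduleOf (Γ.cocycle2 k V₁)
  have hW : ∀ y, y ∈ W ↔ (y : Γ.Tip V₁ → Γ.Alg k) ∈ Γ.coboundary2 k V₁ := fun _ => Iff.rfl
  have hc : ∀ l : Γ.StdIndex V₁ T →₀ k, (Finsupp.linearCombination k c l : Γ.Tip V₁ → Γ.Alg k) =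
      Finsupp.linearCombination k (Γ.stdCocycle k 1) l := fun l =>
    Finsupp.apply_linearCombination k (Γ.cocycle2 k V₁).subtype c l
  have hli : LinearIndependent k (W.mkQ ∘ c) := by
    rw [linearIndependent_iff]
    intro l hl
    rw [← Finsupp.apply_linearCombination, Submodule.mkQ_apply, Submodule.Quotient.mk_eq_zero,
      hW, hc] at hl
    exact Γ.eq_zero_of_linearCombination_mem_coboundary2 k hconn hbip hloc hl hT
  have hsp : ⊤ ≤ Submodule.span k (Set.range (W.mkQ ∘ c)) := by
    rintro q -
    obtain ⟨⟨φ, hφ⟩, rfl⟩ := Submodule.mkQ_surjective W q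
    have hφ' := hφ
    rw [Γ.cocycle2_eq_stdSpan k hconn hbip hloc hT] at hφ'
    obtain ⟨u, hu, w, hw, rfl⟩ := Submodule.mem_sup.1 hφ'
    rw [← Finsupp.range_linearCombination] at hw ⊢
    obtain ⟨l, rfl⟩ := hw
    refine ⟨l, ?_⟩
    rw [← Finsupp.apply_linearCombination]
    refine ((Submodule.Quotient.eq W).2 ?_).symm
    rw [hW, Submodule.coe_sub, hc, add_sub_cancel_right]
    exact hu
  refine ⟨(Module.Basis.mk hli hsp).isUnitSMul fun x => (hr x).isUnit, fun x => ⟨hmem _ x, ?_⟩⟩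
  rw [Module.Basis.isUnitSMul_apply, Module.Basis.mk_apply, Function.comp_apply, ← map_smul,
    Submodule.mkQ_apply]
  exact congrArg _ (Subtype.ext (Γ.stdCocycle_smul k (r x) x).symm)

end Basis

end BrauerGraph

theorem mainTheorem2 {k V H : Type*} [Field k] [IsAlgClosed k] [CharZero k] [Finite V] [Finite H]
    (Γ : BrauerGraph V H) (hconn : Γ.IsConnected)
    (V₁ : Set V) (hbip : Γ.IsBipartition V₁) (hloc : ¬ Γ.IsLocalBrauerTree)
    (T : Set Γ.Edge) (hT : Γ.IsSpanningTree T)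
    (r : Γ.StdIndex V₁ T → k) (hr : ∀ x, r x ≠ 0) :
    (∃ Φ : HH2 k (Γ.Alg k) ≃ₗ[k] Γ.H2 k V₁,
      (∀ f : hochschildZ2 k (Γ.Alg k), ∃ hf : Γ.comparison k V₁ f.1 ∈ Γ.cocycle2 k V₁,
        Φ (Submodule.Quotient.mk f) = Submodule.Quotient.mk ⟨Γ.comparison k V₁ f.1, hf⟩) ∧
      ∃ b : Module.Basis (Γ.StdIndex V₁ T) k (HH2 k (Γ.Alg k)),
        ∀ x, ∃ hx : Γ.stdCocycle k (r x) x ∈ Γ.cocycle2 k V₁,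
          Φ (b x) = Submodule.Quotient.mk ⟨Γ.stdCocycle k (r x) x, hx⟩) ∧
    Nat.card {j : Γ.Edge // j ∉ T} + Nat.card V = Nat.card Γ.Edge + 1 := by
  obtain ⟨Φ, hΦ⟩ := Γ.exists_comparison_equiv k hbip
  obtain ⟨b, hb⟩ := Γ.exists_basis_H2 k hconn hbip hloc hT r hr
  refine ⟨⟨Φ, hΦ, b.map Φ.symm, fun x => ?_⟩, Γ.card_compl_add_card_of_isSpanningTree hT⟩
  obtain ⟨hx, e⟩ := hb x
  exact ⟨hx, by rw [Module.Basis.map_apply, LinearEquiv.apply_symm_apply, e]⟩
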